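/- A fixed pricing market has $n$ buyers and $m$ divisible items, each of unit supply and owned by some seller. Buyer $i$ has a budget $B_i\ge 0$, a value $v_{i,j}\ge 0$ for item $j$ and a personalized price $p_{i,j}\ge 0$ for item $j$. Each item $j$ carries an arbitrary total preorder $\ge_j$ on the buyers (its priority). The bang-per-buck of item $j$ for buyer $i$ is $v_{i,j}/p_{i,j}$, which is $+\infty$ if $v_{i,j}>0=p_{i,j}$. An allocation is a matrix $x\in[0,1]^{n\times m}$ with $\sum_i x_{i,j}\le 1$ for every $j$. Let $r_i=\min_{j:x_{i,j}>0} v_{i,j}/p_{i,j}$ (with $r_i=+\infty$ if buyer $i$ buys nothing). The allocation $x$ is stable if for every buyer $i$: (1) $\sum_j p_{i,j}x_{i,j}\le B_i$; (2) $x_{i,j}>0$ implies $v_{i,j}>0$; (3) for every item $j$ with $v_{i,j}>0$ and $x_{i,j}<1$, either (a) $v_{i,j}/p_{i,j}\le r_i$ and $\sum_{j'}p_{i,j'}x_{i,j'}=B_i$, or (b) $\sum_{i'}x_{i',j}=1$ and $i'\ge_j i$ for every buyer $i'\ne i$ with $x_{i',j}>0$. **Theorem.** Every fixed pricing market has a stable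 allocation, and one can be computed in strongly polynomial time. If all inputs are rational numbers, then a stable allocation all of whose entries are rational can be computed in polynomial time. Precisely, there is a single random access program whose input consists of $n$, $m$, the numbers $v_{i,j}$, $p_{i,j}$, $B_i$ and the tables of the relations $\ge_j$; whose operations are addition and truncated subtraction of natural-number indices, the four arithmetic operations on field elements, comparisons, and reading and writing memory; and which has the following properties. On every market with real data it halts with a stable allocation as output, after a number of elementary operations bounded by a polynomial in $n+m$. On every market with rational data, where the program computes in $\mathbb{Q}$, it halts with a stable allocation with rational entries as output, and its total bit cost (each operation being charged the bit lengths of the numbers involved) is bounded by a polynomial in the bit length of the input. -/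

import Mathlib

open scoped ENNReal

/-! ## Fixed pricing markets and stable allocations -/

/-- A linear Fisher market with `n` buyers and `m` divisible items of unit supply, whose items are
owned by sellers, together with the personalized prices and the priorities the sellers have chosen.
All numbers are taken from the ordered field `K`. -/
structure FixedPricingMarket (K : Type) [Field K] [LinearOrder K] (n m : ℕ) where
  /-- the number of sellers -/
  sellers : ℕ
  /-- the seller who owns an item -/
  owner : Fin m → Fin sellers
  /-- `value i j` is the value of item `j` to buyer `i` -/
  value : Fin n → Fin m → K
  /-- `price i j` is the price of item `j` for buyer `i` -/
  price : Fin n → Fin m → K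
  /-- `budget i` is the budget of buyer `i` -/
  budget : Fin n → K
  /-- `priority j i i'` says that item `j` gives buyer `i` at least the priority of buyer `i'` -/
  priority : Fin m → Fin n → Fin n → Prop
  value_nonneg : ∀ i j, 0 ≤ value i j
  price_nonneg : ∀ i j, 0 ≤ price i j
  budget_nonneg : ∀ i, 0 ≤ budget i
  priority_total : ∀ j i i', priority j i i' ∨ priority j i' i
  priority_trans : ∀ j i₁ i₂ i₃, priority j i₁ i₂ → priority j i₂ i₃ → priority j i₁ i₃

namespace FixedPricingMarket

/-- A market with rational data, viewed as a market with real data. -/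
def toReal {n m : ℕ} (M : FixedPricingMarket ℚ n m) : FixedPricingMarket ℝ n m where
  sellers := M.sellers
  owner := M.owner
  value i j := (M.value i j : ℝ)
  price i j := (M.price i j : ℝ)
  budget i := (M.budget i : ℝ)
  priority := M.priority
  value_nonneg i j := by exact_mod_cast M.value_nonneg i j
  price_nonneg i j := by exact_mod_cast M.price_nonneg i j
  budget_nonneg i := by exact_mod_cast M.budget_nonneg i
  priority_total := M.priority_total
  priority_trans := M.priority_trans

variable {n m : ℕ} (M : FixedPricingMarket ℝ n m) (x : Fin n → Fin m → ℝ)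

/-- The bang-per-buck of item `j` for buyer `i`. It is infinite for a free item of positive
value. -/
noncomputable def bangPerBuck (i : Fin n) (j : Fin m) : ℝ≥0∞ :=
  ENNReal.ofReal (M.value i j) / ENNReal.ofReal (M.price i j)

/-- The minimum bang-per-buck among the items bought by buyer `i`
(infinite if buyer `i` buys nothing). -/
noncomputable def minBangPerBuck (i : Fin n) : ℝ≥0∞ :=
  ⨅ (j : Fin m) (_ : 0 < x i j), M.bangPerBuck i j

/-- The money spent by buyer `i`. -/
noncomputable def spending (i : Fin n) : ℝ :=
  ∑ j, x i j * M.price i j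

/-- `x i j` is the fraction of item `j` allocated to buyer `i`. -/
structure IsAllocation {n m : ℕ} (x : Fin n → Fin m → ℝ) : Prop where
  nonneg : ∀ i j, 0 ≤ x i j
  le_one : ∀ i j, x i j ≤ 1
  supply : ∀ j, ∑ i, x i j ≤ 1

/-- Stability of an allocation for buyer `i`. -/
structure StableFor (i : Fin n) : Prop where
  /-- buyer `i` does not exceed its budget -/
  budget_feasible : M.spending x i ≤ M.budget i
  /-- buyer `i` buys only items that it values -/
  valued : ∀ j, 0 < x i j → 0 < M.value i j
  /-- of an item that it values, buyer `i` could take more only by giving up money that it spends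
  at least as well, or by displacing a buyer of at least its own priority -/
  no_deviation : ∀ j, 0 < M.value i j → x i j < 1 →
    (M.bangPerBuck i j ≤ M.minBangPerBuck x i ∧ M.spending x i = M.budget i) ∨
    (∑ i', x i' j = 1 ∧ ∀ i', i' ≠ i → 0 < x i' j → M.priority j i' i)

/-- `x` is a stable allocation of the market. -/
def IsStableAllocation : Prop :=
  IsAllocation x ∧ ∀ i, M.StableFor x i

end FixedPricingMarket

/-! ## Random access programs over an ordered field, with running times

A program works on two random access memories: one holds natural numbers, which serve as
indices and counters, the other holds elements of an ordered field `K`. Each memory consists of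
arrays with three indices; a program mentions finitely many of them. The elementary operations
are addition and truncated subtraction of natural numbers, the four arithmetic operations of `K`,
and comparisons. There is no operation that turns elements of `K` into natural numbers. -/

namespace RandomAccess

/-- The contents of the two memories: array, then three indices. -/
structure Store (K : Type) where
  idx : ℕ → ℕ → ℕ → ℕ → ℕ
  val : ℕ → ℕ → ℕ → ℕ → K

/-- Overwrite one cell of a memory. -/
def writeCell {α : Type} (f : ℕ → ℕ → ℕ → ℕ → α) (a i j k : ℕ) (v : α) :
    ℕ → ℕ → ℕ → ℕ → α :=
  fun a' i' j' k' => if a' = a ∧ i' = i ∧ j' = j ∧ k' = k then v else f a' i' j' k'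

/-- Expressions for natural numbers. -/
inductive IdxExpr where
  | lit (c : ℕ)
  | read (a : ℕ) (i j k : IdxExpr)
  | add (e f : IdxExpr)
  | sub (e f : IdxExpr)

/-- Expressions for field elements. -/
inductive ValExpr where
  | lit (c : ℤ)
  | read (a : ℕ) (i j k : IdxExpr)
  | add (e f : ValExpr)
  | sub (e f : ValExpr)
  | mul (e f : ValExpr)
  | div (e f : ValExpr)

/-- Conditions. -/
inductive Test where
  | idxLe (e f : IdxExpr)
  | valLe (e f : ValExpr)
  | neg (b : Test)
  | conj (b c : Test)

/-- Programs. -/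
inductive Program where
  | skip
  | writeIdx (a : ℕ) (i j k : IdxExpr) (e : IdxExpr)
  | writeVal (a : ℕ) (i j k : IdxExpr) (e : ValExpr)
  | seq (P Q : Program)
  | branch (b : Test) (P Q : Program)
  | loop (b : Test) (P : Program)

/-- What an elementary operation is charged, in terms of its result. -/
structure CostModel (K : Type) where
  idx : ℕ → ℕ
  val : K → ℕ

/-- Every elementary operation is charged one unit. -/
def unitCost (K : Type) : CostModel K where
  idx _ := 1
  val _ := 1

/-- The number of bits of a natural number, plus one. -/
def natBits (c : ℕ) : ℕ := c.size + 1

/-- The number of bits of the reduced fraction of a rational number, sign included. -/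
def ratBits (q : ℚ) : ℕ := q.num.natAbs.size + q.den.size + 1

/-- Every elementary operation is charged the number of bits of its result (its operands being
charged where they are produced). -/
def bitCost : CostModel ℚ where
  idx := natBits
  val := ratBits

section Semantics

variable {K : Type} [Field K] [LinearOrder K] (C : CostModel K) (s : Store K)

/-- The value of an expression. -/
def IdxExpr.eval : IdxExpr → ℕ
  | .lit c => c
  | .read a i j k => s.idx a i.eval j.eval k.eval
  | .add e f => e.eval + f.eval
  | .sub e f => e.eval - f.eval

/-- The charge for evaluating an expression. -/
def IdxExpr.cost : IdxExpr → ℕ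
  | .lit c => C.idx c
  | .read a i j k =>
      i.cost + j.cost + k.cost + C.idx (s.idx a (i.eval s) (j.eval s) (k.eval s))
  | .add e f => e.cost + f.cost + C.idx (e.eval s + f.eval s)
  | .sub e f => e.cost + f.cost + C.idx (e.eval s - f.eval s)

/-- The value of an expression. Division by zero returns zero. -/
def ValExpr.eval : ValExpr → K
  | .lit c => (c : K)
  | .read a i j k => s.val a (i.eval s) (j.eval s) (k.eval s)
  | .add e f => e.eval + f.eval
  | .sub e f => e.eval - f.eval
  | .mul e f => e.eval * f.eval
  | .div e f => e.eval / f.eval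

/-- The charge for evaluating an expression. -/
def ValExpr.cost : ValExpr → ℕ
  | .lit c => C.val (c : K)
  | .read a i j k =>
      i.cost C s + j.cost C s + k.cost C s + C.val (s.val a (i.eval s) (j.eval s) (k.eval s))
  | .add e f => e.cost + f.cost + C.val (e.eval s + f.eval s)
  | .sub e f => e.cost + f.cost + C.val (e.eval s - f.eval s)
  | .mul e f => e.cost + f.cost + C.val (e.eval s * f.eval s)
  | .div e f => e.cost + f.cost + C.val (e.eval s / f.eval s)

/-- The truth of a condition. -/
def Test.Holds : Test → Prop
  | .idxLe e f => e.eval s ≤ f.eval s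
  | .valLe e f => e.eval s ≤ f.eval s
  | .neg b => ¬ b.Holds
  | .conj b c => b.Holds ∧ c.Holds

/-- The charge for evaluating a condition. -/
def Test.cost : Test → ℕ
  | .idxLe e f => e.cost C s + f.cost C s + 1
  | .valLe e f => e.cost C s + f.cost C s + 1
  | .neg b => b.cost + 1
  | .conj b c => b.cost + c.cost + 1

/-- `Exec C P s t c`: started on `s`, the program `P` terminates with memory contents `t`, after
operations of total charge `c`. -/
inductive Exec (C : CostModel K) : Program → Store K → Store K → ℕ → Prop where
  | skip (s : Store K) : Exec C .skip s s 1
  | writeIdx (s : Store K) (a : ℕ) (i j k e : IdxExpr) :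
      Exec C (.writeIdx a i j k e) s
        { s with idx := writeCell s.idx a (i.eval s) (j.eval s) (k.eval s) (e.eval s) }
        (i.cost C s + j.cost C s + k.cost C s + e.cost C s + 1)
  | writeVal (s : Store K) (a : ℕ) (i j k : IdxExpr) (e : ValExpr) :
      Exec C (.writeVal a i j k e) s
        { s with val := writeCell s.val a (i.eval s) (j.eval s) (k.eval s) (e.eval s) }
        (i.cost C s + j.cost C s + k.cost C s + e.cost C s + 1)
  | seq {P Q : Program} {s t u : Store K} {c d : ℕ} (hP : Exec C P s t c)
      (hQ : Exec C Q t u d) : Exec C (.seq P Q) s u (c + d)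
  | branch_true {b : Test} {P : Program} (Q : Program) {s t : Store K} {c : ℕ}
      (hb : b.Holds s) (hP : Exec C P s t c) :
      Exec C (.branch b P Q) s t (b.cost C s + c + 1)
  | branch_false {b : Test} (P : Program) {Q : Program} {s t : Store K} {c : ℕ}
      (hb : ¬ b.Holds s) (hQ : Exec C Q s t c) :
      Exec C (.branch b P Q) s t (b.cost C s + c + 1)
  | loop_done {b : Test} (P : Program) {s : Store K} (hb : ¬ b.Holds s) :
      Exec C (.loop b P) s s (b.cost C s + 1)
  | loop_step {b : Test} {P : Program} {s t u : Store K} {c d : ℕ} (hb : b.Holds s)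
      (hP : Exec C P s t c) (hL : Exec C (.loop b P) t u d) :
      Exec C (.loop b P) s u (b.cost C s + c + d + 1)

/-- The outcome and the total charge of a program are determined by its start. -/
theorem Exec.deterministic {C : CostModel K} {P : Program} {s t t' : Store K} {c c' : ℕ}
    (h : Exec C P s t c) (h' : Exec C P s t' c') : t = t' ∧ c = c' := by
  induction h generalizing t' c' with
  | skip s => cases h'; exact ⟨rfl, rfl⟩
  | writeIdx s a i j k e => cases h'; exact ⟨rfl, rfl⟩
  | writeVal s a i j k e => cases h'; exact ⟨rfl, rfl⟩
  | seq hP hQ ihP ihQ =>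
    cases h' with
    | seq hP' hQ' =>
      obtain ⟨rfl, rfl⟩ := ihP hP'
      obtain ⟨rfl, rfl⟩ := ihQ hQ'
      exact ⟨rfl, rfl⟩
  | branch_true Q hb hP ih =>
    cases h' with
    | branch_true _ _ hP' => obtain ⟨rfl, rfl⟩ := ih hP'; exact ⟨rfl, rfl⟩
    | branch_false _ hb' _ => exact absurd hb hb'
  | branch_false P hb hQ ih =>
    cases h' with
    | branch_true _ hb' _ => exact absurd hb' hb
    | branch_false _ _ hQ' => obtain ⟨rfl, rfl⟩ := ih hQ'; exact ⟨rfl, rfl⟩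
  | loop_done P hb =>
    cases h' with
    | loop_done _ _ => exact ⟨rfl, rfl⟩
    | loop_step hb' _ _ => exact absurd hb' hb
  | loop_step hb hP hL ihP ihL =>
    cases h' with
    | loop_done _ hb' => exact absurd hb hb'
    | loop_step _ hP' hL' =>
      obtain ⟨rfl, rfl⟩ := ihP hP'
      obtain ⟨rfl, rfl⟩ := ihL hL'
      exact ⟨rfl, rfl⟩

end Semantics

end RandomAccess

/-! ## Markets as inputs of programs -/

namespace FixedPricingMarket

open Classical in
/-- The initial memory contents for a market. Array `0` of the memory for natural numbers holds
`n` and `m`, array `1` the tables of the priorities (one for true, zero for false); arrays `0`,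
`1`, `2` of the memory for field elements hold the values, the prices and the budgets. All other
cells hold zero. -/
noncomputable def input {K : Type} [Field K] [LinearOrder K] {n m : ℕ}
    (M : FixedPricingMarket K n m) : RandomAccess.Store K where
  idx a i j k :=
    if a = 0 ∧ i = 0 ∧ j = 0 ∧ k = 0 then n
    else if a = 0 ∧ i = 1 ∧ j = 0 ∧ k = 0 then m
    else if h : a = 1 ∧ i < m ∧ j < n ∧ k < n then
      if M.priority ⟨i, h.2.1⟩ ⟨j, h.2.2.1⟩ ⟨k, h.2.2.2⟩ then 1 else 0
    else 0
  val a i j k :=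
    if h : a = 0 ∧ i < n ∧ j < m ∧ k = 0 then M.value ⟨i, h.2.1⟩ ⟨j, h.2.2.1⟩
    else if h : a = 1 ∧ i < n ∧ j < m ∧ k = 0 then M.price ⟨i, h.2.1⟩ ⟨j, h.2.2.1⟩
    else if h : a = 2 ∧ i < n ∧ j = 0 ∧ k = 0 then M.budget ⟨i, h.2.1⟩
    else 0

/-- The number of bits of the input of a market with rational data: all rational numbers and the
tables of the priorities, and one bit for every buyer and every item. -/
def inputBits {n m : ℕ} (M : FixedPricingMarket ℚ n m) : ℕ :=
  n + m + m * n * n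
    + ∑ i, ∑ j, (RandomAccess.ratBits (M.value i j) + RandomAccess.ratBits (M.price i j))
    + ∑ i, RandomAccess.ratBits (M.budget i)

end FixedPricingMarket

/-- The result of a program: an `n` by `m` matrix in array `3` of the memory for field
elements. -/
def RandomAccess.Store.output {K : Type} (s : RandomAccess.Store K) (n m : ℕ) :
    Fin n → Fin m → K :=
  fun i j => s.val 3 i j 0

/-! The proof is a deferred acceptance argument with fractional offers. Two tables of flags record
the state: `A i j` says that buyer i has passed item j, that is, it is ready to take all of j and
looks further for a worse item; `R i j` says that item j has rejected buyer i. Row n of `R` belongs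
to a fictitious buyer of lowest priority, who holds the unsold part of an item. Every buyer has a
next item, the best valued one that it has not passed, and every sold-out item has a cutoff buyer,
the worst one that it has not rejected. Flags are only ever raised, so there are at most nm + (n+1)m
moves.

For fixed tables the unknowns are z_i, minus the money that buyer i offers for its next item, and
l_j, the residual fraction of item j left to its cutoff buyer. In equilibrium z_i is minus the
budget plus the payments for all other items, and l_j is one minus the demand of the other buyers.
With these signs the system y = F(y) is affine and monotone, and every unknown influences at most
one unknown: z_i only the residual of the next item, l_j only the offer of the cutoff buyer. A point
between floor and ceiling with F(y) ≤ y is feasible. If a feasible point touches its floor, a move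
is due: the buyer offers all it can and passes its next item (`Invariant.pass`), or the cutoff buyer
gets nothing and is rejected (`Invariant.reject`). In both cases an explicit change of the point is
feasible for the new tables, so feasibility is an invariant. If no feasible point touches the floor,
the least feasible point is a fixed point, and the allocation read off from it is stable
(`Invariant.stable`).

No linear programming is needed, because the influences form a functional graph. Pin the coordinate
u at θ and iterate F from the floor for N rounds; on the coordinates that lead to u this converges,
and `response` is the value then proposed for u. If the response to the floor is at most the floor,
some feasible point touches the floor at u (`exists_feasible_eq_floor`). If this happens nowhere,
the response is affine in θ above the fixed point, with slope less than one, and its values at 1 and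
2 determine the fixed point (`exists_fixedPoint_real`). The least feasible point needs the
completeness of ℝ, but the resulting formula consists of field operations and transfers to ℚ.

The program is verified in a small Hoare logic (`Run`) that also counts steps. A `Meter` abstracts
the cost model, so that one verification serves unit costs and bit costs. For the latter, every
round starts again from the input data; its iterates are fractions with denominator D^a, where D is
a common multiple built from the input and a is quadratic in n + m (`scaled_pinned`). -/

set_option linter.unusedSectionVars false

/-! ## Verification of random access programs -/

namespace RandomAccess

/-- The number of operations of an expression, literals counted with their absolute value. -/
def IdxExpr.size : IdxExpr → ℕ
  | .lit c => c + 1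
  | .read _ i j k => i.size + j.size + k.size + 1
  | .add e f => e.size + f.size + 1
  | .sub e f => e.size + f.size + 1

/-- The number of operations of an expression, literals counted with their absolute value. -/
def ValExpr.size : ValExpr → ℕ
  | .lit c => c.natAbs + 1
  | .read _ i j k => i.size + j.size + k.size + 1
  | .add e f => e.size + f.size + 1
  | .sub e f => e.size + f.size + 1
  | .mul e f => e.size + f.size + 1
  | .div e f => e.size + f.size + 1

/-- The number of operations of a condition. -/
def Test.size : Test → ℕ
  | .idxLe e f => e.size + f.size + 1
  | .valLe e f => e.size + f.size + 1
  | .neg b => b.size + 1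
  | .conj b c => b.size + c.size + 1

/-- A cost model together with bounds on the numbers in the memory, and on the charge of an
operation on such numbers. -/
structure Meter (K : Type) [Field K] [LinearOrder K] where
  cost : CostModel K
  top : ℕ
  level : ℕ
  unit : ℕ
  small : ℕ → K → Prop
  small_mono : ∀ {a b : ℕ} {x : K}, a ≤ b → small a x → small b x
  small_lit : ∀ c : ℤ, small (c.natAbs + 1) (c : K)
  small_add : ∀ {a b : ℕ} {x y : K}, small a x → small b y → small (a + b + 1) (x + y)
  small_sub : ∀ {a b : ℕ} {x y : K}, small a x → small b y → small (a + b + 1) (x - y)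
  small_mul : ∀ {a b : ℕ} {x y : K}, small a x → small b y → small (a + b + 1) (x * y)
  small_div : ∀ {a b : ℕ} {x y : K}, small a x → small b y → small (a + b + 1) (x / y)
  unit_pos : 1 ≤ unit
  idx_le : ∀ c, c ≤ 300 * (top + 1) → cost.idx c ≤ unit
  val_le : ∀ q, small (300 * (level + 1)) q → cost.val q ≤ unit

variable {K : Type} [Field K] [LinearOrder K]

/-- The numbers in the memory respect the bounds. -/
def Meter.Ok (Λ : Meter K) (s : Store K) : Prop :=
  (∀ a i j k, s.idx a i j k ≤ Λ.top) ∧ ∀ a i j k, Λ.small Λ.level (s.val a i j k)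

/-- A bound on the charge of a simple statement. -/
def Meter.step (Λ : Meter K) : ℕ := 1201 * Λ.unit

variable {Λ : Meter K} {s : Store K}

/-- Indices are only added and subtracted, never multiplied, so values grow at most linearly in the
size of the expression. Literals enter the size with their value for this reason. -/
theorem IdxExpr.eval_le (hs : Λ.Ok s) (e : IdxExpr) : e.eval s ≤ e.size * (Λ.top + 1) := by
  induction e with
  | lit c => simp only [eval, size]; nlinarith
  | read a i j k =>
    simp only [eval, size]
    have := hs.1 a (i.eval s) (j.eval s) (k.eval s)
    nlinarith
  | add e f he hf => simp only [eval, size]; nlinarith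
  | sub e f he hf => simp only [eval, size]; have := Nat.sub_le (e.eval s) (f.eval s); nlinarith

theorem IdxExpr.cost_le (hs : Λ.Ok s) (e : IdxExpr) (he : e.size ≤ 300) :
    e.cost Λ.cost s ≤ e.size * Λ.unit := by
  have hval : ∀ e : IdxExpr, e.size ≤ 300 → Λ.cost.idx (e.eval s) ≤ Λ.unit := fun e he =>
    Λ.idx_le _ ((e.eval_le hs).trans (Nat.mul_le_mul_right _ he))
  have hself := hval e he
  induction e with
  | lit c => simp only [cost, size, eval] at *; nlinarith
  | read a i j k hi hj hk =>
    simp only [size] at he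
    have h1 := hi (by omega) (hval i (by omega))
    have h2 := hj (by omega) (hval j (by omega))
    have h3 := hk (by omega) (hval k (by omega))
    simp only [cost, size, eval] at *; nlinarith
  | add e f h1 h2 =>
    simp only [size] at he
    have h1 := h1 (by omega) (hval e (by omega))
    have h2 := h2 (by omega) (hval f (by omega))
    simp only [cost, size, eval] at *; nlinarith
  | sub e f h1 h2 =>
    simp only [size] at he
    have h1 := h1 (by omega) (hval e (by omega))
    have h2 := h2 (by omega) (hval f (by omega))
    simp only [cost, size, eval] at *; nlinarith

/-- All four field operations are subadditive for `small`, up to one unit per operation; hence the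
level is multiplied by at most the size of the expression. -/
theorem ValExpr.small_eval (hs : Λ.Ok s) (e : ValExpr) :
    Λ.small (e.size * (Λ.level + 1)) (e.eval s) := by
  induction e with
  | lit c => exact Λ.small_mono (Nat.le_mul_of_pos_right _ (Nat.succ_pos _)) (Λ.small_lit c)
  | read a i j k => exact Λ.small_mono (by simp only [size]; nlinarith) (hs.2 _ _ _ _)
  | add e f he hf => exact Λ.small_mono (by simp only [size]; nlinarith) (Λ.small_add he hf)
  | sub e f he hf => exact Λ.small_mono (by simp only [size]; nlinarith) (Λ.small_sub he hf)
  | mul e f he hf => exact Λ.small_mono (by simp only [size]; nlinarith) (Λ.small_mul he hf)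
  | div e f he hf => exact Λ.small_mono (by simp only [size]; nlinarith) (Λ.small_div he hf)

theorem ValExpr.cost_le (hs : Λ.Ok s) (e : ValExpr) (he : e.size ≤ 300) :
    e.cost Λ.cost s ≤ e.size * Λ.unit := by
  have hval : ∀ e : ValExpr, e.size ≤ 300 → Λ.cost.val (e.eval s) ≤ Λ.unit := fun e he =>
    Λ.val_le _ (Λ.small_mono (Nat.mul_le_mul_right _ he) (e.small_eval hs))
  have hself := hval e he
  induction e with
  | lit c => exact hself.trans (Nat.le_mul_of_pos_left _ (Nat.succ_pos _))
  | read a i j k =>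
    simp only [size] at he
    have h1 := i.cost_le hs (by omega)
    have h2 := j.cost_le hs (by omega)
    have h3 := k.cost_le hs (by omega)
    simp only [cost, size, eval] at *; nlinarith
  | add e f h1 h2 | sub e f h1 h2 | mul e f h1 h2 | div e f h1 h2 =>
    simp only [size] at he
    have h1 := h1 (by omega) (hval e (by omega))
    have h2 := h2 (by omega) (hval f (by omega))
    simp only [cost, size, eval] at *; nlinarith

theorem Test.cost_le (hs : Λ.Ok s) (b : Test) (hb : b.size ≤ 300) :
    b.cost Λ.cost s ≤ b.size * Λ.unit := by
  have := Λ.unit_pos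
  induction b with
  | idxLe e f =>
    simp only [size] at hb
    have h1 := e.cost_le hs (by omega)
    have h2 := f.cost_le hs (by omega)
    simp only [cost, size]; nlinarith
  | valLe e f =>
    simp only [size] at hb
    have h1 := e.cost_le hs (by omega)
    have h2 := f.cost_le hs (by omega)
    simp only [cost, size]; nlinarith
  | neg b h1 =>
    simp only [size] at hb
    have h1 := h1 (by omega)
    simp only [cost, size]; nlinarith
  | conj b c h1 h2 =>
    simp only [size] at hb
    have h1 := h1 (by omega)
    have h2 := h2 (by omega)
    simp only [cost, size]; nlinarith

theorem Test.cost_succ_le (hs : Λ.Ok s) (b : Test) (hb : b.size ≤ 300) :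
    b.cost Λ.cost s + 1 ≤ Λ.step := by
  have h1 := b.cost_le hs hb
  have h2 := Λ.unit_pos
  have h3 := Nat.mul_le_mul_right Λ.unit hb
  unfold Meter.step
  omega

/-! ### Frames -/

/-- The arrays of the first memory that a program writes to. -/
def Program.writesIdx : Program → ℕ → Bool
  | .skip, _ => false
  | .writeIdx a _ _ _ _, a' => a == a'
  | .writeVal _ _ _ _ _, _ => false
  | .seq P Q, a' => P.writesIdx a' || Q.writesIdx a'
  | .branch _ P Q, a' => P.writesIdx a' || Q.writesIdx a'
  | .loop _ P, a' => P.writesIdx a'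

/-- The arrays of the second memory that a program writes to. -/
def Program.writesVal : Program → ℕ → Bool
  | .skip, _ => false
  | .writeIdx _ _ _ _ _, _ => false
  | .writeVal a _ _ _ _, a' => a == a'
  | .seq P Q, a' => P.writesVal a' || Q.writesVal a'
  | .branch _ P Q, a' => P.writesVal a' || Q.writesVal a'
  | .loop _ P, a' => P.writesVal a'

/-- The store `t` agrees with `s` on all arrays that `P` does not write to. -/
structure Frame (P : Program) (s t : Store K) : Prop where
  idx : ∀ a, P.writesIdx a = false → t.idx a = s.idx a
  val : ∀ a, P.writesVal a = false → t.val a = s.val a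

theorem Frame.refl (P : Program) (s : Store K) : Frame P s s := ⟨fun _ _ => rfl, fun _ _ => rfl⟩

theorem Frame.trans {P : Program} {s t u : Store K} (h : Frame P s t) (h' : Frame P t u) :
    Frame P s u :=
  ⟨fun a ha => (h'.idx a ha).trans (h.idx a ha), fun a ha => (h'.val a ha).trans (h.val a ha)⟩

/-- For a concrete program the hypothesis that an array is not written is a Boolean that evaluates
to `false`. Preservation of data is therefore proved by `rfl` throughout. -/
theorem Exec.frame {C : CostModel K} {P : Program} {s t : Store K} {c : ℕ} (h : Exec C P s t c) :
    Frame P s t := by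
  induction h with
  | skip s => exact Frame.refl _ _
  | writeIdx s a i j k e =>
    refine ⟨fun b hb => ?_, fun _ _ => rfl⟩
    have : b ≠ a := by rintro rfl; simp [Program.writesIdx] at hb
    funext i j k
    simp [writeCell, this]
  | writeVal s a i j k e =>
    refine ⟨fun _ _ => rfl, fun b hb => ?_⟩
    have : b ≠ a := by rintro rfl; simp [Program.writesVal] at hb
    funext i j k
    simp [writeCell, this]
  | seq hP hQ ihP ihQ =>
    constructor
    · intro a ha
      simp only [Program.writesIdx, Bool.or_eq_false_iff] at ha
      exact (ihQ.idx a ha.2).trans (ihP.idx a ha.1)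
    · intro a ha
      simp only [Program.writesVal, Bool.or_eq_false_iff] at ha
      exact (ihQ.val a ha.2).trans (ihP.val a ha.1)
  | branch_true Q hb hP ih =>
    constructor
    · intro a ha
      simp only [Program.writesIdx, Bool.or_eq_false_iff] at ha
      exact ih.idx a ha.1
    · intro a ha
      simp only [Program.writesVal, Bool.or_eq_false_iff] at ha
      exact ih.val a ha.1
  | branch_false P hb hQ ih =>
    constructor
    · intro a ha
      simp only [Program.writesIdx, Bool.or_eq_false_iff] at ha
      exact ih.idx a ha.2
    · intro a ha
      simp only [Program.writesVal, Bool.or_eq_false_iff] at ha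
      exact ih.val a ha.2
  | loop_done P hb => exact Frame.refl _ _
  | loop_step hb hP hL ihP ihL =>
    exact ⟨fun a ha => (ihL.idx a ha).trans (ihP.idx a ha),
      fun a ha => (ihL.val a ha).trans (ihP.val a ha)⟩

/-! ### Total correctness with a bound on the number of steps -/

/-- Started on `s`, the program terminates within `τ` steps in a store that satisfies `Post`, and
all numbers stay within the bounds. -/
def Run (Λ : Meter K) (P : Program) (s : Store K) (τ : ℕ) (Post : Store K → Prop) : Prop :=
  Λ.Ok s → ∃ t c, Exec Λ.cost P s t c ∧ c ≤ τ * Λ.step ∧ Λ.Ok t ∧ Post t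

variable {P Q : Program} {τ τ₁ τ₂ : ℕ} {Post Mid : Store K → Prop}

/-- The frame is handed to the proof of the new postcondition, so facts about untouched arrays need
not be carried through the invariants. -/
theorem Run.mono {Post' : Store K → Prop} {τ' : ℕ} (h : Run Λ P s τ Post) (hτ : τ ≤ τ')
    (hP : ∀ t, Frame P s t → Post t → Post' t) : Run Λ P s τ' Post' := by
  intro hs
  obtain ⟨t, c, he, hc, ht, hp⟩ := h hs
  exact ⟨t, c, he, hc.trans (Nat.mul_le_mul_right _ hτ), ht, hP t he.frame hp⟩

theorem Run.skip (h : Post s) : Run Λ .skip s 1 Post := by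
  intro hs
  refine ⟨s, 1, .skip s, ?_, hs, h⟩
  have := Λ.unit_pos
  unfold Meter.step
  omega

theorem Run.writeIdx {a : ℕ} {i j k e : IdxExpr}
    (hsize : i.size ≤ 300 ∧ j.size ≤ 300 ∧ k.size ≤ 300 ∧ e.size ≤ 300)
    (he : Λ.Ok s → e.eval s ≤ Λ.top)
    (h : Post { s with idx := writeCell s.idx a (i.eval s) (j.eval s) (k.eval s) (e.eval s) }) :
    Run Λ (.writeIdx a i j k e) s 1 Post := by
  intro hs
  refine ⟨_, _, .writeIdx s a i j k e, ?_, ⟨fun a' i' j' k' => ?_, hs.2⟩, h⟩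
  -- Four expressions of at most 300 units each and one unit for the write: this is the factor 1201
  -- in `Meter.step`.
  · have h1 := i.cost_le hs hsize.1
    have h2 := j.cost_le hs hsize.2.1
    have h3 := k.cost_le hs hsize.2.2.1
    have h4 := e.cost_le hs hsize.2.2.2
    have h1' := Nat.mul_le_mul_right Λ.unit hsize.1
    have h2' := Nat.mul_le_mul_right Λ.unit hsize.2.1
    have h3' := Nat.mul_le_mul_right Λ.unit hsize.2.2.1
    have h4' := Nat.mul_le_mul_right Λ.unit hsize.2.2.2
    have := Λ.unit_pos
    unfold Meter.step
    omega
  · simp only [writeCell]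
    split_ifs
    · exact he hs
    · exact hs.1 _ _ _ _

theorem Run.writeVal {a : ℕ} {i j k : IdxExpr} {e : ValExpr}
    (hsize : i.size ≤ 300 ∧ j.size ≤ 300 ∧ k.size ≤ 300 ∧ e.size ≤ 300)
    (he : Λ.Ok s → Λ.small Λ.level (e.eval s))
    (h : Post { s with val := writeCell s.val a (i.eval s) (j.eval s) (k.eval s) (e.eval s) }) :
    Run Λ (.writeVal a i j k e) s 1 Post := by
  intro hs
  refine ⟨_, _, .writeVal s a i j k e, ?_, ⟨hs.1, fun a' i' j' k' => ?_⟩, h⟩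
  · have h1 := i.cost_le hs hsize.1
    have h2 := j.cost_le hs hsize.2.1
    have h3 := k.cost_le hs hsize.2.2.1
    have h4 := e.cost_le hs hsize.2.2.2
    have h1' := Nat.mul_le_mul_right Λ.unit hsize.1
    have h2' := Nat.mul_le_mul_right Λ.unit hsize.2.1
    have h3' := Nat.mul_le_mul_right Λ.unit hsize.2.2.1
    have h4' := Nat.mul_le_mul_right Λ.unit hsize.2.2.2
    have := Λ.unit_pos
    unfold Meter.step
    omega
  · simp only [writeCell]
    split_ifs
    · exact he hs
    · exact hs.2 _ _ _ _

theorem Run.seq (hP : Run Λ P s τ₁ Mid)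
    (hQ : ∀ t, Frame P s t → Mid t → Run Λ Q t τ₂ Post) : Run Λ (.seq P Q) s (τ₁ + τ₂) Post := by
  intro hs
  obtain ⟨t, c, he, hc, ht, hm⟩ := hP hs
  obtain ⟨u, d, he', hd, hu, hp⟩ := hQ t he.frame hm ht
  exact ⟨u, c + d, .seq he he', by rw [add_mul]; exact Nat.add_le_add hc hd, hu, hp⟩

theorem Run.branch {b : Test} (hsize : b.size ≤ 300) (hP : b.Holds s → Run Λ P s τ Post)
    (hQ : ¬ b.Holds s → Run Λ Q s τ Post) : Run Λ (.branch b P Q) s (τ + 1) Post := by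
  intro hs
  have h1 := b.cost_succ_le hs hsize
  by_cases hb : b.Holds s
  · obtain ⟨t, c, he, hc, ht, hp⟩ := hP hb hs
    exact ⟨t, _, .branch_true Q hb he, by rw [add_mul]; omega, ht, hp⟩
  · obtain ⟨t, c, he, hc, ht, hp⟩ := hQ hb hs
    exact ⟨t, _, .branch_false P hb he, by rw [add_mul]; omega, ht, hp⟩

/-- A loop terminates if every round decreases a measure. -/
theorem Run.loop {b : Test} (hsize : b.size ≤ 300) (Inv : Store K → Prop) (μ : Store K → ℕ)
    (hstep : ∀ t, Frame P s t → Inv t → b.Holds t →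
      Run Λ P t τ (fun t' => Inv t' ∧ μ t' < μ t))
    (h0 : Inv s) :
    Run Λ (.loop b P) s (μ s * (τ + 1) + 1) (fun t => Inv t ∧ ¬ b.Holds t) := by
  -- Induction on a bound for the measure, since a round may lower the measure by more than one.
  have key : ∀ N t, μ t ≤ N → Frame P s t → Inv t →
      Run Λ (.loop b P) t (N * (τ + 1) + 1) (fun t => Inv t ∧ ¬ b.Holds t) := by
    intro N
    induction N with
    | zero =>
      intro t hN hf hi ht
      by_cases hb : b.Holds t
      · obtain ⟨_, _, _, _, _, _, hlt⟩ := hstep t hf hi hb ht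
        omega
      · have := b.cost_succ_le ht hsize
        exact ⟨t, _, .loop_done P hb, by simpa using this, ht, hi, hb⟩
    | succ N ih =>
      intro t hN hf hi ht
      have h1 := b.cost_succ_le ht hsize
      by_cases hb : b.Holds t
      · obtain ⟨u, c, he, hc, hu, hi', hlt⟩ := hstep t hf hi hb ht
        obtain ⟨w, d, he', hd, hw, hp⟩ := ih u (by omega) (hf.trans he.frame) hi' hu
        refine ⟨w, _, .loop_step hb he he', ?_, hw, hp⟩
        calc _ = (b.cost Λ.cost t + 1) + c + d := by ring
          _ ≤ Λ.step + τ * Λ.step + (N * (τ + 1) + 1) * Λ.step := by gcongr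
          _ = _ := by ring
      · refine ⟨t, _, .loop_done P hb, h1.trans ?_, ht, hi, hb⟩
        exact Nat.le_mul_of_pos_left _ (by omega)
  exact key _ s le_rfl (Frame.refl _ _) h0

/-- A register: cell `0 0 0` of an array. -/
def reg (r : ℕ) : IdxExpr := .read r (.lit 0) (.lit 0) (.lit 0)

@[simp] theorem reg_eval (r : ℕ) : (reg r).eval s = s.idx r 0 0 0 := rfl

/-- Overwrite a register. -/
def Store.setReg (s : Store K) (r x : ℕ) : Store K :=
  { s with idx := writeCell s.idx r 0 0 0 x }

@[simp] theorem Store.setReg_self (r x : ℕ) : (s.setReg r x).idx r 0 0 0 = x := by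
  simp [Store.setReg, writeCell]

theorem Store.setReg_idx_of_ne {r a : ℕ} (h : a ≠ r) (x : ℕ) :
    (s.setReg r x).idx a = s.idx a := by
  funext i j k
  simp [Store.setReg, writeCell, h]

/-- `for r < bound do P`. -/
def Program.for (r : ℕ) (bound : IdxExpr) (P : Program) : Program :=
  .seq (.writeIdx r (.lit 0) (.lit 0) (.lit 0) (.lit 0))
    (.loop (.neg (.idxLe bound (reg r)))
      (.seq P (.writeIdx r (.lit 0) (.lit 0) (.lit 0) (.add (reg r) (.lit 1)))))

/-- Each pass costs the body, the increment and the test; the additional 2 are the initialisation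
and the last, failing test. The counter is overwritten between two passes, so the invariant must not
depend on its register (`hinv`). -/
theorem Run.for {r b : ℕ} {bound : IdxExpr} (Inv : ℕ → Store K → Prop)
    (hsize : bound.size ≤ 290) (hr : P.writesIdx r = false)
    (hbound : ∀ t, Frame (.for r bound P) s t → bound.eval t = b) (hb : b ≤ Λ.top)
    (h0 : Inv 0 s) (hinv : ∀ k t x, Inv k t → Inv k (t.setReg r x))
    (hstep : ∀ k < b, ∀ t, Frame (.for r bound P) s t → t.idx r 0 0 0 = k → Inv k t →
      Run Λ P t τ (Inv (k + 1))) :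
    Run Λ (.for r bound P) s (2 + b * (τ + 2)) (Inv b) := by
  have hframe : ∀ t u, Frame (.for r bound P) s t →
      (∀ a, a ≠ r → u.idx a = t.idx a) → u.val = t.val → Frame (.for r bound P) s u := by
    intro t u h h1 h2
    refine ⟨fun a ha => ?_, fun a ha => by rw [h2]; exact h.val a ha⟩
    have hne : a ≠ r := by rintro rfl; simp [Program.for, Program.writesIdx] at ha
    rw [h1 a hne]; exact h.idx a ha
  have hsub : ∀ t u, Frame (.for r bound P) s t → Frame P t u → Frame (.for r bound P) s u := by
    intro t u h h'
    refine h.trans ⟨fun a ha => h'.idx a ?_, fun a ha => h'.val a ?_⟩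
    · simp only [Program.for, Program.writesIdx, Bool.or_eq_false_iff] at ha
      exact ha.2.1
    · simp only [Program.for, Program.writesVal, Bool.or_eq_false_iff] at ha
      exact ha.2.1
  have hloop : ∀ t, Frame (.for r bound P) s t → t.idx r 0 0 0 = 0 → Inv 0 t →
      Run Λ (.loop (.neg (.idxLe bound (reg r)))
        (.seq P (.writeIdx r (.lit 0) (.lit 0) (.lit 0) (.add (reg r) (.lit 1))))) t
        (b * (τ + 1 + 1) + 1) (Inv b) := by
    intro t ht htr hti
    have key := Run.loop (Λ := Λ) (τ := τ + 1) (s := t) (b := .neg (.idxLe bound (reg r)))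
      (P := .seq P (.writeIdx r (.lit 0) (.lit 0) (.lit 0) (.add (reg r) (.lit 1))))
      (by simp only [Test.size, reg, IdxExpr.size]; omega)
      (fun u => Frame (.for r bound P) s u ∧ u.idx r 0 0 0 ≤ b ∧ Inv (u.idx r 0 0 0) u)
      (fun u => b - u.idx r 0 0 0)
      (by
        rintro u - ⟨hu, -, hui⟩ hholds
        simp only [Test.Holds, hbound u hu, reg_eval, not_le] at hholds
        refine Run.seq (hstep _ hholds u hu rfl hui) fun w hw hwi => ?_
        have hwr : w.idx r 0 0 0 = u.idx r 0 0 0 := by rw [hw.idx r hr]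
        have heval : (IdxExpr.add (reg r) (.lit 1)).eval w = u.idx r 0 0 0 + 1 := by
          simp [IdxExpr.eval, hwr]
        refine Run.writeIdx (by refine ⟨?_, ?_, ?_, ?_⟩ <;> simp [IdxExpr.size, reg])
          (fun _ => by rw [heval]; omega) ?_
        rw [heval]
        have hset : (w.setReg r (u.idx r 0 0 0 + 1)).idx r 0 0 0 = u.idx r 0 0 0 + 1 :=
          Store.setReg_self _ _
        have : (Frame (.for r bound P) s (w.setReg r (u.idx r 0 0 0 + 1)) ∧
            (w.setReg r (u.idx r 0 0 0 + 1)).idx r 0 0 0 ≤ b ∧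
            Inv ((w.setReg r (u.idx r 0 0 0 + 1)).idx r 0 0 0)
              (w.setReg r (u.idx r 0 0 0 + 1))) ∧
            b - (w.setReg r (u.idx r 0 0 0 + 1)).idx r 0 0 0 < b - u.idx r 0 0 0 := by
          rw [hset]
          exact ⟨⟨hframe _ _ (hsub _ _ hu hw) (fun a ha => Store.setReg_idx_of_ne ha _) rfl,
            by omega, hinv _ _ _ hwi⟩, by omega⟩
        exact this)
      ⟨ht, by omega, by rw [htr]; exact hti⟩
    refine key.mono ?_ ?_
    · simp only [htr, Nat.sub_zero]; omega
    · rintro u - ⟨⟨hu, hle, hui⟩, hn⟩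
      simp only [Test.Holds, hbound u hu, reg_eval, not_not] at hn
      rwa [le_antisymm hle hn] at hui
  have := Run.seq (Λ := Λ) (s := s) (Mid := fun t => Frame (.for r bound P) s t ∧
      t.idx r 0 0 0 = 0 ∧ Inv 0 t) (Run.writeIdx (a := r) (i := .lit 0) (j := .lit 0) (k := .lit 0)
      (e := .lit 0) (by decide) (fun _ => Nat.zero_le _)
      ⟨hframe s (s.setReg r 0) (Frame.refl _ _) (fun a ha => Store.setReg_idx_of_ne ha _) rfl,
        Store.setReg_self _ _, hinv _ _ _ h0⟩)
    (fun t _ ht => hloop t ht.1 ht.2.1 ht.2.2)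
  refine this.mono ?_ fun _ _ h => h
  ring_nf; omega

end RandomAccess

/-! ## Monotone affine systems on functional graphs -/

namespace MonotoneSystem

/-! ### Feasible points and pinned value iteration over an ordered field -/

section General

variable {K : Type} [Field K] [LinearOrder K]

/-- The affine map with constants `C` and coefficients `W` on the first `N` coordinates. -/
def affine (N : ℕ) (W C : ℕ → ℕ → K) (y : ℕ → K) (u : ℕ) : K :=
  ∑ v ∈ Finset.range N, (C u v + W u v * y v)

/-- Value iteration from below with floor `b`, where the coordinate `u` is kept at `θ`. -/
def pinned (N : ℕ) (W C : ℕ → ℕ → K) (b : ℕ → K) (u : ℕ) (θ : K) : ℕ → ℕ → K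
  | 0, v => if v = u then θ else b v
  | t + 1, v => if v = u then θ else max (b v) (affine N W C (pinned N W C b u θ t) v)

/-- The value that the system proposes for the pinned coordinate. -/
def response (N : ℕ) (W C : ℕ → ℕ → K) (b : ℕ → K) (u : ℕ) (θ : K) : K :=
  affine N W C (pinned N W C b u θ N) u

/-- The points between `b` and `top` that the affine map does not increase. -/
def Feasible (N : ℕ) (W C : ℕ → ℕ → K) (b top y : ℕ → K) : Prop :=
  ∀ u < N, b u ≤ y u ∧ y u ≤ top u ∧ affine N W C y u ≤ y u

/-- Every coordinate influences at most one coordinate, the one given by `f`;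
`N` stands for no coordinate. -/
structure Functional (N : ℕ) (W : ℕ → ℕ → K) (f : ℕ → ℕ) : Prop where
  nonneg : ∀ u v, 0 ≤ W u v
  target : ∀ u < N, ∀ v < N, W u v ≠ 0 → f v = u
  sink : f N = N
  bounded : ∀ v, v ≤ N → f v ≤ N

variable {N : ℕ} {W C : ℕ → ℕ → K} {b top : ℕ → K} {f : ℕ → ℕ} {u : ℕ}

theorem affine_mono [IsStrictOrderedRing K] (hW : ∀ u v, 0 ≤ W u v) {y z : ℕ → K}
    (h : ∀ v < N, y v ≤ z v) (v : ℕ) :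
    affine N W C y v ≤ affine N W C z v := by
  refine Finset.sum_le_sum fun w hw => ?_
  have := mul_le_mul_of_nonneg_left (h w (Finset.mem_range.1 hw)) (hW v w)
  linarith

theorem pinned_self (θ : K) (t : ℕ) : pinned N W C b u θ t u = θ := by
  cases t <;> simp [pinned]

theorem floor_le_pinned {θ : K} (hθ : b u ≤ θ) (t v : ℕ) : b v ≤ pinned N W C b u θ t v := by
  cases t <;> simp only [pinned] <;> split_ifs with h
  · rw [h]; exact hθ
  · exact le_rfl
  · rw [h]; exact hθ
  · exact le_max_left _ _

/-- A feasible point is a supersolution, and a monotone iteration that starts below a supersolution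
stays below it. -/
theorem pinned_le [IsStrictOrderedRing K] (hW : ∀ u v, 0 ≤ W u v) {y : ℕ → K}
    (hy : Feasible N W C b top y) {θ : K}
    (hθ : θ ≤ y u) (t : ℕ) : ∀ v < N, pinned N W C b u θ t v ≤ y v := by
  induction t with
  | zero =>
    intro v hv
    simp only [pinned]
    split_ifs with h
    · rw [h]; exact hθ
    · exact (hy v hv).1
  | succ t ih =>
    intro v hv
    simp only [pinned]
    split_ifs with h
    · rw [h]; exact hθ
    · exact max_le (hy v hv).1 ((affine_mono hW ih v).trans (hy v hv).2.2)

/-- `v` reaches `u` for the first time after `d` steps. -/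
def FirstHit (f : ℕ → ℕ) (u v d : ℕ) : Prop :=
  f^[d] v = u ∧ ∀ e < d, f^[e] v ≠ u

theorem FirstHit.cons {v w d : ℕ} (h : FirstHit f u v d) (hw : f w = v) (hne : w ≠ u) :
    FirstHit f u w (d + 1) := by
  refine ⟨by rw [Function.iterate_succ_apply, hw, h.1], fun e he => ?_⟩
  cases e with
  | zero => simpa using hne
  | succ e => rw [Function.iterate_succ_apply, hw]; exact h.2 e (by omega)

theorem exists_firstHit {v d : ℕ} (h : f^[d] v = u) : ∃ e, FirstHit f u v e := by
  classical
  have hex : ∃ d, f^[d] v = u := ⟨d, h⟩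
  exact ⟨Nat.find hex, Nat.find_spec hex, fun e he => Nat.find_min hex he⟩

/-- The coordinates visited up to the first visit to `u` are distinct and below `N`: the sink `N` is
never left, and a repetition would lead to `u` earlier. -/
theorem FirstHit.lt (hf : Functional N W f) (hu : u < N) {v d : ℕ} (hv : v < N)
    (h : FirstHit f u v d) : d < N := by
  have hle : ∀ e, f^[e] v ≤ N := by
    intro e
    induction e with
    | zero => simpa using hv.le
    | succ e ih => rw [Function.iterate_succ_apply']; exact hf.bounded _ ih
  have hsink : ∀ e, f^[e] N = N := by
    intro e
    induction e with
    | zero => rfl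
    | succ e ih => rw [Function.iterate_succ_apply, hf.sink, ih]
  have hlt : ∀ e ≤ d, f^[e] v < N := by
    intro e he
    refine lt_of_le_of_ne (hle e) fun h' => ?_
    have := h.1
    rw [← Nat.sub_add_cancel he, Function.iterate_add_apply, h', hsink] at this
    omega
  -- If the orbit agrees at times e < e', then `u` is already reached d - e' steps after time e,
  -- hence before time d.
  have hinj : ∀ e e', e < e' → e' ≤ d → f^[e] v ≠ f^[e'] v := by
    intro e e' hlt' hle' heq
    have h1 : f^[d - e'] (f^[e'] v) = u := by
      rw [← Function.iterate_add_apply, Nat.sub_add_cancel hle', h.1]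
    rw [← heq, ← Function.iterate_add_apply] at h1
    exact h.2 _ (by omega) h1
  have hcard : (Finset.range (d + 1)).card ≤ (Finset.range N).card := by
    refine Finset.card_le_card_of_injOn (fun e => f^[e] v) ?_ ?_
    · intro e he
      simp only [Finset.coe_range, Set.mem_Iio] at he ⊢
      exact hlt e (by omega)
    · intro e he e' he' heq
      simp only [Finset.coe_range, Set.mem_Iio] at he he'
      rcases lt_trichotomy e e' with hl | hl | hl
      · exact absurd heq (hinj e e' hl (by omega))
      · exact hl
      · exact absurd heq.symm (hinj e' e hl (by omega))
  simpa using hcard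

/-- The affine map at a coordinate only depends on the coordinates that influence it. -/
theorem affine_congr (hf : Functional N W f) {v : ℕ} (hv : v < N) {y z : ℕ → K}
    (h : ∀ w < N, f w = v → y w = z w) : affine N W C y v = affine N W C z v := by
  refine Finset.sum_congr rfl fun w hw => ?_
  rcases eq_or_ne (W v w) 0 with h0 | h0
  · simp [h0]
  · rw [h w (Finset.mem_range.1 hw) (hf.target v hv w (Finset.mem_range.1 hw) h0)]

/-- A coordinate at distance d from `u` is settled from round N - d on: it reads only coordinates
one step further from `u`, and distances stay below `N`, so the base case is vacuous. Pinning `u`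
cuts the only cycle from which `u` can be reached. -/
theorem pinned_stable (hf : Functional N W f) (hu : u < N) (θ : K) (t : ℕ) :
    ∀ v < N, v ≠ u → ∀ d, FirstHit f u v d → N ≤ t + d →
      pinned N W C b u θ (t + 1) v = pinned N W C b u θ t v := by
  induction t with
  | zero => intro v hv _ d hd hN; have := hd.lt hf hu hv; omega
  | succ t ih =>
    intro v hv hne d hd hN
    rw [pinned, pinned, if_neg hne, if_neg hne]
    congr 1
    refine affine_congr hf hv fun w hw hwv => ?_
    rcases eq_or_ne w u with rfl | hwu
    · rw [pinned_self, pinned_self]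
    · exact ih w hw hwu (d + 1) (hd.cons hwv hwu) (by omega)

/-- On the coordinates that reach `u`, the pinned iteration has converged after `N` rounds. -/
theorem pinned_eq (hf : Functional N W f) (hu : u < N) (θ : K) {v d : ℕ} (hv : v < N)
    (hne : v ≠ u) (hd : f^[d] v = u) :
    pinned N W C b u θ N v = max (b v) (affine N W C (pinned N W C b u θ N) v) := by
  obtain ⟨e, he⟩ := exists_firstHit hd
  rw [← pinned_stable hf hu θ N v hv hne e he (by omega), pinned, if_neg hne]

/-- If the response to the floor is at most the floor, some feasible point attains the floor. -/
theorem exists_feasible_eq_floor [IsStrictOrderedRing K] (hf : Functional N W f) (hu : u < N)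
    {y : ℕ → K}
    (hy : Feasible N W C b top y) (hr : response N W C b u (b u) ≤ b u) :
    ∃ y', Feasible N W C b top y' ∧ y' u = b u := by
  classical
  set z := pinned N W C b u (b u) N with hz
  have hzy : ∀ v < N, z v ≤ y v := pinned_le hf.nonneg hy (hy u hu).1 N
  -- Only coordinates that lead to `u` are lowered to the iterate. Others may lie on cycles, where
  -- `N` rounds need not converge, and they keep the value of `y`. The set of lowered coordinates is
  -- closed under predecessors, so F sees no mixture there.
  let y' : ℕ → K := fun v => if ∃ d, f^[d] v = u then z v else y v
  have hy'y : ∀ v < N, y' v ≤ y v := by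
    intro v hv
    simp only [y']
    split_ifs
    · exact hzy v hv
    · exact le_rfl
  have hin : ∀ v < N, (∃ d, f^[d] v = u) → affine N W C y' v = affine N W C z v := by
    intro v hv hd
    refine affine_congr hf hv fun w hw hwv => ?_
    obtain ⟨d, hd⟩ := hd
    have : ∃ d, f^[d] w = u := ⟨d + 1, by rw [Function.iterate_succ_apply, hwv, hd]⟩
    simp only [y', if_pos this]
  refine ⟨y', fun v hv => ⟨?_, (hy'y v hv).trans (hy v hv).2.1, ?_⟩, ?_⟩
  · simp only [y']
    split_ifs
    · exact floor_le_pinned le_rfl N v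
    · exact (hy v hv).1
  · by_cases hd : ∃ d, f^[d] v = u
    · rw [hin v hv hd]
      simp only [y', if_pos hd]
      rcases eq_or_ne v u with rfl | hne
      · rw [hz, pinned_self]; exact hr
      · obtain ⟨d, hd⟩ := hd
        rw [hz, pinned_eq hf hu _ hv hne hd]
        exact le_max_right _ _
    · refine (affine_mono hf.nonneg hy'y v).trans ?_
      simp only [y', if_neg hd]
      exact (hy v hv).2.2
  · have : ∃ d, f^[d] u = u := ⟨0, rfl⟩
    simp only [y', if_pos this]
    exact pinned_self _ _

end General

/-! ### The least feasible point over the reals -/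

section Real

variable {N : ℕ} {W C : ℕ → ℕ → ℝ} {b top : ℕ → ℝ} {f : ℕ → ℕ}

/-- As in the Knaster–Tarski theorem, the coordinatewise infimum of supersolutions of a monotone map
is a supersolution. -/
theorem exists_least_feasible (hW : ∀ u v, 0 ≤ W u v) (hne : ∃ y, Feasible N W C b top y) :
    ∃ y, Feasible N W C b top y ∧ ∀ z, Feasible N W C b top z → ∀ u < N, y u ≤ z u := by
  obtain ⟨y₀, hy₀⟩ := hne
  let S : ℕ → Set ℝ := fun u => {x | ∃ z, Feasible N W C b top z ∧ z u = x}
  have hle : ∀ z, Feasible N W C b top z → ∀ u < N, sInf (S u) ≤ z u := fun z hz u hu =>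
    csInf_le ⟨b u, by rintro x ⟨z', hz', rfl⟩; exact (hz' u hu).1⟩ ⟨z, hz, rfl⟩
  refine ⟨fun u => sInf (S u), fun u hu => ⟨?_, ?_, ?_⟩, hle⟩
  · exact le_csInf ⟨_, y₀, hy₀, rfl⟩ (by rintro x ⟨z, hz, rfl⟩; exact (hz u hu).1)
  · exact (hle y₀ hy₀ u hu).trans (hy₀ u hu).2.1
  · refine le_csInf ⟨_, y₀, hy₀, rfl⟩ ?_
    rintro x ⟨z, hz, rfl⟩
    exact (affine_mono hW (hle z hz) u).trans (hz u hu).2.2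

/-- One step length for finitely many strict slacks. It serves to lower a point that lies strictly
above the floor in a given direction. -/
theorem exists_pos_forall_mul_le (N : ℕ) (h g : ℕ → ℝ) (hg : ∀ v < N, 0 < g v) :
    ∃ ε > 0, ∀ v < N, ε * h v ≤ g v := by
  induction N with
  | zero => exact ⟨1, one_pos, by simp⟩
  | succ N ih =>
    obtain ⟨ε, hε, hle⟩ := ih fun v hv => hg v (by omega)
    have hpos : 0 < g N := hg N (by omega)
    have hden : 0 < |h N| + 1 := by positivity
    have h2 : 0 < g N / (|h N| + 1) := div_pos hpos hden
    refine ⟨min ε (g N / (|h N| + 1)), lt_min hε h2, fun v hv => ?_⟩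
    have hm : 0 < min ε (g N / (|h N| + 1)) := lt_min hε h2
    rcases Nat.lt_succ_iff_lt_or_eq.1 hv with hv | rfl
    · rcases le_total 0 (h v) with h0 | h0
      · exact (mul_le_mul_of_nonneg_right (min_le_left _ _) h0).trans (hle v hv)
      · have := mul_nonpos_of_nonneg_of_nonpos hm.le h0
        exact this.trans (hg v (by omega)).le
    · calc _ ≤ min ε (g v / (|h v| + 1)) * |h v| :=
            mul_le_mul_of_nonneg_left (le_abs_self _) hm.le
        _ ≤ g v / (|h v| + 1) * (|h v| + 1) := by
            refine mul_le_mul (min_le_right _ _) (by linarith) (abs_nonneg _) h2.le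
        _ = g v := div_mul_cancel₀ _ hden.ne'

/-- If no response to the floor is at most the floor, the affine map has a feasible fixed point
above the floor, and two responses per coordinate determine it. -/
theorem exists_fixedPoint_real (hf : Functional N W f) (htop : ∀ u < N, top u ≤ 1)
    (hne : ∃ y, Feasible N W C b top y)
    (hr : ∀ u < N, b u < response N W C b u (b u)) :
    ∃ y, Feasible N W C b top y ∧ ∀ u < N, b u < y u ∧ affine N W C y u = y u ∧
      y u = (2 * response N W C b u 1 - response N W C b u 2) /
        (1 - (response N W C b u 2 - response N W C b u 1)) := by
  classical
  obtain ⟨y, hy, hleast⟩ := exists_least_feasible hf.nonneg hne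
  -- If `y` touched the floor at u, it would dominate the iteration pinned at the floor, and F(y) ≤
  -- y would bound the response by the floor.
  have hlt : ∀ u < N, b u < y u := by
    intro u hu
    refine lt_of_le_of_ne (hy u hu).1 fun heq => absurd (hr u hu) (not_lt.2 ?_)
    calc response N W C b u (b u) ≤ affine N W C y u :=
          affine_mono hf.nonneg (pinned_le hf.nonneg hy heq.le N) u
      _ ≤ b u := by rw [heq]; exact (hy u hu).2.2
  have hfix : ∀ u < N, affine N W C y u = y u := by
    intro u hu
    refine le_antisymm (hy u hu).2.2 ?_
    -- Lowering a single coordinate towards its image keeps the point feasible, so leastness leaves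
    -- no room between `y u` and its image.
    let y' : ℕ → ℝ := Function.update y u (max (b u) (affine N W C y u))
    have hle : ∀ v < N, y' v ≤ y v := by
      intro v hv
      rcases eq_or_ne v u with rfl | hvu
      · simp only [y', Function.update_self]; exact max_le (hy v hv).1 (hy v hv).2.2
      · simp [y', hvu]
    have hy' : Feasible N W C b top y' := by
      intro v hv
      refine ⟨?_, (hle v hv).trans (hy v hv).2.1, (affine_mono hf.nonneg hle v).trans ?_⟩
      · rcases eq_or_ne v u with rfl | hvu
        · simp [y']
        · simpa [y', hvu] using (hy v hv).1
      · rcases eq_or_ne v u with rfl | hvu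
        · simp [y']
        · simpa [y', hvu] using (hy v hv).2.2
    have := hleast y' hy' u hu
    simp only [y', Function.update_self, le_max_iff] at this
    rcases this with h | h
    · exact absurd h (not_le.2 (hlt u hu))
    · exact h
  refine ⟨y, hy, fun u hu => ⟨hlt u hu, hfix u hu, ?_⟩⟩
  -- The linear part of the pinned iteration: `h t v` will be the slope in θ of the iterate at v.
  set h : ℕ → ℕ → ℝ := pinned N W (fun _ _ => 0) (fun _ => 0) u 1 with hh
  have hself : ∀ t, h t u = 1 := fun t => pinned_self 1 t
  have hnonneg : ∀ t v, 0 ≤ h t v := fun t v =>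
    floor_le_pinned (b := fun _ => 0) (by norm_num) t v
  have hstep : ∀ t v, v ≠ u → h (t + 1) v = affine N W (fun _ _ => 0) (h t) v := by
    intro t v hv
    rw [hh, pinned, if_neg hv, max_eq_right]
    refine Finset.sum_nonneg fun w _ => ?_
    rw [zero_add]
    exact mul_nonneg (hf.nonneg v w) (hnonneg t w)
  have hsplit : ∀ (δ : ℝ) (g : ℕ → ℝ) v, affine N W C (fun w => y w + δ * g w) v =
      affine N W C y v + δ * affine N W (fun _ _ => 0) g v := by
    intro δ g v
    simp only [affine, Finset.mul_sum, ← Finset.sum_add_distrib]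
    exact Finset.sum_congr rfl fun w _ => by ring
  -- For θ above `y u` the settled iterates lie above `y`, hence strictly above the floor; the
  -- maximum with the floor is never active, and the iteration is affine in θ.
  have hpin : ∀ θ, y u ≤ θ → ∀ t, ∀ v < N, v ≠ u → ∀ d, FirstHit f u v d → N ≤ t + d →
      pinned N W C b u θ t v = y v + (θ - y u) * h t v := by
    intro θ hθ t
    induction t with
    | zero => intro v hv _ d hd hN; have := hd.lt hf hu hv; omega
    | succ t ih =>
      intro v hv hne d hd hN
      have key : affine N W C (pinned N W C b u θ t) v =
          affine N W C (fun w => y w + (θ - y u) * h t w) v := by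
        refine affine_congr hf hv fun w hw hwv => ?_
        rcases eq_or_ne w u with rfl | hwu
        · rw [pinned_self, hself]; ring
        · exact ih w hw hwu (d + 1) (hd.cons hwv hwu) (by omega)
      rw [pinned, if_neg hne, key, hsplit, hfix v hv, ← hstep t v hne, max_eq_right]
      have := mul_nonneg (sub_nonneg.2 hθ) (hnonneg (t + 1) v)
      linarith [hlt v hv]
  set g := affine N W (fun _ _ => 0) (h N) u with hg
  have hresp : ∀ θ, y u ≤ θ → response N W C b u θ = y u + (θ - y u) * g := by
    intro θ hθ
    have hlin := hsplit (θ - y u) (h N) u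
    rw [hfix u hu, ← hg] at hlin
    rw [← hlin]
    refine affine_congr hf hu fun w hw hwu => ?_
    rcases eq_or_ne w u with rfl | hne
    · rw [pinned_self, hself]; ring
    · refine hpin θ hθ N w hw hne 1 ⟨by simpa using hwu, fun e he => ?_⟩ (by omega)
      obtain rfl : e = 0 := by omega
      simpa using hne
  -- If the gain around `u` were at least 1, a small multiple of `h` could be subtracted from `y` on
  -- the coordinates leading to `u` without losing feasibility, against leastness.
  have hg1 : g < 1 := by
    by_contra hge
    rw [not_lt] at hge
    obtain ⟨ε, hε, hεle⟩ := exists_pos_forall_mul_le N (h N) (fun v => y v - b v)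
      fun v hv => sub_pos.2 (hlt v hv)
    let y' : ℕ → ℝ := fun v => if ∃ d, f^[d] v = u then y v + -ε * h N v else y v
    have hle : ∀ v < N, y' v ≤ y v := by
      intro v hv
      simp only [y']
      split_ifs
      · have := mul_nonneg hε.le (hnonneg N v); linarith
      · exact le_rfl
    have hfeas : Feasible N W C b top y' := by
      intro v hv
      refine ⟨?_, (hle v hv).trans (hy v hv).2.1, ?_⟩
      · simp only [y']
        split_ifs
        · linarith [hεle v hv]
        · exact (hy v hv).1
      · by_cases hd : ∃ d, f^[d] v = u
        · have heq : affine N W C y' v = affine N W C (fun w => y w + -ε * h N w) v := by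
            refine affine_congr hf hv fun w hw hwv => ?_
            obtain ⟨d, hd⟩ := hd
            have : ∃ d, f^[d] w = u := ⟨d + 1, by rw [Function.iterate_succ_apply, hwv, hd]⟩
            simp only [y', if_pos this]
          rw [heq, hsplit, hfix v hv]
          simp only [y', if_pos hd]
          rcases eq_or_ne v u with rfl | hvu
          · rw [hself, ← hg]; nlinarith
          · obtain ⟨d, hd⟩ := hd
            have h1 := pinned_eq (C := fun _ _ => 0) (b := fun _ => 0) hf hu 1 hv hvu hd
            rw [← hh] at h1
            rw [max_eq_right] at h1
            · rw [← h1]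
            · refine Finset.sum_nonneg fun w _ => ?_
              rw [zero_add]
              exact mul_nonneg (hf.nonneg v w) (hnonneg N w)
        · refine (affine_mono hf.nonneg hle v).trans ?_
          simp only [y', if_neg hd]
          exact (hy v hv).2.2
    have := hleast y' hfeas u hu
    have hd : ∃ d, f^[d] u = u := ⟨0, rfl⟩
    simp only [y', if_pos hd, hself] at this
    linarith
  -- Thus 1 and 2 both lie in the range where the response is y_u + (θ - y_u) g. These two values
  -- give the line, and since g < 1 it meets the diagonal only at y_u.
  have hy1 : y u ≤ 1 := (hy u hu).2.1.trans (htop u hu)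
  rw [hresp 1 hy1, hresp 2 (by linarith), eq_div_iff]
  · ring
  · intro h0; apply hg1.ne; linarith

end Real

/-! ### Transfer to ordered subfields of the reals -/

section Transfer

variable {K : Type} [Field K] [LinearOrder K] [IsStrictOrderedRing K]
variable {N : ℕ} {W C : ℕ → ℕ → K} {b top : ℕ → K} {f : ℕ → ℕ}

theorem map_affine (φ : K →+* ℝ) (y : ℕ → K) (u : ℕ) :
    φ (affine N W C y u) =
      affine N (fun u v => φ (W u v)) (fun u v => φ (C u v)) (fun v => φ (y v)) u := by
  simp [affine]

theorem map_pinned (φ : K →+* ℝ) (hφ : StrictMono φ) (u : ℕ) (θ : K) (t : ℕ) : ∀ v,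
    φ (pinned N W C b u θ t v) =
      pinned N (fun u v => φ (W u v)) (fun u v => φ (C u v)) (fun v => φ (b v)) u (φ θ) t v := by
  induction t with
  | zero => intro v; simp only [pinned]; split_ifs <;> rfl
  | succ t ih =>
    intro v
    simp only [pinned]
    split_ifs
    · rfl
    · rw [hφ.monotone.map_max, map_affine]
      simp only [ih]

theorem map_response (φ : K →+* ℝ) (hφ : StrictMono φ) (u : ℕ) (θ : K) :
    φ (response N W C b u θ) =
      response N (fun u v => φ (W u v)) (fun u v => φ (C u v)) (fun v => φ (b v)) u (φ θ) := by
  simp only [response, map_affine, map_pinned φ hφ]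

/-- `exists_fixedPoint_real` for ordered subfields of the reals. -/
theorem fixedPoint_of_floor_lt_response (φ : K →+* ℝ) (hφ : StrictMono φ)
    (hf : Functional N W f) (htop : ∀ u < N, top u ≤ 1) (hne : ∃ y, Feasible N W C b top y)
    (hr : ∀ u < N, b u < response N W C b u (b u)) (y : ℕ → K)
    (hy : ∀ u < N, y u = (2 * response N W C b u 1 - response N W C b u 2) /
        (1 - (response N W C b u 2 - response N W C b u 1))) :
    ∀ u < N, b u < y u ∧ y u ≤ top u ∧ affine N W C y u = y u := by
  obtain ⟨y₀, hy₀⟩ := hne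
  obtain ⟨z, hz, hzu⟩ := exists_fixedPoint_real (N := N) (W := fun u v => φ (W u v))
    (C := fun u v => φ (C u v)) (b := fun v => φ (b v)) (top := fun v => φ (top v)) (f := f)
    ⟨fun u v => by simpa using hφ.monotone (hf.nonneg u v),
      fun u hu v hv h => hf.target u hu v hv (by rintro h0; exact h (by simp [h0])),
      hf.sink, hf.bounded⟩
    (fun u hu => by simpa using hφ.monotone (htop u hu))
    ⟨fun v => φ (y₀ v), fun u hu => ⟨hφ.monotone (hy₀ u hu).1, hφ.monotone (hy₀ u hu).2.1, by
      rw [← map_affine]; exact hφ.monotone (hy₀ u hu).2.2⟩⟩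
    (fun u hu => by rw [← map_response φ hφ]; exact hφ (hr u hu))
  -- Both sides are the same expression in field operations and maxima, which commute with `φ`.
  -- Hence the real fixed point already lies in `K`.
  have hyz : ∀ u < N, φ (y u) = z u := by
    intro u hu
    rw [hy u hu, (hzu u hu).2.2]
    simp [map_response φ hφ, map_ofNat]
  intro u hu
  refine ⟨hφ.lt_iff_lt.1 ?_, hφ.le_iff_le.1 ?_, hφ.injective ?_⟩
  · rw [hyz u hu]; exact (hzu u hu).1
  · rw [hyz u hu]; exact (hz u hu).2.1
  · rw [hyz u hu, map_affine, ← (hzu u hu).2.1]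
    exact Finset.sum_congr rfl fun v hv => by simp only [hyz v (Finset.mem_range.1 hv)]

end Transfer

end MonotoneSystem

/-! ## Selecting a best index -/

open Classical in
/-- The last index below `b` that satisfies `q` and is best for `le` among the indices considered
so far; `d` if there is none. -/
noncomputable def pickBest (q : ℕ → Prop) (le : ℕ → ℕ → Prop) (d : ℕ) : ℕ → ℕ
  | 0 => d
  | j + 1 =>
    if q j ∧ (pickBest q le d j = d ∨ le (pickBest q le d j) j) then j else pickBest q le d j

theorem pickBest_congr {q q' : ℕ → Prop} {le : ℕ → ℕ → Prop} {d b : ℕ}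
    (h : ∀ j < b, q j ↔ q' j) : pickBest q le d b = pickBest q' le d b := by
  induction b with
  | zero => rfl
  | succ b ih =>
    rw [pickBest, pickBest, ih fun j hj => h j (by omega)]
    rw [show q b = q' b from propext (h b (by omega))]

theorem pickBest_le {q : ℕ → Prop} {le : ℕ → ℕ → Prop} {d b : ℕ} (hb : b ≤ d) :
    pickBest q le d b ≤ d := by
  induction b with
  | zero => exact le_rfl
  | succ b ih =>
    rw [pickBest]
    split_ifs
    · omega
    · exact ih (by omega)

/-- Transitivity is required only among admissible indices: the cross-multiplied comparison of items
may fail to be transitive at a free item of value zero. -/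
theorem pickBest_spec {q : ℕ → Prop} {le : ℕ → ℕ → Prop} {d b : ℕ} (hb : b ≤ d)
    (htotal : ∀ i < b, ∀ j < b, le i j ∨ le j i)
    (htrans : ∀ i < b, ∀ j < b, ∀ k < b, q i → q j → q k → le i j → le j k → le i k) :
    (pickBest q le d b = d ∧ ∀ j < b, ¬ q j) ∨
      (pickBest q le d b < b ∧ q (pickBest q le d b) ∧
        ∀ j < b, q j → le j (pickBest q le d b)) := by
  induction b with
  | zero => left; exact ⟨rfl, by simp⟩
  | succ b ih =>
    have ih := ih (by omega) (fun i hi j hj => htotal i (by omega) j (by omega))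
      (fun i hi j hj k hk => htrans i (by omega) j (by omega) k (by omega))
    have hrefl : le b b := by simpa using htotal b (by omega) b (by omega)
    simp only [pickBest]
    split_ifs with h
    · right
      refine ⟨by omega, h.1, fun j hj hq => ?_⟩
      rcases Nat.lt_succ_iff_lt_or_eq.1 hj with hj' | rfl
      · rcases ih with ih | ih
        · exact absurd hq (ih.2 j hj')
        · rcases h.2 with h2 | h2
          · omega
          · exact htrans j hj _ (by omega) b (by omega) hq ih.2.1 h.1 (ih.2.2 j hj' hq) h2
      · exact hrefl
    · rcases ih with ih | ih
      · left
        refine ⟨ih.1, fun j hj hq => ?_⟩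
        rcases Nat.lt_succ_iff_lt_or_eq.1 hj with hj' | rfl
        · exact ih.2 j hj' hq
        · exact h ⟨hq, Or.inl ih.1⟩
      · right
        refine ⟨by omega, ih.2.1, fun j hj hq => ?_⟩
        rcases Nat.lt_succ_iff_lt_or_eq.1 hj with hj' | rfl
        · exact ih.2.2 j hj' hq
        · rcases htotal j (by omega) (pickBest q le d j) (by omega) with h' | h'
          · exact h'
          · exact absurd ⟨hq, Or.inr h'⟩ h

/-! ## Pointers and the system of a pair of flag tables -/

/-- The data of a market, indexed by natural numbers. -/
structure IndexedMarket (K : Type) where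
  n : ℕ
  m : ℕ
  value : ℕ → ℕ → K
  price : ℕ → ℕ → K
  budget : ℕ → K
  priority : ℕ → ℕ → ℕ → Prop

namespace IndexedMarket

variable {K : Type} [Field K] [LinearOrder K]

/-- The laws that the data of a market satisfy. -/
structure Valid (X : IndexedMarket K) : Prop where
  price_nonneg : ∀ i j, 0 ≤ X.price i j
  budget_nonneg : ∀ i, 0 ≤ X.budget i
  total : ∀ j < X.m, ∀ i < X.n, ∀ i' < X.n, X.priority j i i' ∨ X.priority j i' i
  trans : ∀ j < X.m, ∀ i₁ < X.n, ∀ i₂ < X.n, ∀ i₃ < X.n,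
    X.priority j i₁ i₂ → X.priority j i₂ i₃ → X.priority j i₁ i₃

/-- Item `j` gives buyer `i` at least the bang-per-buck of item `c`. -/
def BangLe (X : IndexedMarket K) (i c j : ℕ) : Prop :=
  X.value i c * X.price i j ≤ X.value i j * X.price i c

/-- The best item that buyer `i` values and has not passed; `m` if there is none. -/
noncomputable def nextItem (X : IndexedMarket K) (A : ℕ → ℕ → ℕ) (i : ℕ) : ℕ :=
  pickBest (fun j => A i j = 0 ∧ 0 < X.value i j) (X.BangLe i) X.m X.m

/-- The worst buyer that item `j` has not rejected, once `j` is sold out (which row `n` of the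
table of rejections records); `n` as long as `j` is not sold out. -/
noncomputable def cutoff (X : IndexedMarket K) (R : ℕ → ℕ → ℕ) (j : ℕ) : ℕ :=
  if R X.n j = 0 then X.n else pickBest (fun i => R i j = 0) (X.priority j) X.n X.n

theorem nextItem_le (X : IndexedMarket K) (A : ℕ → ℕ → ℕ) (i : ℕ) : X.nextItem A i ≤ X.m :=
  pickBest_le le_rfl

theorem cutoff_le (X : IndexedMarket K) (R : ℕ → ℕ → ℕ) (j : ℕ) : X.cutoff R j ≤ X.n := by
  unfold cutoff
  split_ifs
  · exact le_rfl
  · exact pickBest_le le_rfl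

section System

variable (X : IndexedMarket K) (A R : ℕ → ℕ → ℕ) (s k : ℕ → ℕ)

/-- Coefficients: coordinate `i < n` is minus the money that buyer `i` offers for its next item,
coordinate `n + j` is the fraction of item `j` that goes to its cutoff buyer. -/
def coefW (u v : ℕ) : K :=
  if u < X.n ∧ X.n ≤ v ∧ R u (v - X.n) = 0 ∧ k (v - X.n) = u ∧
      (A u (v - X.n) ≠ 0 ∨ s u = v - X.n) then X.price u (v - X.n)
  else if X.n ≤ u ∧ v < X.n ∧ R v (u - X.n) = 0 ∧ k (u - X.n) ≠ v ∧
      A v (u - X.n) = 0 ∧ s v = u - X.n then 1 / X.price v (u - X.n)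
  else 0

/-- Constants. -/
def coefC (u v : ℕ) : K :=
  if u = v then if u < X.n then -X.budget u else 1
  else if u < X.n ∧ X.n ≤ v ∧ R u (v - X.n) = 0 ∧ k (v - X.n) ≠ u ∧ A u (v - X.n) ≠ 0 then
    X.price u (v - X.n)
  else if X.n ≤ u ∧ v < X.n ∧ R v (u - X.n) = 0 ∧ k (u - X.n) ≠ v ∧ A v (u - X.n) ≠ 0 then -1
  else 0

/-- Lower bounds. -/
def floor (u : ℕ) : K :=
  if X.n ≤ u then 0
  -- Without a next item there is nothing to pass. The offer never exceeds the budget, so a floor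
  -- strictly below minus the budget is never attained.
  else if s u = X.m then -X.budget u - 1
  -- The cutoff buyer takes the residual instead of making an offer, and a rejected buyer makes
  -- none. Floor and ceiling coincide, which forces the buyer to pass the item.
  else if k (s u) = u ∨ R u (s u) ≠ 0 then 0
  else -X.price u (s u)

/-- Upper bounds. -/
def ceiling (u : ℕ) : K :=
  if u < X.n then 0
  -- A cutoff buyer that has neither passed the item nor has it next does not want it yet. The
  -- residual is forced to the floor 0, and the item rejects this buyer.
  else if k (u - X.n) < X.n ∧ A (k (u - X.n)) (u - X.n) = 0 ∧ s (k (u - X.n)) ≠ u - X.n then 0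
  else 1

/-- What buyer `i` pays for item `j`, unless it is the next item. -/
def payment (l : ℕ → K) (i j : ℕ) : K :=
  if R i j = 0 then
    if k j = i then if A i j ≠ 0 ∨ s i = j then X.price i j * l j else 0
    else if A i j ≠ 0 then X.price i j else 0
  else 0

/-- What buyer `i` gets of item `j`, unless it is the cutoff buyer. -/
def demand (z : ℕ → K) (i j : ℕ) : K :=
  if R i j = 0 ∧ k j ≠ i then
    if A i j ≠ 0 then 1 else if s i = j then -z i / X.price i j else 0
  else 0

variable {X A R s k}

/-- The equation of a buyer's coordinate is its money balance. The offer for the next item is not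
part of the payments, so at a fixed point it equals what is left of the budget. -/
theorem affine_buyer (y : ℕ → K) {i : ℕ} (hi : i < X.n) :
    MonotoneSystem.affine (X.n + X.m) (X.coefW A R s k) (X.coefC A R k) y i =
      -X.budget i + ∑ j ∈ Finset.range X.m, X.payment A R s k (fun j => y (X.n + j)) i j := by
  rw [MonotoneSystem.affine, Finset.sum_range_add]
  congr 1
  · rw [Finset.sum_eq_single i]
    · simp [coefC, coefW, hi, not_le.2 hi]
    · intro v hv hvi
      rw [Finset.mem_range] at hv
      simp [coefC, coefW, hi, hvi.symm, not_le.2 hv, not_le.2 hi]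
    · intro h; exact absurd (Finset.mem_range.2 hi) h
  · refine Finset.sum_congr rfl fun j _ => ?_
    have h1 : i ≠ X.n + j := by omega
    simp only [coefC, coefW, payment, hi, h1, not_le.2 hi, Nat.add_sub_cancel_left, true_and,
      false_and, if_false, Nat.le_add_right]
    split_ifs <;> simp_all

/-- The equation of an item's coordinate is its supply balance: the residual is what the buyers
other than the cutoff buyer leave over. -/
theorem affine_item (y : ℕ → K) {j : ℕ} (hj : j < X.m) :
    MonotoneSystem.affine (X.n + X.m) (X.coefW A R s k) (X.coefC A R k) y (X.n + j) =
      1 - ∑ i ∈ Finset.range X.n, X.demand A R s k y i j := by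
  rw [MonotoneSystem.affine, Finset.sum_range_add, add_comm, sub_eq_add_neg]
  congr 1
  · rw [Finset.sum_eq_single j]
    · simp [coefC, coefW]
    · intro v _ hvj
      simp [coefC, coefW, hvj.symm]
    · intro h; exact absurd (Finset.mem_range.2 hj) h
  · rw [← Finset.sum_neg_distrib]
    refine Finset.sum_congr rfl fun i hi => ?_
    rw [Finset.mem_range] at hi
    have h1 : X.n + j ≠ i := by omega
    simp only [coefC, coefW, demand, hi, h1, not_le.2 hi, Nat.add_sub_cancel_left, true_and,
      if_false, Nat.le_add_right, Nat.not_lt.2 (Nat.le_add_right X.n j), false_and]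
    split_ifs <;> simp_all [div_eq_inv_mul]

/-- Recording offers with a minus sign makes all influences nonnegative: a smaller offer leaves a
larger residual, and a larger residual costs the cutoff buyer money that it cannot offer elsewhere.
-/
theorem functional_coefW [IsStrictOrderedRing K] (hX : X.Valid) (hs : ∀ i, s i ≤ X.m)
    (hk : ∀ j, k j ≤ X.n) :
    MonotoneSystem.Functional (X.n + X.m) (X.coefW A R s k) (fun v =>
      if v < X.n then X.n + s v else if k (v - X.n) < X.n ∧ v < X.n + X.m then k (v - X.n)
      else X.n + X.m) where
  nonneg u v := by
    unfold coefW
    split_ifs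
    · exact hX.price_nonneg _ _
    · exact one_div_nonneg.2 (hX.price_nonneg _ _)
    · exact le_rfl
  target u hu v hv h := by
    unfold coefW at h
    split_ifs at h with h1 h2
    · simp [not_lt.2 h1.2.1, h1.2.2.2.1, h1.1, hv]
    · simp only [h2.2.1, if_true]; omega
    · exact absurd rfl h
  sink := by simp
  bounded v hv := by
    have := hs v
    have := hk (v - X.n)
    split_ifs <;> omega

/-- Feasibility, stated for buyers and items separately. -/
structure FeasiblePair (X : IndexedMarket K) (A R : ℕ → ℕ → ℕ) (s k : ℕ → ℕ) (z l : ℕ → K) :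
    Prop where
  floor_le : ∀ i < X.n, X.floor R s k i ≤ z i
  nonpos : ∀ i < X.n, z i ≤ 0
  pay_le : ∀ i < X.n,
    -X.budget i + ∑ j ∈ Finset.range X.m, X.payment A R s k l i j ≤ z i
  nonneg : ∀ j < X.m, 0 ≤ l j
  le_one : ∀ j < X.m, l j ≤ 1
  idle : ∀ j < X.m, k j < X.n → A (k j) j = 0 → s (k j) ≠ j → l j ≤ 0
  supply : ∀ j < X.m, 1 - ∑ i ∈ Finset.range X.n, X.demand A R s k z i j ≤ l j

theorem demand_congr {y z : ℕ → K} {i : ℕ} (h : y i = z i) (j : ℕ) :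
    X.demand A R s k y i j = X.demand A R s k z i j := by
  simp only [demand, h]

theorem feasiblePair_of_feasible [IsStrictOrderedRing K] {y : ℕ → K}
    (h : MonotoneSystem.Feasible (X.n + X.m) (X.coefW A R s k) (X.coefC A R k)
      (X.floor R s k) (X.ceiling A s k) y) :
    X.FeasiblePair A R s k y (fun j => y (X.n + j)) where
  floor_le i hi := (h i (by omega)).1
  nonpos i hi := by simpa [ceiling, hi] using (h i (by omega)).2.1
  pay_le i hi := by rw [← affine_buyer y hi]; exact (h i (by omega)).2.2
  nonneg j hj := by simpa [floor] using (h (X.n + j) (by omega)).1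
  le_one j hj := by
    refine (h (X.n + j) (by omega)).2.1.trans ?_
    unfold ceiling
    split_ifs <;> simp
  idle j hj h1 h2 h3 := by
    refine (h (X.n + j) (by omega)).2.1.trans ?_
    simp [ceiling, h1, h2, h3]
  supply j hj := by rw [← affine_item y hj]; exact (h (X.n + j) (by omega)).2.2

theorem FeasiblePair.exists_feasible {z l : ℕ → K} (h : X.FeasiblePair A R s k z l) :
    ∃ y, MonotoneSystem.Feasible (X.n + X.m) (X.coefW A R s k) (X.coefC A R k)
      (X.floor R s k) (X.ceiling A s k) y := by
  set y : ℕ → K := fun u => if u < X.n then z u else l (u - X.n) with hy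
  have hyl : (fun j => y (X.n + j)) = l := by funext j; simp [hy]
  refine ⟨y, fun u hu => ?_⟩
  by_cases hun : u < X.n
  · have hyu : y u = z u := by simp [hy, hun]
    rw [hyu, affine_buyer y hun, hyl]
    exact ⟨h.floor_le u hun, by simpa [ceiling, hun] using h.nonpos u hun, h.pay_le u hun⟩
  · obtain ⟨j, rfl⟩ := Nat.exists_eq_add_of_le (not_lt.1 hun)
    have hj : j < X.m := by omega
    have hyu : y (X.n + j) = l j := by simp [hy]
    rw [hyu, affine_item y hj, Finset.sum_congr rfl fun i hi =>
      demand_congr (show y i = z i by simp [hy, Finset.mem_range.1 hi]) j]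
    refine ⟨by simpa [floor] using h.nonneg j hj, ?_, h.supply j hj⟩
    simp only [ceiling, hun, if_false, Nat.add_sub_cancel_left]
    split_ifs with hc
    · exact h.idle j hj hc.1 hc.2.1 hc.2.2
    · exact h.le_one j hj

theorem payment_nonneg [IsStrictOrderedRing K] (hX : X.Valid) {l : ℕ → K} {i j : ℕ} (hl : 0 ≤ l j) :
    0 ≤ X.payment A R s k l i j := by
  have := hX.price_nonneg i j
  unfold payment
  split_ifs <;> first | exact mul_nonneg this hl | exact this | exact le_rfl

theorem floor_nonpos [IsStrictOrderedRing K] (hX : X.Valid) (u : ℕ) : X.floor R s k u ≤ 0 := by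
  unfold floor
  split_ifs
  · exact le_rfl
  · have := hX.budget_nonneg u; linarith
  · exact le_rfl
  · exact neg_nonpos.2 (hX.price_nonneg _ _)

end System

end IndexedMarket

/-! ### The invariant of the flag tables and the two kinds of moves -/

namespace IndexedMarket

variable {K : Type} [Field K] [LinearOrder K] [IsStrictOrderedRing K]
variable {X : IndexedMarket K} {A R : ℕ → ℕ → ℕ}

/-- Transitivity follows by cancelling the positive value of the middle item, so free items need no
separate treatment. -/
theorem nextItem_spec (A : ℕ → ℕ → ℕ) (i : ℕ) :
    (X.nextItem A i = X.m ∧ ∀ j < X.m, ¬ (A i j = 0 ∧ 0 < X.value i j)) ∨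
      (X.nextItem A i < X.m ∧ (A i (X.nextItem A i) = 0 ∧ 0 < X.value i (X.nextItem A i)) ∧
        ∀ j < X.m, A i j = 0 ∧ 0 < X.value i j → X.BangLe i j (X.nextItem A i)) := by
  refine pickBest_spec le_rfl (fun _ _ _ _ => le_total _ _) fun a _ b _ c _ ha hb hc hab hbc => ?_
  unfold BangLe at *
  refine le_of_mul_le_mul_left ?_ hb.2
  have h1 := mul_le_mul_of_nonneg_left hbc ha.2.le
  have h2 := mul_le_mul_of_nonneg_left hab hc.2.le
  linarith

/-- What `cutoff` returns. -/
theorem cutoff_spec (hX : X.Valid) (R : ℕ → ℕ → ℕ) {j : ℕ} (hj : j < X.m)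
    (hR : R X.n j ≠ 0) :
    (X.cutoff R j = X.n ∧ ∀ i < X.n, ¬ R i j = 0) ∨
      (X.cutoff R j < X.n ∧ R (X.cutoff R j) j = 0 ∧
        ∀ i < X.n, R i j = 0 → X.priority j i (X.cutoff R j)) := by
  rw [cutoff, if_neg hR]
  exact pickBest_spec le_rfl (hX.total j hj)
    fun a ha b hb c hc _ _ _ => hX.trans j hj a ha b hb c hc

/-- Set an entry of a table of flags. -/
def raise (A : ℕ → ℕ → ℕ) (i j : ℕ) : ℕ → ℕ → ℕ :=
  fun i' j' => if i' = i ∧ j' = j then 1 else A i' j'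

theorem raise_self (A : ℕ → ℕ → ℕ) (i j : ℕ) : raise A i j i j = 1 := by simp [raise]

theorem raise_of_ne {i j i' j' : ℕ} (h : i' ≠ i ∨ j' ≠ j) : raise A i j i' j' = A i' j' := by
  unfold raise
  rw [if_neg]
  tauto

theorem raise_ne_zero {i j i' j' : ℕ} (h : A i' j' ≠ 0) : raise A i j i' j' ≠ 0 := by
  unfold raise
  split_ifs
  · exact one_ne_zero
  · exact h

/-- The facts about the tables of passed items and rejected buyers that the algorithm maintains. -/
structure Invariant (X : IndexedMarket K) (A R : ℕ → ℕ → ℕ) : Prop where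
  unvalued : ∀ i < X.n, ∀ j < X.m, X.value i j ≤ 0 → R i j ≠ 0
  passed : ∀ i < X.n, ∀ j < X.m, ∀ j' < X.m, A i j' ≠ 0 → A i j = 0 → 0 < X.value i j →
    X.BangLe i j j'
  rejected : ∀ j < X.m, ∀ i < X.n, ∀ i' < X.n, R i j ≠ 0 → 0 < X.value i j → R i' j = 0 →
    X.priority j i' i
  sold : ∀ j < X.m, ∀ i < X.n, R i j ≠ 0 → 0 < X.value i j → R X.n j ≠ 0
  kept : ∀ j < X.m, R X.n j ≠ 0 → ∃ i < X.n, R i j = 0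
  feasible : ∃ z l, X.FeasiblePair A R (X.nextItem A) (X.cutoff R) z l

/-- Buyer `i` passes its next item when it offers all it can for that item. -/
theorem Invariant.pass (hX : X.Valid) (h : X.Invariant A R) {i : ℕ} (hi : i < X.n) {z l : ℕ → K}
    (hf : X.FeasiblePair A R (X.nextItem A) (X.cutoff R) z l)
    (hz : z i = X.floor R (X.nextItem A) (X.cutoff R) i) :
    X.nextItem A i < X.m ∧ X.Invariant (raise A i (X.nextItem A i)) R := by
  set s := X.nextItem A with hs
  set k := X.cutoff R with hk
  have hsum : 0 ≤ ∑ j ∈ Finset.range X.m, X.payment A R s k l i j :=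
    Finset.sum_nonneg fun j hj => payment_nonneg hX (hf.nonneg j (Finset.mem_range.1 hj))
  have hspec := nextItem_spec (X := X) A i
  rw [← hs] at hspec
  rcases hspec with hspec | ⟨hsm, ⟨hA0, hval⟩, hbest⟩
  -- Without a next item, sitting at the floor would mean an offer above the budget.
  · exfalso
    have h1 := hf.pay_le i hi
    rw [hz, floor, if_neg (not_le.2 hi), if_pos hspec.1] at h1
    linarith
  refine ⟨hsm, h.unvalued, ?_, h.rejected, h.sold, h.kept, ?_⟩
  · intro a ha j hj j' hj' h1 h2 h3
    have h2' : A a j = 0 := by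
      by_contra h0; exact raise_ne_zero h0 h2
    by_cases hc : a = i ∧ j' = s i
    · obtain ⟨rfl, rfl⟩ := hc
      exact hbest j hj ⟨h2', h3⟩
    · rw [raise, if_neg hc] at h1
      exact h.passed a ha j hj j' hj' h1 h2' h3
  set A' := raise A i (s i) with hA'
  have hAi : A' i (s i) = 1 := raise_self _ _ _
  have hAne : ∀ a j, a ≠ i ∨ j ≠ s i → A' a j = A a j := fun a j => raise_of_ne
  have hsne : ∀ a, a ≠ i → X.nextItem A' a = s a := fun a ha =>
    pickBest_congr fun j _ => by rw [hAne a j (Or.inl ha)]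
  have hp := hX.price_nonneg i (s i)
  have hdem : k (s i) ≠ i → R i (s i) = 0 → z i = -X.price i (s i) := by
    intro h1 h2
    rw [hz, floor, if_neg (not_le.2 hi), if_neg hsm.ne, if_neg]
    push Not; exact ⟨h1, h2⟩
  -- The old offer turns into a payment for the passed item, and the buyer starts with offer zero at
  -- its new next item; the residuals do not change.
  refine ⟨Function.update z i 0, l,
    (?_ : X.FeasiblePair A' R (X.nextItem A') k (Function.update z i 0) l)⟩
  refine ⟨?_, ?_, ?_, hf.nonneg, hf.le_one, ?_, ?_⟩
  · intro a ha
    rcases eq_or_ne a i with rfl | hai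
    · simpa using floor_nonpos hX a
    · rw [Function.update_of_ne hai, floor, hsne a hai]
      exact hf.floor_le a ha
  · intro a ha
    rcases eq_or_ne a i with rfl | hai
    · simp
    · rw [Function.update_of_ne hai]
      exact hf.nonpos a ha
  · intro a ha
    rcases eq_or_ne a i with rfl | hai
    · rw [Function.update_self]
      have hle : ∀ j ∈ Finset.range X.m, X.payment A' R (X.nextItem A') k l a j ≤
          X.payment A R s k l a j + if j = s a then -z a else 0 := by
        intro j hj
        rw [Finset.mem_range] at hj
        have hl := hf.nonneg j hj
        rcases eq_or_ne j (s a) with rfl | hjs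
        · have hza := hf.nonpos a ha
          simp only [payment, hAi, hA0, if_true]
          by_cases hR : R a (s a) = 0
          · by_cases hka : k (s a) = a
            · simp [hR, hka, hza]
            · simp [hR, hka, hdem hka hR]
          · simp [hR, hza]
        · simp only [payment, hAne a j (Or.inr hjs), hjs, if_false, add_zero]
          by_cases hR : R a j = 0
          · by_cases hka : k j = a
            · by_cases hA : A a j = 0
              -- The buyer may be the cutoff buyer of its new next item and start paying for the
              -- residual there. It was idle at that item before the move, so this residual is zero.
              · have hl0 : l j = 0 := le_antisymm
                  (hf.idle j hj (by rw [hka]; exact ha) (by rw [hka]; exact hA)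
                    (by rw [hka]; exact hjs.symm)) hl
                simp [hl0]
              · simp [hA]
            · simp [hka]
          · simp [hR]
      have h1 := Finset.sum_le_sum hle
      rw [Finset.sum_add_distrib, Finset.sum_ite_eq' , if_pos (Finset.mem_range.2 hsm)] at h1
      linarith [hf.pay_le a ha]
    · rw [Function.update_of_ne hai]
      have : ∀ j, X.payment A' R (X.nextItem A') k l a j = X.payment A R s k l a j := fun j => by
        simp only [payment, hAne a j (Or.inl hai), hsne a hai]
      simp only [this]
      exact hf.pay_le a ha
  · intro j hj h1 h2 h3
    by_cases hki : k j = i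
    · refine hf.idle j hj h1 ?_ ?_
      · by_contra h0; exact raise_ne_zero h0 h2
      · intro h0
        rw [hki] at h0
        change A' (k j) j = 0 at h2
        rw [hki, ← h0, hAi] at h2
        exact one_ne_zero h2
    · change A' (k j) j = 0 at h2
      rw [hAne _ _ (Or.inl hki)] at h2
      rw [hsne _ hki] at h3
      exact hf.idle j hj h1 h2 h3
  · intro j hj
    refine le_trans (sub_le_sub_left (Finset.sum_le_sum fun a ha => ?_) 1) (hf.supply j hj)
    rcases eq_or_ne a i with rfl | hai
    · unfold demand
      by_cases hc : R a j = 0 ∧ k j ≠ a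
      · rw [if_pos hc, if_pos hc]
        rcases eq_or_ne (s a) j with hj' | hjs
        · rw [← hj'] at hc ⊢
          -- The demand was price over price and becomes 1. This is an equality except at price
          -- zero, where the quotient is 0.
          rw [hAi, if_pos one_ne_zero, if_neg (not_not.2 hA0), if_pos rfl, hdem hc.2 hc.1, neg_neg]
          exact div_self_le_one _
        · rw [hAne a j (Or.inr hjs.symm)]
          by_cases hA : A a j = 0
          · simp [hA, hjs]
          · simp [hA]
      · rw [if_neg hc, if_neg hc]
    · simp only [demand, hAne a j (Or.inl hai), hsne a hai, Function.update_of_ne hai, le_refl]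

/-- Item `j` rejects its cutoff buyer when that buyer gets nothing. -/
theorem Invariant.reject (hX : X.Valid) (h : X.Invariant A R) {j : ℕ} (hj : j < X.m)
    {z l : ℕ → K} (hf : X.FeasiblePair A R (X.nextItem A) (X.cutoff R) z l) (hl : l j = 0) :
    X.cutoff R j ≤ X.n ∧ R (X.cutoff R j) j = 0 ∧
      X.Invariant A (raise R (X.cutoff R j) j) := by
  set s := X.nextItem A with hs
  set k := X.cutoff R with hk
  -- Index n stands for the fictitious buyer of the unsold part; its rejection records that the item
  -- is sold out. By `kept`, a sold-out item still has a real unrejected buyer, so `cutoff` returns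
  -- n only for items that are not sold out.
  have hknR : k j = X.n → R X.n j = 0 := by
    intro hkn
    by_contra hR
    obtain ⟨i, hi, hi0⟩ := h.kept j hj hR
    rcases cutoff_spec hX R hj hR with hc | hc
    · exact hc.2 i hi hi0
    · exact absurd hkn hc.1.ne
  have hkR : R (k j) j = 0 := by
    by_cases hkn : k j = X.n
    · rw [hkn]; exact hknR hkn
    · have hR : R X.n j ≠ 0 := by
        intro h0; exact hkn (by rw [hk, cutoff, if_pos h0])
      rcases cutoff_spec hX R hj hR with hc | hc
      · exact absurd hc.1 hkn
      · exact hc.2.1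
  refine ⟨cutoff_le X R j, hkR, ?_⟩
  set R' := raise R (k j) j with hR'
  have hRne : ∀ a j', a ≠ k j ∨ j' ≠ j → R' a j' = R a j' := fun a j' => raise_of_ne
  have hRk : R' (k j) j = 1 := raise_self _ _ _
  have hRof : ∀ a j', R' a j' = 0 → R a j' = 0 := fun a j' h1 => by
    by_contra h0; exact raise_ne_zero h0 h1
  have hclosed : R' X.n j ≠ 0 := by
    by_cases hkn : k j = X.n
    · rw [← hkn, hRk]; exact one_ne_zero
    · refine raise_ne_zero fun h0 => hkn ?_
      rw [hk, cutoff, if_pos h0]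
  have hkne : ∀ j', j' ≠ j → X.cutoff R' j' = k j' := by
    intro j' hj'
    simp only [hk, cutoff, hRne X.n j' (Or.inr hj')]
    congr 1
    exact pickBest_congr fun a _ => by rw [hRne a j' (Or.inr hj')]
  set e := X.cutoff R' j with he
  -- As the residual is zero, the other buyers demand the whole item. So one of them exists, and it
  -- can become the new cutoff buyer e.
  have hdem : 1 ≤ ∑ i ∈ Finset.range X.n, X.demand A R s k z i j := by
    have := hf.supply j hj
    rw [hl] at this
    linarith
  obtain ⟨hen, heR', hek, heR⟩ : e < X.n ∧ R' e j = 0 ∧ e ≠ k j ∧ R e j = 0 := by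
    rcases cutoff_spec hX R' hj hclosed with hc | hc
    · exfalso
      rw [Finset.sum_eq_zero] at hdem
      · exact absurd hdem (not_le.2 one_pos)
      · intro a ha
        rw [demand, if_neg]
        rintro ⟨h1, h2⟩
        exact hc.2 a (Finset.mem_range.1 ha) (by rw [hRne a j (Or.inl h2.symm)]; exact h1)
    · refine ⟨hc.1, hc.2.1, ?_, hRof _ _ hc.2.1⟩
      intro h0
      have := hc.2.1
      rw [← he, h0, hRk] at this
      exact one_ne_zero this
  have hnext : s e = j → A e j = 0 := by
    intro hse
    have hspec := nextItem_spec (X := X) A e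
    rw [← hs] at hspec
    rcases hspec with hc | hc
    · omega
    · rw [hse] at hc; exact hc.2.1.1
  -- The new residual: e receives as cutoff buyer exactly what it demanded before.
  set c := X.demand A R s k z e j with hc
  have hzoff : s e = j → -X.price e j ≤ z e := by
    intro hse
    have := hf.floor_le e hen
    rw [floor, if_neg (not_le.2 hen), if_neg (by omega), hse, if_neg] at this
    · exact this
    · push Not; exact ⟨hek.symm, heR⟩
  have hze := hf.nonpos e hen
  have hp := hX.price_nonneg e j
  have hcval : c = if A e j ≠ 0 then 1 else if s e = j then -z e / X.price e j else 0 := by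
    rw [hc, demand, if_pos ⟨heR, hek.symm⟩]
  have hc0 : 0 ≤ c := by
    rw [hcval]
    split_ifs
    · exact zero_le_one
    · exact div_nonneg (by linarith) hp
    · exact le_rfl
  have hc1 : c ≤ 1 := by
    rw [hcval]
    split_ifs with h1 h2
    · exact le_rfl
    · have := hzoff h2
      exact div_le_one_of_le₀ (by linarith) hp
    · exact zero_le_one
  -- At price zero the floor is 0 as well, so the offer vanishes and division by zero does no harm.
  have hpc : s e = j → X.price e j * c = -z e := by
    intro hse
    rw [hcval, if_neg (not_not.2 (hnext hse)), if_pos hse]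
    rcases hp.eq_or_lt with h0 | h0
    · have := hzoff hse
      rw [← h0] at this ⊢
      simp only [neg_zero] at this
      rw [le_antisymm hze this]; simp
    · exact mul_div_cancel₀ _ h0.ne'
  -- If j is the next item of e, its former offer is now counted as the payment for the residual,
  -- and the offer is reset to zero.
  set z' : ℕ → K := fun a => if a = e ∧ s e = j then 0 else z a with hz'
  set l' : ℕ → K := Function.update l j c with hl'
  have hfeas : X.FeasiblePair A R' s (X.cutoff R') z' l' := by
    refine ⟨?_, ?_, ?_, ?_, ?_, ?_, ?_⟩
    · intro a ha
      have hfl := hf.floor_le a ha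
      by_cases hae : a = e ∧ s e = j
      · simp only [hz', if_pos hae]; exact floor_nonpos hX a
      · simp only [hz', if_neg hae]
        refine le_trans ?_ hfl
        unfold floor
        rw [if_neg (not_le.2 ha), if_neg (not_le.2 ha)]
        by_cases hsm : s a = X.m
        · rw [if_pos hsm, if_pos hsm]
        · rw [if_neg hsm, if_neg hsm]
          have hpa := hX.price_nonneg a (s a)
          by_cases h0 : k (s a) = a ∨ R a (s a) ≠ 0
          · rw [if_pos h0]
            split_ifs
            · exact le_rfl
            · exact neg_nonpos.2 hpa
          · rw [if_neg h0, if_neg]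
            push Not at h0 ⊢
            by_cases hsj : s a = j
            · have hka : a ≠ k j := by rw [← hsj]; exact h0.1.symm
              refine ⟨?_, ?_⟩
              · rw [hsj, ← he]
                rintro rfl
                exact hae ⟨rfl, hsj⟩
              · rw [hRne _ _ (Or.inl hka)]; exact h0.2
            · rw [hkne _ hsj, hRne _ _ (Or.inr hsj)]; exact h0
    · intro a ha
      simp only [hz']
      split_ifs
      · exact le_rfl
      · exact hf.nonpos a ha
    · intro a ha
      have hle : ∀ j' ∈ Finset.range X.m, X.payment A R' s (X.cutoff R') l' a j' ≤
          X.payment A R s k l a j' +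
            if j' = j then (if a = e ∧ s e = j then -z e else 0) else 0 := by
        intro j' hj'
        rw [Finset.mem_range] at hj'
        rcases eq_or_ne j' j with rfl | hne
        · rw [if_pos rfl]
          simp only [payment, ← he, hl', Function.update_self]
          rcases eq_or_ne a e with hae | hae
          · rw [hae]
            by_cases hse : s e = j'
            · simp [heR', heR, hse, hek.symm, hpc hse, hnext hse]
            · by_cases hA : A e j' = 0
              · simp [heR', hse, hA, heR]
              · simp [heR', hse, hA, heR, hek.symm, hcval]
          · by_cases hak : a = k j'
            · subst hak
              simp [hRk, hl, hkR, hae]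
            · simp [hRne a j' (Or.inl hak), hae, Ne.symm hae, Ne.symm hak]
        · rw [if_neg hne, add_zero]
          simp [payment, hkne _ hne, hRne a j' (Or.inr hne), hl', hne]
      have h1 := Finset.sum_le_sum hle
      rw [Finset.sum_add_distrib, Finset.sum_ite_eq', if_pos (Finset.mem_range.2 hj)] at h1
      have h2 := hf.pay_le a ha
      simp only [hz']
      split_ifs with hae
      · rw [if_pos hae] at h1
        rw [hae.1] at h1 h2 ⊢
        linarith
      · rw [if_neg hae] at h1
        linarith
    · intro j' hj'
      rcases eq_or_ne j' j with rfl | hne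
      · simpa [hl'] using hc0
      · simpa [hl', hne] using hf.nonneg j' hj'
    · intro j' hj'
      rcases eq_or_ne j' j with rfl | hne
      · simpa [hl'] using hc1
      · simpa [hl', hne] using hf.le_one j' hj'
    · intro j' hj' h1 h2 h3
      rcases eq_or_ne j' j with rfl | hne
      · rw [← he] at h2 h3
        simp [hl', hcval, h2, h3]
      · rw [hkne _ hne] at h1 h2 h3
        simpa [hl', hne] using hf.idle j' hj' h1 h2 h3
    · intro j' hj'
      rcases eq_or_ne j' j with rfl | hne
      -- Only the demand of e disappears from the sum, and the residual rises by exactly this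
      -- amount.
      · have hle : ∀ a ∈ Finset.range X.n, X.demand A R s k z a j' ≤
            X.demand A R' s (X.cutoff R') z' a j' + if a = e then c else 0 := by
          intro a _
          rcases eq_or_ne a e with rfl | hae
          · rw [if_pos rfl, ← hc]
            simp [demand, ← he]
          · rw [if_neg hae, add_zero]
            by_cases hak : a = k j'
            · simp [demand, hak, hRk]
            · simp [demand, hRne a j' (Or.inl hak), ← he, Ne.symm hae, Ne.symm hak, hz', hae]
        have h1 := Finset.sum_le_sum hle
        rw [Finset.sum_add_distrib, Finset.sum_ite_eq', if_pos (Finset.mem_range.2 hen)] at h1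
        simp only [hl', Function.update_self]
        linarith
      · have : ∀ a, X.demand A R' s (X.cutoff R') z' a j' = X.demand A R s k z a j' := by
          intro a
          simp only [demand, hkne _ hne, hRne a j' (Or.inr hne)]
          by_cases hsa : s a = j'
          · have : ¬ (a = e ∧ s e = j) := by
              rintro ⟨rfl, h0⟩; exact hne (hsa.symm.trans h0)
            simp only [hz', if_neg this]
          · simp [hsa]
        simp only [this, hl', Function.update_of_ne hne]
        exact hf.supply j' hj'
  refine ⟨?_, h.passed, ?_, ?_, ?_, z', l', hfeas⟩
  · intro a ha j' hj' h1
    exact raise_ne_zero (h.unvalued a ha j' hj' h1)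
  · intro j' hj' a ha a' ha' h1 h2 h3
    by_cases hcase : a = k j ∧ j' = j
    · obtain ⟨rfl, rfl⟩ := hcase
      have hR : R X.n j' ≠ 0 := by
        intro h0
        have : k j' = X.n := by rw [hk, cutoff, if_pos h0]
        omega
      rcases cutoff_spec hX R hj' hR with hc | hc
      · exact absurd (hRof _ _ h3) (hc.2 a' ha')
      · exact hc.2.2 a' ha' (hRof _ _ h3)
    · rw [hR', raise, if_neg hcase] at h1
      exact h.rejected j' hj' a ha a' ha' h1 h2 (hRof _ _ h3)
  · intro j' hj' a ha h1 h2
    rcases eq_or_ne j' j with rfl | hne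
    · exact hclosed
    · rw [hRne _ _ (Or.inr hne)] at h1 ⊢
      exact h.sold j' hj' a ha h1 h2
  · intro j' hj' h1
    rcases eq_or_ne j' j with rfl | hne
    · exact ⟨e, hen, heR'⟩
    · rw [hRne _ _ (Or.inr hne)] at h1
      obtain ⟨a, ha, ha0⟩ := h.kept j' hj' h1
      exact ⟨a, ha, by rw [hRne _ _ (Or.inr hne)]; exact ha0⟩

end IndexedMarket

/-! ### The initial tables, and stability of the allocation at a fixed point -/

namespace IndexedMarket

variable {K : Type} [Field K] [LinearOrder K] [IsStrictOrderedRing K]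
variable {X : IndexedMarket K} {A R : ℕ → ℕ → ℕ}

/-- Nothing is offered and nothing is sold: z = 0, and the fictitious buyer holds every item
entirely, l = 1. -/
theorem invariant_initial (hX : X.Valid) (hA : ∀ i < X.n, ∀ j < X.m, A i j = 0)
    (hR : ∀ i < X.n, ∀ j < X.m, R i j ≠ 0 ↔ X.value i j ≤ 0) (hRn : ∀ j < X.m, R X.n j = 0) :
    X.Invariant A R := by
  have hk : ∀ j < X.m, X.cutoff R j = X.n := fun j hj => by rw [cutoff, if_pos (hRn j hj)]
  refine ⟨fun i hi j hj h => (hR i hi j hj).2 h, ?_, ?_, ?_, ?_, fun _ => 0, fun _ => 1, ?_⟩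
  · intro i hi j _ j' hj' h; exact absurd (hA i hi j' hj') h
  · intro j hj i hi i' _ h h'; exact absurd h' (not_lt.2 ((hR i hi j hj).1 h))
  · intro j hj i hi h h'; exact absurd h' (not_lt.2 ((hR i hi j hj).1 h))
  · intro j hj h; exact absurd (hRn j hj) h
  · refine ⟨fun i _ => floor_nonpos hX i, fun _ _ => le_rfl, fun i hi => ?_,
      fun _ _ => zero_le_one, fun _ _ => le_rfl, fun j hj h => ?_, fun j _ => ?_⟩
    · rw [Finset.sum_eq_zero]
      · simpa using hX.budget_nonneg i
      · intro j hj
        rw [Finset.mem_range] at hj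
        simp [payment, hk j hj, hi.ne', hA i hi j hj]
    · rw [hk j hj] at h; exact absurd h (lt_irrefl _)
    · rw [sub_le_self_iff]
      refine Finset.sum_nonneg fun i _ => ?_
      unfold demand
      split_ifs <;> simp

/-- The allocation that belongs to a fixed point of the system. -/
def allocation (X : IndexedMarket K) (A R : ℕ → ℕ → ℕ) (s k : ℕ → ℕ) (y : ℕ → K) (i j : ℕ) : K :=
  if R i j ≠ 0 then 0
  else if k j = i then y (X.n + j)
  else if A i j ≠ 0 then 1
  else if s i = j then (0 - y i) / X.price i j
  else 0

/-- Stability of an allocation, in terms of field operations only. -/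
structure Stable (X : IndexedMarket K) (x : ℕ → ℕ → K) : Prop where
  nonneg : ∀ i < X.n, ∀ j < X.m, 0 ≤ x i j
  supply : ∀ j < X.m, ∑ i ∈ Finset.range X.n, x i j ≤ 1
  budget_feasible : ∀ i < X.n, ∑ j ∈ Finset.range X.m, x i j * X.price i j ≤ X.budget i
  valued : ∀ i < X.n, ∀ j < X.m, 0 < x i j → 0 < X.value i j
  no_deviation : ∀ i < X.n, ∀ j < X.m, 0 < X.value i j → x i j < 1 →
    ((∀ j' < X.m, 0 < x i j' → X.BangLe i j j') ∧
      ∑ j ∈ Finset.range X.m, x i j * X.price i j = X.budget i) ∨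
    (∑ i' ∈ Finset.range X.n, x i' j = 1 ∧
      ∀ i' < X.n, i' ≠ i → 0 < x i' j → X.priority j i' i)

/-- Lying strictly above the floor means that no move is pending, and the equations say that budgets
and supplies balance. A buyer short of a valued item either still has a next item, and then its
money is exhausted on items at least as good, or it is the cutoff or rejected, and then the item is
sold out to buyers of at least its priority. -/
theorem Invariant.stable (hX : X.Valid) (h : X.Invariant A R) {y : ℕ → K}
    (hy : ∀ u < X.n + X.m, X.floor R (X.nextItem A) (X.cutoff R) u < y u ∧
      y u ≤ X.ceiling A (X.nextItem A) (X.cutoff R) u ∧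
      MonotoneSystem.affine (X.n + X.m) (X.coefW A R (X.nextItem A) (X.cutoff R))
        (X.coefC A R (X.cutoff R)) y u = y u) :
    X.Stable (X.allocation A R (X.nextItem A) (X.cutoff R) y) := by
  set s := X.nextItem A with hs
  set k := X.cutoff R with hk
  have hpay : ∀ i < X.n, -X.budget i +
      ∑ j ∈ Finset.range X.m, X.payment A R s k (fun j => y (X.n + j)) i j = y i :=
    fun i hi => by rw [← affine_buyer y hi]; exact (hy i (by omega)).2.2
  have hsup : ∀ j < X.m, 1 - ∑ i ∈ Finset.range X.n, X.demand A R s k y i j = y (X.n + j) :=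
    fun j hj => by rw [← affine_item y hj]; exact (hy (X.n + j) (by omega)).2.2
  have hneg : ∀ i < X.n, y i ≤ 0 := fun i hi => by
    have := (hy i (by omega)).2.1
    rwa [ceiling, if_pos hi] at this
  have hpos : ∀ j < X.m, 0 < y (X.n + j) := fun j hj => by
    have := (hy (X.n + j) (by omega)).1
    rwa [floor, if_pos (Nat.le_add_right _ _)] at this
  -- The coordinate is at most 0 and strictly above its floor. So the floor is not 0, which excludes
  -- cutoff and rejected buyers and makes the price positive.
  have hbuyer : ∀ i < X.n, s i < X.m → k (s i) ≠ i ∧ R i (s i) = 0 ∧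
      -X.price i (s i) < y i ∧ 0 < X.price i (s i) := by
    intro i hi hsi
    have h1 := (hy i (by omega)).1
    have h2 := hneg i hi
    rw [floor, if_neg (not_le.2 hi), if_neg hsi.ne] at h1
    split_ifs at h1 with hc
    · exact absurd h2 (not_le.2 h1)
    · push Not at hc
      exact ⟨hc.1, hc.2, h1, by linarith⟩
  -- The residual is positive, so its ceiling is not 0. If the cutoff buyer has not passed the item,
  -- the item must be its next one, which `hbuyer` excludes.
  have hitem : ∀ j < X.m, k j < X.n → A (k j) j ≠ 0 := by
    intro j hj hkj hA
    have h1 := (hy (X.n + j) (by omega)).2.1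
    have h2 := hpos j hj
    by_cases hsj : s (k j) = j
    · have := (hbuyer (k j) hkj (by omega)).1
      rw [hsj] at this
      exact this rfl
    · rw [ceiling, if_neg (by omega), Nat.add_sub_cancel_left, if_pos ⟨hkj, hA, hsj⟩] at h1
      exact absurd h1 (not_le.2 h2)
  have hnext : ∀ i j, j < X.m → s i = j → A i j = 0 ∧ 0 < X.value i j := by
    intro i j hj hsi
    rcases nextItem_spec (X := X) A i with hc | hc
    · rw [← hs] at hc; omega
    · rw [← hs, hsi] at hc; exact hc.2.1
  set x := X.allocation A R s k y with hx
  have hnonneg : ∀ i < X.n, ∀ j < X.m, 0 ≤ x i j := by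
    intro i hi j hj
    simp only [hx, allocation]
    split_ifs
    · exact le_rfl
    · exact (hpos j hj).le
    · exact zero_le_one
    · exact div_nonneg (by linarith [hneg i hi]) (hX.price_nonneg _ _)
    · exact le_rfl
  -- The shares are the demands plus the residual of the cutoff buyer. If the cutoff is the index n,
  -- the residual stays unsold.
  have hdem : ∀ j < X.m, ∀ i, x i j = X.demand A R s k y i j +
      if i = k j then (if k j < X.n then y (X.n + j) else x i j) else 0 := by
    intro j hj i
    by_cases hki : k j = i
    · by_cases hkn : k j < X.n
      · have hR : R i j = 0 := by
          have hRn : R X.n j ≠ 0 := fun h0 => by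
            rw [hk, cutoff, if_pos h0] at hkn; exact lt_irrefl _ hkn
          rcases cutoff_spec hX R hj hRn with hc | hc
          · rw [← hk] at hc; omega
          · rw [← hk, hki] at hc; exact hc.2.1
        rw [if_pos hki.symm, if_pos hkn]
        simp [hx, allocation, demand, hki, hR]
      · rw [if_pos hki.symm, if_neg hkn]
        simp [demand, hki]
    · rw [if_neg (Ne.symm hki), add_zero]
      simp only [hx, allocation, demand]
      by_cases hR : R i j = 0 <;> simp [hR, hki]
  have hsum : ∀ j < X.m, ∑ i ∈ Finset.range X.n, x i j =
      1 - y (X.n + j) + if k j < X.n then y (X.n + j) else 0 := by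
    intro j hj
    rw [Finset.sum_congr rfl fun i _ => hdem j hj i, Finset.sum_add_distrib, Finset.sum_ite_eq',
      ← hsup j hj]
    by_cases hkn : k j < X.n
    · simp [hkn]
    · simp [hkn]
  have hspend : ∀ i < X.n, ∑ j ∈ Finset.range X.m, x i j * X.price i j =
      X.budget i + y i + if s i < X.m then -y i else 0 := by
    intro i hi
    -- Besides the payments, the buyer spends its offer on its share of the next item; hence
    -- spending equals the budget whenever there is a next item.
    have hterm : ∀ j ∈ Finset.range X.m, x i j * X.price i j =
        X.payment A R s k (fun j => y (X.n + j)) i j + if j = s i then -y i else 0 := by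
      intro j hj
      rw [Finset.mem_range] at hj
      simp only [hx, allocation, payment]
      by_cases hsj : s i = j
      · obtain ⟨h1, h2, -, h4⟩ := hbuyer i hi (by omega)
        rw [hsj] at h1 h2 h4
        simp [h1, h2, hsj, (hnext i j hj hsj).1, h4.ne']
      · rw [if_neg (Ne.symm hsj), add_zero]
        by_cases hR : R i j = 0
        · by_cases hki : k j = i
          · have := hitem j hj (by omega)
            rw [hki] at this
            simp [hR, hki, this, mul_comm]
          · by_cases hA : A i j = 0
            · simp [hR, hki, hA, hsj]
            · simp [hR, hki, hA]
        · simp [hR]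
    rw [Finset.sum_congr rfl hterm, Finset.sum_add_distrib, Finset.sum_ite_eq']
    have := hpay i hi
    simp only [Finset.mem_range]
    linarith
  have hRx : ∀ i j, 0 < x i j → R i j = 0 := by
    intro i j h0
    by_contra hR
    simp [hx, allocation, hR] at h0
  refine ⟨hnonneg, ?_, ?_, ?_, ?_⟩
  · intro j hj
    rw [hsum j hj]
    have := hpos j hj
    split_ifs <;> linarith
  · intro i hi
    rw [hspend i hi]
    have := hneg i hi
    split_ifs <;> linarith
  · intro i hi j hj h0
    by_contra hv
    exact h.unvalued i hi j hj (not_lt.1 hv) (hRx i j h0)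
  · intro i hi j hj hv hx1
    have hsold : k j < X.n → ∑ i' ∈ Finset.range X.n, x i' j = 1 := by
      intro hkn
      rw [hsum j hj, if_pos hkn]; ring
    have hcut : R X.n j ≠ 0 → k j < X.n ∧ ∀ i' < X.n, R i' j = 0 → X.priority j i' (k j) := by
      intro hRn
      rcases cutoff_spec hX R hj hRn with hc | hc
      · obtain ⟨a, ha, ha0⟩ := h.kept j hj hRn
        exact absurd ha0 (hc.2 a ha)
      · exact ⟨hc.1, hc.2.2⟩
    by_cases hR : R i j = 0
    · by_cases hki : k j = i
      · right
        have hRn : R X.n j ≠ 0 := fun h0 => by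
          rw [hk, cutoff, if_pos h0] at hki; omega
        refine ⟨hsold (by omega), fun i' hi' _ h0 => ?_⟩
        rw [← hki]
        exact (hcut hRn).2 i' hi' (hRx i' j h0)
      -- An item that was passed and is neither rejecting nor rationing the buyer is bought
      -- entirely, so here the item has not been passed and a next item exists.
      · have hA : A i j = 0 := by
          by_contra hA
          simp [hx, allocation, hR, hki, hA] at hx1
        left
        rcases nextItem_spec (X := X) A i with hc | hc
        · exact absurd ⟨hA, hv⟩ (hc.2 j hj)
        · rw [← hs] at hc
          have hspi := hspend i hi
          rw [if_pos hc.1] at hspi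
          refine ⟨fun j' hj' h0 => ?_, by rw [hspi]; ring⟩
          by_cases hA' : A i j' = 0
          · by_cases hsj : s i = j'
            · rw [← hsj]; exact hc.2.2 j hj ⟨hA, hv⟩
            · exfalso
              have hR' := hRx i j' h0
              by_cases hki' : k j' = i
              · have := hitem j' hj' (by omega)
                rw [hki'] at this
                exact this hA'
              · simp [hx, allocation, hR', hki', hA', hsj] at h0
          · exact h.passed i hi j hj j' hj' hA' hA hv
    · right
      have hRn := h.sold j hj i hi hR hv
      exact ⟨hsold (hcut hRn).1, fun i' hi' _ h0 =>
        h.rejected j hj i hi i' hi' hR hv (hRx i' j h0)⟩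

end IndexedMarket

/-! ## The program -/

namespace RandomAccess

/-- An entry of a table of natural numbers. -/
def cell (a : ℕ) (i j : IdxExpr) : IdxExpr := .read a i j (.lit 0)

/-- An entry of a table of field elements. -/
def vcell (a : ℕ) (i j : IdxExpr) : ValExpr := .read a i j (.lit 0)

/-- A register for a field element. -/
def vreg (r : ℕ) : ValExpr := .read r (.lit 0) (.lit 0) (.lit 0)

/-- Assignment to an entry of a table of natural numbers. -/
def Program.put (a : ℕ) (i j e : IdxExpr) : Program := .writeIdx a i j (.lit 0) e

/-- Assignment to an entry of a table of field elements. -/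
def Program.putVal (a : ℕ) (i j : IdxExpr) (e : ValExpr) : Program := .writeVal a i j (.lit 0) e

namespace Test

def isSet (e : IdxExpr) : Test := .neg (.idxLe e (.lit 0))
def eq (e f : IdxExpr) : Test := .conj (.idxLe e f) (.idxLe f e)
def lt (e f : IdxExpr) : Test := .neg (.idxLe f e)
def disj (b c : Test) : Test := .neg (.conj (.neg b) (.neg c))

end Test

/-- The number of buyers. -/
def buyers : IdxExpr := reg 0

/-- The number of items. -/
def items : IdxExpr := .read 0 (.lit 1) (.lit 0) (.lit 0)

/-- The number of coordinates of the system. -/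
def coords : IdxExpr := reg 7

/-- Reject all buyers that do not value an item; request a first round. -/
def initProgram : Program :=
  .seq (.put 7 (.lit 0) (.lit 0) (.add buyers items))
  (.seq (.for 10 buyers (.for 11 items
    (.branch (.valLe (vcell 0 (reg 10) (reg 11)) (.lit 0)) (.put 4 (reg 10) (reg 11) (.lit 1))
      .skip)))
  (.put 30 (.lit 0) (.lit 0) (.lit 1)))

/-- Compute the next item of every buyer. -/
def nextItemProgram : Program :=
  .for 10 buyers (.seq (.put 5 (reg 10) (.lit 0) items)
    (.for 11 items (.branch
      (.conj (.conj (.neg (.isSet (cell 3 (reg 10) (reg 11))))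
          (.neg (.valLe (vcell 0 (reg 10) (reg 11)) (.lit 0))))
        (.disj (.eq (cell 5 (reg 10) (.lit 0)) items)
          (.valLe
            (.mul (vcell 0 (reg 10) (cell 5 (reg 10) (.lit 0))) (vcell 1 (reg 10) (reg 11)))
            (.mul (vcell 0 (reg 10) (reg 11)) (vcell 1 (reg 10) (cell 5 (reg 10) (.lit 0)))))))
      (.put 5 (reg 10) (.lit 0) (reg 11)) .skip)))

/-- Compute the cutoff buyer of every item. -/
def cutoffProgram : Program :=
  .for 11 items (.seq (.put 6 (reg 11) (.lit 0) buyers)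
    (.branch (.isSet (cell 4 buyers (reg 11)))
      (.for 10 buyers (.branch
        (.conj (.neg (.isSet (cell 4 (reg 10) (reg 11))))
          (.disj (.eq (cell 6 (reg 11) (.lit 0)) buyers)
            (.isSet (.read 1 (reg 11) (cell 6 (reg 11) (.lit 0)) (reg 10)))))
        (.put 6 (reg 11) (.lit 0) (reg 10)) .skip))
      .skip))

/-- The item of the coordinate in register `r`. -/
def itemOf (r : ℕ) : IdxExpr := .sub (reg r) buyers

/-- Buyer (coordinate in register `r`) is not rejected by the item (coordinate in register `q`). -/
def unrejected (r q : ℕ) : Test :=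
  .conj (.lt (reg r) buyers) (.conj (.neg (.lt (reg q) buyers))
    (.neg (.isSet (cell 4 (reg r) (itemOf q)))))

/-- Buyer (register `r`) is the cutoff buyer of the item (register `q`). -/
def isCutoff (r q : ℕ) : Test := .eq (cell 6 (itemOf q) (.lit 0)) (reg r)

/-- Buyer (register `r`) has passed the item (register `q`). -/
def isPassed (r q : ℕ) : Test := .isSet (cell 3 (reg r) (itemOf q))

/-- The item (register `q`) is the next item of the buyer (register `r`). -/
def isNext (r q : ℕ) : Test := .eq (cell 5 (reg r) (.lit 0)) (itemOf q)

/-- Compute the coefficients, the constants and the lower bounds. -/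
def systemProgram : Program :=
  .for 12 coords (.seq
    (.branch (.neg (.lt (reg 12) buyers)) (.putVal 6 (reg 12) (.lit 0) (.lit 0))
    (.branch (.eq (cell 5 (reg 12) (.lit 0)) items)
      (.putVal 6 (reg 12) (.lit 0) (.sub (.sub (.lit 0) (vcell 2 (reg 12) (.lit 0))) (.lit 1)))
    (.branch (.disj (.eq (cell 6 (cell 5 (reg 12) (.lit 0)) (.lit 0)) (reg 12))
        (.isSet (cell 4 (reg 12) (cell 5 (reg 12) (.lit 0)))))
      (.putVal 6 (reg 12) (.lit 0) (.lit 0))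
      (.putVal 6 (reg 12) (.lit 0)
        (.sub (.lit 0) (vcell 1 (reg 12) (cell 5 (reg 12) (.lit 0))))))))
    (.for 13 coords (.seq
      (.branch (.conj (unrejected 12 13) (.conj (isCutoff 12 13)
          (.disj (isPassed 12 13) (isNext 12 13))))
        (.putVal 4 (reg 12) (reg 13) (vcell 1 (reg 12) (itemOf 13)))
      (.branch (.conj (unrejected 13 12) (.conj (.neg (isCutoff 13 12))
          (.conj (.neg (isPassed 13 12)) (isNext 13 12))))
        (.putVal 4 (reg 12) (reg 13) (.div (.lit 1) (vcell 1 (reg 13) (itemOf 12))))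
        (.putVal 4 (reg 12) (reg 13) (.lit 0))))
      (.branch (.eq (reg 12) (reg 13))
        (.branch (.lt (reg 12) buyers)
          (.putVal 5 (reg 12) (reg 13) (.sub (.lit 0) (vcell 2 (reg 12) (.lit 0))))
          (.putVal 5 (reg 12) (reg 13) (.lit 1)))
      (.branch (.conj (unrejected 12 13) (.conj (.neg (isCutoff 12 13)) (isPassed 12 13)))
        (.putVal 5 (reg 12) (reg 13) (vcell 1 (reg 12) (itemOf 13)))
      (.branch (.conj (unrejected 13 12) (.conj (.neg (isCutoff 13 12)) (isPassed 13 12)))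
        (.putVal 5 (reg 12) (reg 13) (.lit (-1)))
        (.putVal 5 (reg 12) (reg 13) (.lit 0))))))))

/-- Apply the affine map to iterate `t`, at coordinate `v`; the result goes to register `9`. -/
def affineProgram (t v : IdxExpr) : Program :=
  .seq (.putVal 9 (.lit 0) (.lit 0) (.lit 0))
  (.for 23 coords (.putVal 9 (.lit 0) (.lit 0)
    (.add (vreg 9) (.add (vcell 5 v (reg 23)) (.mul (vcell 4 v (reg 23)) (vcell 7 t (reg 23)))))))

/-- Compute the response of the coordinate in register `14` to the number in register `10`;
the result goes to register `9`. -/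
def responseProgram : Program :=
  .seq (.for 21 coords (.branch (.eq (reg 21) (reg 14))
    (.putVal 7 (.lit 0) (reg 21) (vreg 10))
    (.putVal 7 (.lit 0) (reg 21) (vcell 6 (reg 21) (.lit 0)))))
  (.seq (.for 22 coords (.for 21 coords (.seq (affineProgram (reg 22) (reg 21))
    (.branch (.eq (reg 21) (reg 14))
      (.putVal 7 (.add (reg 22) (.lit 1)) (reg 21) (vreg 10))
    (.branch (.valLe (vreg 9) (vcell 6 (reg 21) (.lit 0)))
      (.putVal 7 (.add (reg 22) (.lit 1)) (reg 21) (vcell 6 (reg 21) (.lit 0)))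
      (.putVal 7 (.add (reg 22) (.lit 1)) (reg 21) (vreg 9)))))))
  (affineProgram coords (reg 14)))

/-- Search for a coordinate whose response to its lower bound is at most that bound. -/
def searchProgram : Program :=
  .seq (.put 30 (.lit 0) (.lit 0) (.lit 0))
  (.for 14 coords (.seq (.putVal 10 (.lit 0) (.lit 0) (vcell 6 (reg 14) (.lit 0)))
    (.seq responseProgram
    (.branch (.valLe (vreg 9) (vcell 6 (reg 14) (.lit 0)))
      (.seq (.put 30 (.lit 0) (.lit 0) (.lit 1)) (.put 31 (.lit 0) (.lit 0) (reg 14))) .skip))))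

/-- Move the pointer of the coordinate found. -/
def advanceProgram : Program :=
  .branch (.isSet (reg 30))
    (.branch (.lt (reg 31) buyers)
      (.put 3 (reg 31) (cell 5 (reg 31) (.lit 0)) (.lit 1))
      (.put 4 (cell 6 (itemOf 31) (.lit 0)) (itemOf 31) (.lit 1)))
    .skip

/-- One round. -/
def roundProgram : Program :=
  .seq nextItemProgram (.seq cutoffProgram (.seq systemProgram (.seq searchProgram advanceProgram)))

/-- Compute the fixed point of the final system. -/
def solveProgram : Program :=
  .for 14 coords (.seq (.putVal 10 (.lit 0) (.lit 0) (.lit 1)) (.seq responseProgram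
    (.seq (.putVal 11 (.lit 0) (.lit 0) (vreg 9))
    (.seq (.putVal 10 (.lit 0) (.lit 0) (.lit 2)) (.seq responseProgram
    (.putVal 8 (reg 14) (.lit 0)
      (.div (.sub (.mul (.lit 2) (vreg 11)) (vreg 9))
        (.sub (.lit 1) (.sub (vreg 9) (vreg 11))))))))))

/-- Write the allocation. -/
def outputProgram : Program :=
  .for 10 buyers (.for 11 items
    (.branch (.isSet (cell 4 (reg 10) (reg 11))) (.putVal 3 (reg 10) (reg 11) (.lit 0))
    (.branch (.eq (cell 6 (reg 11) (.lit 0)) (reg 10))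
      (.putVal 3 (reg 10) (reg 11) (vcell 8 (.add buyers (reg 11)) (.lit 0)))
    (.branch (.isSet (cell 3 (reg 10) (reg 11))) (.putVal 3 (reg 10) (reg 11) (.lit 1))
    (.branch (.eq (cell 5 (reg 10) (.lit 0)) (reg 11))
      (.putVal 3 (reg 10) (reg 11)
        (.div (.sub (.lit 0) (vcell 8 (reg 10) (.lit 0))) (vcell 1 (reg 10) (reg 11))))
      (.putVal 3 (reg 10) (reg 11) (.lit 0)))))))

/-- The program that computes a stable allocation. -/
def stableAllocationProgram : Program :=
  .seq initProgram (.seq (.loop (.isSet (reg 30)) roundProgram) (.seq solveProgram outputProgram))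

/-! ## Its verification -/

section Simp

variable {K : Type} [Field K] [LinearOrder K] {s : Store K}

@[simp] theorem cell_eval (a : ℕ) (i j : IdxExpr) :
    (cell a i j).eval s = s.idx a (i.eval s) (j.eval s) 0 := rfl
@[simp] theorem vcell_eval (a : ℕ) (i j : IdxExpr) :
    (vcell a i j).eval s = s.val a (i.eval s) (j.eval s) 0 := rfl
@[simp] theorem vreg_eval (r : ℕ) : (vreg r).eval s = s.val r 0 0 0 := rfl
@[simp] theorem Test.isSet_holds (e : IdxExpr) : (Test.isSet e).Holds s ↔ e.eval s ≠ 0 := by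
  simp [Test.isSet, Test.Holds, IdxExpr.eval]
@[simp] theorem Test.eq_holds (e f : IdxExpr) :
    (Test.eq e f).Holds s ↔ e.eval s = f.eval s := by
  simp [Test.eq, Test.Holds, le_antisymm_iff]
@[simp] theorem Test.lt_holds (e f : IdxExpr) :
    (Test.lt e f).Holds s ↔ e.eval s < f.eval s := by
  simp [Test.lt, Test.Holds]
@[simp] theorem Test.disj_holds (b c : Test) :
    (Test.disj b c).Holds s ↔ b.Holds s ∨ c.Holds s := by
  simp only [Test.disj, Test.Holds]; tauto
@[simp] theorem buyers_eval : buyers.eval s = s.idx 0 0 0 0 := rfl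
@[simp] theorem items_eval : items.eval s = s.idx 0 1 0 0 := rfl
@[simp] theorem coords_eval : coords.eval s = s.idx 7 0 0 0 := rfl
@[simp] theorem itemOf_eval (r : ℕ) :
    (itemOf r).eval s = s.idx r 0 0 0 - s.idx 0 0 0 0 := rfl

variable {Λ : Meter K} {Post : Store K → Prop}

theorem Run.put {a : ℕ} {i j e : IdxExpr} (hsize : i.size ≤ 300 ∧ j.size ≤ 300 ∧ e.size ≤ 300)
    (he : Λ.Ok s → e.eval s ≤ Λ.top)
    (h : Post { s with idx := writeCell s.idx a (i.eval s) (j.eval s) 0 (e.eval s) }) :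
    Run Λ (.put a i j e) s 1 Post :=
  Run.writeIdx ⟨hsize.1, hsize.2.1, by decide, hsize.2.2⟩ he h

theorem Run.putVal {a : ℕ} {i j : IdxExpr} {e : ValExpr}
    (hsize : i.size ≤ 300 ∧ j.size ≤ 300 ∧ e.size ≤ 300)
    (he : Λ.Ok s → Λ.small Λ.level (e.eval s))
    (h : Post { s with val := writeCell s.val a (i.eval s) (j.eval s) 0 (e.eval s) }) :
    Run Λ (.putVal a i j e) s 1 Post :=
  Run.writeVal ⟨hsize.1, hsize.2.1, by decide, hsize.2.2⟩ he h

/-- Filling a table. -/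
theorem Run.table {r₁ r₂ b₁ b₂ τ : ℕ} {e₁ e₂ : IdxExpr} {P : Program}
    (Q : ℕ → ℕ → Store K → Prop) (J : Store K → Prop)
    (hsize : e₁.size ≤ 290 ∧ e₂.size ≤ 290)
    (hr : (Program.for r₂ e₂ P).writesIdx r₁ = false ∧ P.writesIdx r₂ = false)
    (he₁ : ∀ t, Frame (.for r₁ e₁ (.for r₂ e₂ P)) s t → e₁.eval t = b₁)
    (he₂ : ∀ t, Frame (.for r₁ e₁ (.for r₂ e₂ P)) s t → e₂.eval t = b₂)
    (hb : b₁ ≤ Λ.top ∧ b₂ ≤ Λ.top)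
    (hJ : J s) (hJreg : ∀ t x, J t → J (t.setReg r₁ x) ∧ J (t.setReg r₂ x))
    (hQreg : ∀ i j t x, Q i j t → Q i j (t.setReg r₁ x) ∧ Q i j (t.setReg r₂ x))
    (hstep : ∀ i < b₁, ∀ j < b₂, ∀ t, Frame (.for r₁ e₁ (.for r₂ e₂ P)) s t →
      t.idx r₁ 0 0 0 = i → t.idx r₂ 0 0 0 = j → J t → Run Λ P t τ (fun t' => J t' ∧ Q i j t' ∧
        ∀ i' j', i' ≠ i ∨ j' ≠ j → Q i' j' t → Q i' j' t')) :
    Run Λ (.for r₁ e₁ (.for r₂ e₂ P)) s (2 + b₁ * ((2 + b₂ * (τ + 2)) + 2))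
      (fun t => J t ∧ ∀ i < b₁, ∀ j < b₂, Q i j t) := by
  have hframe : ∀ t u, Frame (.for r₁ e₁ (.for r₂ e₂ P)) s t → Frame (.for r₂ e₂ P) t u →
      Frame (.for r₁ e₁ (.for r₂ e₂ P)) s u := by
    intro t u h h'
    refine h.trans ⟨fun a ha => h'.idx a ?_, fun a ha => h'.val a ?_⟩
    · rw [Program.for, Program.writesIdx, Bool.or_eq_false_iff] at ha
      simp only [Program.writesIdx, Bool.or_eq_false_iff] at ha
      exact ha.2.1
    · rw [Program.for, Program.writesVal, Bool.or_eq_false_iff] at ha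
      simp only [Program.writesVal, Bool.or_eq_false_iff] at ha
      exact ha.2.1
  refine Run.for (fun k t => J t ∧ ∀ i < k, ∀ j < b₂, Q i j t) hsize.1 hr.1 he₁ hb.1
    ⟨hJ, by simp⟩ (fun k t x h => ⟨(hJreg t x h.1).1, fun i hi j hj =>
      (hQreg i j t x (h.2 i hi j hj)).1⟩) ?_
  intro i hi t ht hti hinv
  refine (Run.for (s := t) (r := r₂) (fun k t => J t ∧ (∀ i' < i, ∀ j < b₂, Q i' j t) ∧
    ∀ j < k, Q i j t) hsize.2 hr.2 (fun u hu => he₂ u (hframe t u ht hu)) hb.2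
    ⟨hinv.1, hinv.2, by simp⟩ (fun k t x h => ⟨(hJreg t x h.1).2,
      fun i hi j hj => (hQreg i j t x (h.2.1 i hi j hj)).2,
      fun j hj => (hQreg i j t x (h.2.2 j hj)).2⟩) ?_).mono le_rfl ?_
  · intro j hj u hu huj hinv'
    have hui : u.idx r₁ 0 0 0 = i := by rw [hu.idx r₁ hr.1]; exact hti
    refine (hstep i hi j hj u (hframe t u ht hu) hui huj hinv'.1).mono le_rfl ?_
    rintro w - ⟨h1, h2, h3⟩
    refine ⟨h1, fun i' hi' j' hj' => h3 i' j' (Or.inl hi'.ne) (hinv'.2.1 i' hi' j' hj'),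
      fun j' hj' => ?_⟩
    rcases Nat.lt_succ_iff_lt_or_eq.1 hj' with hlt | rfl
    · exact h3 i j' (Or.inr hlt.ne) (hinv'.2.2 j' hlt)
    · exact h2
  · rintro u - ⟨h1, h2, h3⟩
    refine ⟨h1, fun i' hi' j hj => ?_⟩
    rcases Nat.lt_succ_iff_lt_or_eq.1 hi' with hlt | rfl
    · exact h2 i' hlt j hj
    · exact h3 j hj

end Simp

end RandomAccess

/-! ### How the store represents a market and its flag tables -/

namespace RandomAccess

open IndexedMarket MonotoneSystem

variable {K : Type} [Field K] [LinearOrder K]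

/-- The input arrays hold the market `X`. -/
structure Encodes (X : IndexedMarket K) (s : Store K) : Prop where
  n : s.idx 0 0 0 0 = X.n
  m : s.idx 0 1 0 0 = X.m
  value : ∀ i j, s.val 0 i j 0 = X.value i j
  price : ∀ i j, s.val 1 i j 0 = X.price i j
  budget : ∀ i, s.val 2 i 0 0 = X.budget i
  priority : ∀ j i i', s.idx 1 j i i' ≠ 0 ↔ X.priority j i i'

/-- The program does not write to the input arrays. -/
def Program.keepsInput (P : Program) : Bool :=
  !(P.writesIdx 0 || P.writesIdx 1 || P.writesVal 0 || P.writesVal 1 || P.writesVal 2)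

theorem Encodes.frame {X : IndexedMarket K} {P : Program} {s t : Store K} (h : Encodes X s)
    (hP : P.keepsInput = true) (hf : Frame P s t) : Encodes X t := by
  simp only [Program.keepsInput, Bool.not_eq_true', Bool.or_eq_false_iff] at hP
  obtain ⟨⟨⟨⟨h0, h1⟩, h2⟩, h3⟩, h4⟩ := hP
  constructor
  · rw [hf.idx 0 h0]; exact h.n
  · rw [hf.idx 0 h0]; exact h.m
  · rw [hf.val 0 h2]; exact h.value
  · rw [hf.val 1 h3]; exact h.price
  · rw [hf.val 2 h4]; exact h.budget
  · rw [hf.idx 1 h1]; exact h.priority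

/-- The store holds the market `X`, the number of coordinates, and the tables `A` of passed items
and `R` of rejections. -/
structure Flags (X : IndexedMarket K) (A R : ℕ → ℕ → ℕ) (s : Store K) : Prop
    extends Encodes X s where
  coords : s.idx 7 0 0 0 = X.n + X.m
  passed : ∀ i j, s.idx 3 i j 0 = A i j
  rejected : ∀ i j, s.idx 4 i j 0 = R i j

/-- The program does not write to the arrays that `Flags` refers to. -/
def Program.keepsFlags (P : Program) : Bool :=
  P.keepsInput && !(P.writesIdx 3 || P.writesIdx 4 || P.writesIdx 7)

theorem Flags.frame {X : IndexedMarket K} {A R : ℕ → ℕ → ℕ} {P : Program} {s t : Store K}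
    (h : Flags X A R s) (hP : P.keepsFlags = true) (hf : Frame P s t) : Flags X A R t := by
  simp only [Program.keepsFlags, Bool.and_eq_true, Bool.not_eq_true', Bool.or_eq_false_iff] at hP
  obtain ⟨h0, ⟨h1, h2⟩, h3⟩ := hP
  refine ⟨h.toEncodes.frame h0 hf, ?_, ?_, ?_⟩
  · rw [hf.idx 7 h3]; exact h.coords
  · rw [hf.idx 3 h1]; exact h.passed
  · rw [hf.idx 4 h2]; exact h.rejected

end RandomAccess

namespace IndexedMarket

variable {K : Type} [Field K] [LinearOrder K]

/-- The fixed point of the system, if no lower bound is active. -/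
def solution (X : IndexedMarket K) (A R : ℕ → ℕ → ℕ) (s k : ℕ → ℕ) (u : ℕ) : K :=
  (2 * MonotoneSystem.response (X.n + X.m) (X.coefW A R s k) (X.coefC A R k) (X.floor R s k) u 1 -
      MonotoneSystem.response (X.n + X.m) (X.coefW A R s k) (X.coefC A R k) (X.floor R s k) u 2) /
    (1 - (MonotoneSystem.response (X.n + X.m) (X.coefW A R s k) (X.coefC A R k)
        (X.floor R s k) u 2 -
      MonotoneSystem.response (X.n + X.m) (X.coefW A R s k) (X.coefC A R k) (X.floor R s k) u 1))

end IndexedMarket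

/-! ### Bounds on the numbers stored; the programs for the affine map and the response -/

namespace RandomAccess

open IndexedMarket MonotoneSystem

variable {K : Type} [Field K] [LinearOrder K]

/-- The bounds of a meter allow for all numbers that occur in the algorithm on the market `X`. -/
structure Meter.Fits (Λ : Meter K) (X : IndexedMarket K) : Prop where
  top : X.n + X.m + 2 ≤ Λ.top
  lit : ∀ c : ℤ, c.natAbs ≤ 2 → Λ.small Λ.level (c : K)
  recip : ∀ i j, Λ.small Λ.level (1 / X.price i j)
  neg_price : ∀ i j, Λ.small Λ.level (0 - X.price i j)
  neg_budget : ∀ i, Λ.small Λ.level (0 - X.budget i)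
  neg_budget_sub : ∀ i, Λ.small Λ.level (0 - X.budget i - 1)
  -- All partial sums are included, because the summation loop stores each of them in its
  -- accumulator.
  sums : ∀ (A R : ℕ → ℕ → ℕ) (s k : ℕ → ℕ) (u : ℕ) (θ : K),
    θ = X.floor R s k u ∨ θ = 1 ∨ θ = 2 → ∀ t ≤ X.n + X.m, ∀ v < X.n + X.m, ∀ w ≤ X.n + X.m,
      Λ.small Λ.level (affine w (X.coefW A R s k) (X.coefC A R k)
        (pinned (X.n + X.m) (X.coefW A R s k) (X.coefC A R k) (X.floor R s k) u θ t) v)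
  solution : ∀ (A R : ℕ → ℕ → ℕ) (s k : ℕ → ℕ) (u : ℕ), u < X.n + X.m →
    Λ.small Λ.level (X.solution A R s k u)
  share : ∀ (A R : ℕ → ℕ → ℕ) (s k : ℕ → ℕ) (u j : ℕ), u < X.n + X.m →
    Λ.small Λ.level ((0 - X.solution A R s k u) / X.price u j)

/-- The arrays `4`, `5` and `6` hold a system with `N` coordinates. -/
structure HoldsSystem (N : ℕ) (W C : ℕ → ℕ → K) (b : ℕ → K) (s : Store K) : Prop where
  coords : s.idx 7 0 0 0 = N
  coefW : ∀ u < N, ∀ v < N, s.val 4 u v 0 = W u v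
  coefC : ∀ u < N, ∀ v < N, s.val 5 u v 0 = C u v
  floor : ∀ u < N, s.val 6 u 0 0 = b u

def Program.keepsSystem (P : Program) : Bool :=
  !(P.writesIdx 7 || P.writesVal 4 || P.writesVal 5 || P.writesVal 6)

variable {Λ : Meter K} {N : ℕ} {W C : ℕ → ℕ → K} {b : ℕ → K} {s : Store K}

theorem HoldsSystem.frame {P : Program} {t : Store K} (h : HoldsSystem N W C b s)
    (hP : P.keepsSystem = true) (hf : Frame P s t) : HoldsSystem N W C b t := by
  simp only [Program.keepsSystem, Bool.not_eq_true', Bool.or_eq_false_iff] at hP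
  obtain ⟨⟨⟨h0, h1⟩, h2⟩, h3⟩ := hP
  constructor
  · rw [hf.idx 7 h0]; exact h.coords
  · rw [hf.val 4 h1]; exact h.coefW
  · rw [hf.val 5 h2]; exact h.coefC
  · rw [hf.val 6 h3]; exact h.floor

/-- A bound on the number of steps of `affineProgram`. -/
def affineSteps (N : ℕ) : ℕ := 1 + (2 + N * (1 + 2))

/-- Row `T` of array 7 holds the argument `y`. The index expressions may read any register except
the summation counter 23, which is what `hev` expresses. -/
theorem run_affineProgram {t v : IdxExpr} (ht : t.size ≤ 10) (hv : v.size ≤ 10) {T V : ℕ}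
    (hev : ∀ s' : Store K, (∀ a, a ≠ 23 → s'.idx a = s.idx a) → t.eval s' = T ∧ v.eval s' = V)
    (hs : HoldsSystem N W C b s) (hN : N ≤ Λ.top) (hV : V < N) {y : ℕ → K}
    (hy : ∀ w < N, s.val 7 T w 0 = y w)
    (hsmall : ∀ w ≤ N, Λ.small Λ.level (affine w W C y V)) :
    Run Λ (affineProgram t v) s (affineSteps N) (fun s' => s'.val 9 0 0 0 = affine N W C y V) := by
  refine Run.seq (Mid := fun s' => s'.val 9 0 0 0 = affine 0 W C y V)
    (Run.putVal (by decide) (fun _ => ?_) ?_) fun s₁ hf₁ h₁ => ?_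
  · simpa [affine, ValExpr.eval] using hsmall 0 (Nat.zero_le _)
  · simp [writeCell, affine, ValExpr.eval, IdxExpr.eval]
  · have hs₁ : HoldsSystem N W C b s₁ := hs.frame rfl hf₁
    refine Run.for (fun k s' => s'.val 9 0 0 0 = affine k W C y V) (by decide) rfl
      (fun s₂ hf₂ => (hs₁.frame rfl hf₂).coords) hN h₁ (fun k s' x h => h) ?_
    intro w hw s₂ hf₂ hw₂ hacc
    have hs₂ : HoldsSystem N W C b s₂ := hs₁.frame rfl hf₂
    obtain ⟨htT, hvV⟩ := hev s₂ fun a ha => by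
      rw [hf₂.idx a (by simpa [Program.for, Program.writesIdx, Program.putVal] using ha.symm),
        hf₁.idx a rfl]
    have heval : (ValExpr.add (vreg 9) (.add (vcell 5 v (reg 23))
        (.mul (vcell 4 v (reg 23)) (vcell 7 t (reg 23))))).eval s₂ = affine (w + 1) W C y V := by
      simp only [ValExpr.eval, vreg_eval, vcell_eval, reg_eval, htT, hvV, hw₂, hacc]
      rw [hs₂.coefW V hV w hw, hs₂.coefC V hV w hw, hf₂.val 7 rfl, hf₁.val 7 rfl, hy w hw]
      simp [affine, Finset.sum_range_succ]
    refine Run.putVal ⟨by decide, by decide, ?_⟩ (fun _ => by rw [heval]; exact hsmall _ hw) ?_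
    · simp only [ValExpr.size, vreg, vcell, reg, IdxExpr.size]
      omega
    · rw [heval]; simp [writeCell, IdxExpr.eval]

/-- A bound on the number of steps of `responseProgram`. -/
def responseSteps (N : ℕ) : ℕ :=
  (2 + N * ((1 + 1) + 2)) +
    ((2 + N * ((2 + N * ((affineSteps N + (1 + 1 + 1)) + 2)) + 2)) + affineSteps N)

/-- Row t of array 7 holds the t-th iterate. Each round writes a new row and leaves the preceding
one intact, so all coordinates are updated from the same iterate. -/
theorem run_responseProgram {u : ℕ} {θ : K} (hs : HoldsSystem N W C b s) (hN : N + 2 ≤ Λ.top)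
    (hu : u < N) (hreg : s.idx 14 0 0 0 = u) (hθ : s.val 10 0 0 0 = θ)
    (hsmall : ∀ t ≤ N, ∀ v < N, ∀ w ≤ N,
      Λ.small Λ.level (affine w W C (pinned N W C b u θ t) v)) :
    Run Λ responseProgram s (responseSteps N)
      (fun s' => s'.val 9 0 0 0 = response N W C b u θ) := by
  refine Run.seq (Mid := fun s' => ∀ v < N, s'.val 7 0 v 0 = pinned N W C b u θ 0 v) ?_
    fun s₁ hf₁ h₁ => ?_
  · refine Run.for (fun k s' => ∀ v < k, s'.val 7 0 v 0 = pinned N W C b u θ 0 v)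
      (by decide) rfl (fun s₂ hf₂ => (hs.frame rfl hf₂).coords) (by omega) (by simp)
      (fun k s' x h => h) ?_
    intro v hv s₂ hf₂ hv₂ hinv
    have hs₂ := hs.frame rfl hf₂
    have hu₂ : s₂.idx 14 0 0 0 = u := by rw [hf₂.idx 14 rfl]; exact hreg
    have hθ₂ : s₂.val 10 0 0 0 = θ := by rw [hf₂.val 10 rfl]; exact hθ
    refine Run.branch (by decide) (fun h => ?_) (fun h => ?_)
    · simp only [Test.eq_holds, reg_eval, hv₂, hu₂] at h
      refine Run.putVal (by decide) (fun hok => hok.2 _ _ _ _) fun w hw => ?_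
      simp only [writeCell, reg_eval, hv₂, IdxExpr.eval, vreg_eval, hθ₂, true_and, and_true]
      split_ifs with hwv
      · simp [pinned, hwv, h]
      · exact hinv w (by omega)
    · simp only [Test.eq_holds, reg_eval, hv₂, hu₂] at h
      refine Run.putVal (by decide) (fun hok => hok.2 _ _ _ _) fun w hw => ?_
      simp only [writeCell, reg_eval, hv₂, IdxExpr.eval, vcell_eval, true_and, and_true]
      split_ifs with hwv
      · simp [pinned, hwv, h, hs₂.floor v hv]
      · exact hinv w (by omega)
  · have hs₁ : HoldsSystem N W C b s₁ := hs.frame rfl hf₁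
    have hu₁ : s₁.idx 14 0 0 0 = u := by rw [hf₁.idx 14 rfl]; exact hreg
    have hθ₁ : s₁.val 10 0 0 0 = θ := by rw [hf₁.val 10 rfl]; exact hθ
    refine Run.seq (Mid := fun s' => ∀ v < N, s'.val 7 N v 0 = pinned N W C b u θ N v) ?_
      fun s₂ hf₂ h₂ => ?_
    · refine Run.for (fun k s' => ∀ v < N, s'.val 7 k v 0 = pinned N W C b u θ k v)
        (by decide) rfl (fun s₂ hf₂ => (hs₁.frame rfl hf₂).coords) (by omega) h₁
        (fun k s' x h => h) ?_
      intro t ht s₂ hf₂ ht₂ hinv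
      have hs₂ := hs₁.frame rfl hf₂
      have hu₂ : s₂.idx 14 0 0 0 = u := by rw [hf₂.idx 14 rfl]; exact hu₁
      have hθ₂ : s₂.val 10 0 0 0 = θ := by rw [hf₂.val 10 rfl]; exact hθ₁
      refine Run.mono (Run.for (b := N) (fun k s' =>
        (∀ v < N, s'.val 7 t v 0 = pinned N W C b u θ t v) ∧
          ∀ v < k, s'.val 7 (t + 1) v 0 = pinned N W C b u θ (t + 1) v)
        (by decide) rfl (fun s₃ hf₃ => (hs₂.frame rfl hf₃).coords) (by omega)
        ⟨hinv, by simp⟩ (fun k s' x h => h) ?_) le_rfl fun _ _ h => h.2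
      intro v hv s₃ hf₃ hv₃ hinv₃
      have hs₃ := hs₂.frame rfl hf₃
      have ht₃ : s₃.idx 22 0 0 0 = t := by rw [hf₃.idx 22 rfl]; exact ht₂
      have hu₃ : s₃.idx 14 0 0 0 = u := by rw [hf₃.idx 14 rfl]; exact hu₂
      have hθ₃ : s₃.val 10 0 0 0 = θ := by rw [hf₃.val 10 rfl]; exact hθ₂
      refine Run.seq (run_affineProgram (T := t) (V := v) (y := pinned N W C b u θ t)
        (by decide) (by decide) (fun s' h => ?_) hs₃ (by omega) hv hinv₃.1
        (hsmall t ht.le v hv)) fun s₄ hf₄ h₄ => ?_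
      · simp only [reg_eval]
        rw [h 22 (by decide), h 21 (by decide)]
        exact ⟨ht₃, hv₃⟩
      · have hs₄ := hs₃.frame rfl hf₄
        have ht₄ : s₄.idx 22 0 0 0 = t := by rw [hf₄.idx 22 rfl]; exact ht₃
        have hu₄ : s₄.idx 14 0 0 0 = u := by rw [hf₄.idx 14 rfl]; exact hu₃
        have hv₄ : s₄.idx 21 0 0 0 = v := by rw [hf₄.idx 21 rfl]; exact hv₃
        have hθ₄ : s₄.val 10 0 0 0 = θ := by rw [hf₄.val 10 rfl]; exact hθ₃
        have hz : s₄.val 7 = s₃.val 7 := hf₄.val 7 rfl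
        have key : ∀ e : ValExpr, e.eval s₄ = pinned N W C b u θ (t + 1) v →
            (fun s' : Store K => (∀ v < N, s'.val 7 t v 0 = pinned N W C b u θ t v) ∧
              ∀ w < v + 1, s'.val 7 (t + 1) w 0 = pinned N W C b u θ (t + 1) w)
            { s₄ with
              val := writeCell s₄.val 7 ((IdxExpr.add (reg 22) (.lit 1)).eval s₄)
                ((reg 21).eval s₄) 0 (e.eval s₄) } := by
          intro e he
          refine ⟨fun w hw => ?_, fun w hw => ?_⟩
          · simp only [writeCell, IdxExpr.eval, reg_eval, ht₄]
            rw [if_neg (by omega), hz]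
            exact hinv₃.1 w hw
          · simp only [writeCell, IdxExpr.eval, reg_eval, ht₄, hv₄, true_and, and_true, he, hz]
            split_ifs with hwv
            · rw [hwv]
            · exact hinv₃.2 w (by omega)
        refine Run.branch (by decide) (fun h => ?_) (fun h => ?_)
        · simp only [Test.eq_holds, reg_eval, hv₄, hu₄] at h
          refine (Run.putVal (by decide) (fun hok => hok.2 _ _ _ _) (key _ ?_)).mono
            (by omega) fun _ _ h => h
          simp [hθ₄, pinned, h]
        · simp only [Test.eq_holds, reg_eval, hv₄, hu₄] at h
          refine Run.branch (by decide) (fun hle => ?_) (fun hle => ?_)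
          · simp only [Test.Holds, vreg_eval, vcell_eval, reg_eval, hv₄, h₄, IdxExpr.eval,
              hs₄.floor v hv] at hle
            refine Run.putVal (by decide) (fun hok => hok.2 _ _ _ _) (key _ ?_)
            simp [hv₄, hs₄.floor v hv, pinned, h, IdxExpr.eval, hle]
          · simp only [Test.Holds, vreg_eval, vcell_eval, reg_eval, hv₄, h₄, IdxExpr.eval,
              hs₄.floor v hv, not_le] at hle
            refine Run.putVal (by decide) (fun hok => hok.2 _ _ _ _) (key _ ?_)
            simp [h₄, pinned, h, hle.le]
    · have hs₂ := hs₁.frame rfl hf₂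
      refine run_affineProgram (T := N) (V := u) (by decide) (by decide) (fun s' h => ?_)
        hs₂ (by omega) hu h₂ (hsmall N le_rfl u hu)
      simp only [reg_eval, coords_eval]
      rw [h 7 (by decide), h 14 (by decide), hf₂.idx 14 rfl]
      exact ⟨hs₂.coords, hu₁⟩

end RandomAccess

/-! ### The programs for next items and cutoff buyers -/

namespace RandomAccess

open IndexedMarket MonotoneSystem

variable {K : Type} [Field K] [LinearOrder K]
variable {Λ : Meter K} {X : IndexedMarket K} {A R : ℕ → ℕ → ℕ} {s : Store K} {N : ℕ}

theorem Run.for_le {P : Program} {r b τ N : ℕ} {bound : IdxExpr} (hbN : b ≤ N)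
    (Inv : ℕ → Store K → Prop)
    (hsize : bound.size ≤ 290) (hr : P.writesIdx r = false)
    (hbound : ∀ t, Frame (.for r bound P) s t → bound.eval t = b) (hb : b ≤ Λ.top)
    (h0 : Inv 0 s) (hinv : ∀ k t x, Inv k t → Inv k (t.setReg r x))
    (hstep : ∀ k < b, ∀ t, Frame (.for r bound P) s t → t.idx r 0 0 0 = k → Inv k t →
      Run Λ P t τ (Inv (k + 1))) :
    Run Λ (.for r bound P) s (2 + N * (τ + 2)) (Inv b) :=
  (Run.for Inv hsize hr hbound hb h0 hinv hstep).mono (by gcongr) fun _ _ h => h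

/-- A bound on the number of steps of `nextItemProgram`. -/
def nextItemSteps (N : ℕ) : ℕ := 2 + N * ((1 + (2 + N * ((1 + 1) + 2))) + 2)

/-- The inner loop follows the recursion of `pickBest`, with the table entry itself as the best
index so far. -/
theorem run_nextItemProgram (hs : Flags X A R s) (hΛ : Λ.Fits X) :
    Run Λ nextItemProgram s (nextItemSteps (X.n + X.m))
      (fun t => ∀ i < X.n, t.idx 5 i 0 0 = X.nextItem A i) := by
  have htop := hΛ.top
  refine Run.for_le (Nat.le_add_right _ _) (fun k t => ∀ i < k, t.idx 5 i 0 0 = X.nextItem A i)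
    (by decide) rfl (fun t ht => (hs.frame rfl ht).n) (by omega) (by simp)
    (fun k t x h i hi => by rw [Store.setReg_idx_of_ne (by decide)]; exact h i hi) ?_
  intro i hi t ht hti hinv
  have hst := hs.frame rfl ht
  refine Run.seq (Mid := fun t' => t'.idx 5 i 0 0 = X.m ∧
    ∀ i' < i, t'.idx 5 i' 0 0 = X.nextItem A i') (Run.put (by decide) (fun _ => ?_) ?_) ?_
  · rw [items_eval, hst.m]; omega
  · refine ⟨by simp [writeCell, IdxExpr.eval, hti, hst.m], fun i' hi' => ?_⟩
    simp only [writeCell, IdxExpr.eval, reg_eval, hti]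
    rw [if_neg (by omega)]
    exact hinv i' hi'
  · intro t₁ ht₁ h₁
    have hst₁ := hst.frame rfl ht₁
    refine Run.mono (Run.for_le (N := X.n + X.m) (Nat.le_add_left _ _) (fun k t' => t'.idx 5 i 0 0 =
        pickBest (fun j => A i j = 0 ∧ 0 < X.value i j) (X.BangLe i) X.m k ∧
        ∀ i' < i, t'.idx 5 i' 0 0 = X.nextItem A i')
      (by decide) rfl (fun t ht => (hst₁.frame rfl ht).m) (by omega) h₁
      (fun k t x h => by rw [Store.setReg_idx_of_ne (by decide)]; exact h) ?_) le_rfl ?_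
    · intro j hj t₂ ht₂ htj hinv₂
      have hst₂ := hst₁.frame rfl ht₂
      have hti₂ : t₂.idx 10 0 0 0 = i := by rw [ht₂.idx 10 rfl, ht₁.idx 10 rfl]; exact hti
      have htest : (Test.conj (.conj (.neg (.isSet (cell 3 (reg 10) (reg 11))))
          (.neg (.valLe (vcell 0 (reg 10) (reg 11)) (.lit 0))))
          (.disj (.eq (cell 5 (reg 10) (.lit 0)) items)
          (.valLe
            (.mul (vcell 0 (reg 10) (cell 5 (reg 10) (.lit 0))) (vcell 1 (reg 10) (reg 11)))
            (.mul (vcell 0 (reg 10) (reg 11))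
              (vcell 1 (reg 10) (cell 5 (reg 10) (.lit 0))))))).Holds t₂ ↔
          (A i j = 0 ∧ 0 < X.value i j) ∧
          (pickBest (fun j => A i j = 0 ∧ 0 < X.value i j) (X.BangLe i) X.m j = X.m ∨
            X.BangLe i (pickBest (fun j => A i j = 0 ∧ 0 < X.value i j) (X.BangLe i) X.m j) j) := by
        simp only [Test.Holds, Test.isSet_holds, Test.eq_holds, Test.disj_holds, cell_eval,
          vcell_eval, reg_eval, items_eval, ValExpr.eval, IdxExpr.eval, hti₂, htj, hinv₂.1,
          hst₂.value, hst₂.price, hst₂.m, hst₂.passed, Int.cast_zero, not_le, not_not, BangLe]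
      refine Run.branch (by decide) (fun h => ?_) (fun h => ?_)
      · rw [htest] at h
        refine Run.put (by decide) (fun hok => hok.1 _ _ _ _) ⟨?_, fun i' hi' => ?_⟩
        · simp only [pickBest]
          rw [if_pos h]
          simp [writeCell, IdxExpr.eval, hti₂, htj]
        · simp only [writeCell, IdxExpr.eval, reg_eval, hti₂]
          rw [if_neg (by omega)]
          exact hinv₂.2 i' hi'
      · rw [htest] at h
        refine Run.skip ⟨?_, hinv₂.2⟩
        simp only [pickBest]
        rw [if_neg h]
        exact hinv₂.1
    · rintro t₂ - ⟨h2, h3⟩ i' hi'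
      rcases Nat.lt_succ_iff_lt_or_eq.1 hi' with hlt | rfl
      · exact h3 i' hlt
      · exact h2

/-- A bound on the number of steps of `cutoffProgram`. -/
def cutoffSteps (N : ℕ) : ℕ := 2 + N * ((1 + ((2 + N * ((1 + 1) + 2)) + 1)) + 2)

theorem run_cutoffProgram (hs : Flags X A R s) (hΛ : Λ.Fits X) :
    Run Λ cutoffProgram s (cutoffSteps (X.n + X.m))
      (fun t => ∀ j < X.m, t.idx 6 j 0 0 = X.cutoff R j) := by
  have htop := hΛ.top
  refine Run.for_le (Nat.le_add_left _ _) (fun k t => ∀ j < k, t.idx 6 j 0 0 = X.cutoff R j)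
    (by decide) rfl (fun t ht => (hs.frame rfl ht).m) (by omega) (by simp)
    (fun k t x h i hi => by rw [Store.setReg_idx_of_ne (by decide)]; exact h i hi) ?_
  intro j hj t ht htj hinv
  have hst := hs.frame rfl ht
  refine Run.seq (Mid := fun t' => t'.idx 6 j 0 0 = X.n ∧
    ∀ j' < j, t'.idx 6 j' 0 0 = X.cutoff R j') (Run.put (by decide) (fun _ => ?_) ?_) ?_
  · rw [buyers_eval, hst.n]; omega
  · refine ⟨by simp [writeCell, IdxExpr.eval, htj, hst.n], fun j' hj' => ?_⟩
    simp only [writeCell, IdxExpr.eval, reg_eval, htj]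
    rw [if_neg (by omega)]
    exact hinv j' hj'
  · intro t₁ ht₁ h₁
    have hst₁ := hst.frame rfl ht₁
    have htj₁ : t₁.idx 11 0 0 0 = j := by rw [ht₁.idx 11 rfl]; exact htj
    refine Run.branch (by decide) (fun h => ?_) (fun h => ?_)
    · simp only [Test.isSet_holds, cell_eval, buyers_eval, reg_eval, htj₁, hst₁.n,
        hst₁.rejected] at h
      refine Run.mono (Run.for_le (N := X.n + X.m) (Nat.le_add_right _ _) (fun k t' =>
          t'.idx 6 j 0 0 = pickBest (fun i => R i j = 0) (X.priority j) X.n k ∧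
          ∀ j' < j, t'.idx 6 j' 0 0 = X.cutoff R j')
        (by decide) rfl (fun t ht => (hst₁.frame rfl ht).n) (by omega) h₁
        (fun k t x h => by rw [Store.setReg_idx_of_ne (by decide)]; exact h) ?_) le_rfl ?_
      · intro i hi t₂ ht₂ hti hinv₂
        have hst₂ := hst₁.frame rfl ht₂
        have htj₂ : t₂.idx 11 0 0 0 = j := by rw [ht₂.idx 11 rfl]; exact htj₁
        have htest : (Test.conj (.neg (.isSet (cell 4 (reg 10) (reg 11))))
            (.disj (.eq (cell 6 (reg 11) (.lit 0)) buyers)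
            (.isSet (.read 1 (reg 11) (cell 6 (reg 11) (.lit 0)) (reg 10))))).Holds t₂ ↔
            R i j = 0 ∧ (pickBest (fun i => R i j = 0) (X.priority j) X.n i = X.n ∨
              X.priority j (pickBest (fun i => R i j = 0) (X.priority j) X.n i) i) := by
          simp only [Test.Holds, Test.isSet_holds, Test.eq_holds, Test.disj_holds, cell_eval,
            reg_eval, buyers_eval, IdxExpr.eval, htj₂, hti, hinv₂.1, hst₂.n, hst₂.rejected,
            hst₂.priority, not_not]
        refine Run.branch (by decide) (fun h => ?_) (fun h => ?_)
        · rw [htest] at h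
          refine Run.put (by decide) (fun hok => hok.1 _ _ _ _) ⟨?_, fun j' hj' => ?_⟩
          · simp only [pickBest]
            rw [if_pos h]
            simp [writeCell, IdxExpr.eval, htj₂, hti]
          · simp only [writeCell, IdxExpr.eval, reg_eval, htj₂]
            rw [if_neg (by omega)]
            exact hinv₂.2 j' hj'
        · rw [htest] at h
          refine Run.skip ⟨?_, hinv₂.2⟩
          simp only [pickBest]
          rw [if_neg h]
          exact hinv₂.1
      · rintro t₂ - ⟨h2, h3⟩ j' hj'
        rcases Nat.lt_succ_iff_lt_or_eq.1 hj' with hlt | rfl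
        · exact h3 j' hlt
        · rw [h2, cutoff, if_neg h]
    · simp only [Test.isSet_holds, cell_eval, buyers_eval, reg_eval, htj₁, hst₁.n,
        hst₁.rejected, not_not] at h
      refine Run.mono (τ := 1) (Run.skip fun j' hj' => ?_) (by omega) fun _ _ h => h
      rcases Nat.lt_succ_iff_lt_or_eq.1 hj' with hlt | rfl
      · exact h₁.2 j' hlt
      · rw [h₁.1, cutoff, if_pos h]

/-- The store holds the tables of next items and cutoff buyers. -/
structure Pointers (X : IndexedMarket K) (A R : ℕ → ℕ → ℕ) (s : Store K) : Prop where
  next : ∀ i < X.n, s.idx 5 i 0 0 = X.nextItem A i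
  cutoff : ∀ j < X.m, s.idx 6 j 0 0 = X.cutoff R j

theorem Pointers.frame {P : Program} {t : Store K} (h : Pointers X A R s)
    (h5 : P.writesIdx 5 = false) (h6 : P.writesIdx 6 = false) (hf : Frame P s t) :
    Pointers X A R t :=
  ⟨by rw [hf.idx 5 h5]; exact h.next, by rw [hf.idx 6 h6]; exact h.cutoff⟩

theorem unrejected_holds (hs : Flags X A R s) (r q : ℕ) :
    (unrejected r q).Holds s ↔ s.idx r 0 0 0 < X.n ∧ X.n ≤ s.idx q 0 0 0 ∧
      R (s.idx r 0 0 0) (s.idx q 0 0 0 - X.n) = 0 := by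
  simp [unrejected, Test.Holds, hs.n, hs.rejected]

theorem isCutoff_holds (hs : Flags X A R s) (hp : Pointers X A R s) {r q : ℕ}
    (hq : s.idx q 0 0 0 - X.n < X.m) :
    (isCutoff r q).Holds s ↔ X.cutoff R (s.idx q 0 0 0 - X.n) = s.idx r 0 0 0 := by
  simp [isCutoff, hs.n, IdxExpr.eval, hp.cutoff _ hq]

theorem isPassed_holds (hs : Flags X A R s) (r q : ℕ) :
    (isPassed r q).Holds s ↔ A (s.idx r 0 0 0) (s.idx q 0 0 0 - X.n) ≠ 0 := by
  simp [isPassed, hs.n, hs.passed]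

theorem isNext_holds (hs : Flags X A R s) (hp : Pointers X A R s) {r q : ℕ}
    (hr : s.idx r 0 0 0 < X.n) :
    (isNext r q).Holds s ↔ X.nextItem A (s.idx r 0 0 0) = s.idx q 0 0 0 - X.n := by
  simp [isNext, hs.n, IdxExpr.eval, hp.next _ hr]

end RandomAccess

/-! ### The programs that build the system and search it for a possible move -/

namespace RandomAccess

open IndexedMarket MonotoneSystem

variable {K : Type} [Field K] [LinearOrder K]
variable {Λ : Meter K} {X : IndexedMarket K} {A R : ℕ → ℕ → ℕ} {s : Store K} {N : ℕ}

/-- The pointer tables are known only at indices in range. When a coordinate has the wrong kind,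
truncated subtraction leads to irrelevant cells, but then the first conjunct already fails; hence
the case distinction. -/
theorem active_holds (hs : Flags X A R s) (hp : Pointers X A R s) {r q : ℕ}
    (hq : s.idx q 0 0 0 < X.n + X.m) :
    (Test.conj (unrejected r q)
      (.conj (isCutoff r q) (.disj (isPassed r q) (isNext r q)))).Holds s ↔
      s.idx r 0 0 0 < X.n ∧ X.n ≤ s.idx q 0 0 0 ∧
      R (s.idx r 0 0 0) (s.idx q 0 0 0 - X.n) = 0 ∧
      X.cutoff R (s.idx q 0 0 0 - X.n) = s.idx r 0 0 0 ∧
      (A (s.idx r 0 0 0) (s.idx q 0 0 0 - X.n) ≠ 0 ∨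
        X.nextItem A (s.idx r 0 0 0) = s.idx q 0 0 0 - X.n) := by
  by_cases h1 : s.idx r 0 0 0 < X.n
  · by_cases h2 : X.n ≤ s.idx q 0 0 0
    · simp only [Test.Holds, Test.disj_holds, unrejected_holds hs, isPassed_holds hs,
        isNext_holds hs hp h1, isCutoff_holds hs hp (r := r) (q := q) (by omega)]
      tauto
    · simp [Test.Holds, unrejected_holds hs, h2]
  · simp [Test.Holds, unrejected_holds hs, h1]

theorem marginal_holds (hs : Flags X A R s) (hp : Pointers X A R s) {r q : ℕ}
    (hq : s.idx q 0 0 0 < X.n + X.m) :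
    (Test.conj (unrejected r q) (.conj (.neg (isCutoff r q))
      (.conj (.neg (isPassed r q)) (isNext r q)))).Holds s ↔
      X.n ≤ s.idx q 0 0 0 ∧ s.idx r 0 0 0 < X.n ∧
      R (s.idx r 0 0 0) (s.idx q 0 0 0 - X.n) = 0 ∧
      X.cutoff R (s.idx q 0 0 0 - X.n) ≠ s.idx r 0 0 0 ∧
      A (s.idx r 0 0 0) (s.idx q 0 0 0 - X.n) = 0 ∧
        X.nextItem A (s.idx r 0 0 0) = s.idx q 0 0 0 - X.n := by
  by_cases h1 : s.idx r 0 0 0 < X.n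
  · by_cases h2 : X.n ≤ s.idx q 0 0 0
    · simp only [Test.Holds, unrejected_holds hs, isPassed_holds hs,
        isNext_holds hs hp h1, isCutoff_holds hs hp (r := r) (q := q) (by omega), not_not]
      tauto
    · simp [Test.Holds, unrejected_holds hs, h2]
  · simp [Test.Holds, unrejected_holds hs, h1]

theorem fixed_holds (hs : Flags X A R s) (hp : Pointers X A R s) {r q : ℕ}
    (hq : s.idx q 0 0 0 < X.n + X.m) :
    (Test.conj (unrejected r q) (.conj (.neg (isCutoff r q)) (isPassed r q))).Holds s ↔
      s.idx r 0 0 0 < X.n ∧ X.n ≤ s.idx q 0 0 0 ∧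
      R (s.idx r 0 0 0) (s.idx q 0 0 0 - X.n) = 0 ∧
      X.cutoff R (s.idx q 0 0 0 - X.n) ≠ s.idx r 0 0 0 ∧
      A (s.idx r 0 0 0) (s.idx q 0 0 0 - X.n) ≠ 0 := by
  by_cases h2 : X.n ≤ s.idx q 0 0 0
  · simp only [Test.Holds, unrejected_holds hs, isPassed_holds hs,
      isCutoff_holds hs hp (r := r) (q := q) (by omega)]
    tauto
  · simp [Test.Holds, unrejected_holds hs, h2]

/-- A bound on the number of steps of `systemProgram`. -/
def systemSteps (N : ℕ) : ℕ :=
  2 + N * ((4 + (2 + N * ((3 + 4) + 2))) + 2)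

theorem run_systemProgram (hs : Flags X A R s) (hp : Pointers X A R s) (hΛ : Λ.Fits X) :
    Run Λ systemProgram s (systemSteps (X.n + X.m))
      (HoldsSystem (X.n + X.m) (X.coefW A R (X.nextItem A) (X.cutoff R))
        (X.coefC A R (X.cutoff R)) (X.floor R (X.nextItem A) (X.cutoff R))) := by
  have htop := hΛ.top
  have hlit : ∀ c : ℤ, c.natAbs ≤ 2 → Λ.small Λ.level (c : K) := hΛ.lit
  set N := X.n + X.m with hN
  set W := X.coefW A R (X.nextItem A) (X.cutoff R) with hW
  set C := X.coefC A R (X.cutoff R) with hC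
  set b := X.floor R (X.nextItem A) (X.cutoff R) with hb
  have main : Run Λ systemProgram s (systemSteps N) (fun t => ∀ u < N, t.val 6 u 0 0 = b u ∧
      ∀ v < N, t.val 4 u v 0 = W u v ∧ t.val 5 u v 0 = C u v) := by
    refine Run.for (fun k t => ∀ u < k, t.val 6 u 0 0 = b u ∧
      ∀ v < N, t.val 4 u v 0 = W u v ∧ t.val 5 u v 0 = C u v)
      (by decide) rfl (fun t ht => (hs.frame rfl ht).coords) (by omega) (by simp)
      (fun k t x h => h) ?_
    intro u hu t ht htu hinv
    have hst := hs.frame rfl ht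
    have hpt := hp.frame rfl rfl ht
    refine Run.seq (τ₁ := 4)
      (Mid := fun t' => t'.val 6 u 0 0 = b u ∧ ∀ u' < u, t'.val 6 u' 0 0 = b u')
      ?_ fun t₁ ht₁ h₁ => ?_
    · have hfill : ∀ e : ValExpr, e.eval t = b u →
          (fun t' : Store K => t'.val 6 u 0 0 = b u ∧ ∀ u' < u, t'.val 6 u' 0 0 = b u')
            { t with
              val := writeCell t.val 6 ((reg 12).eval t) ((IdxExpr.lit 0).eval t) 0
                (e.eval t) } := by
        intro e he
        refine ⟨by simp [writeCell, htu, IdxExpr.eval, he], fun u' hu' => ?_⟩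
        simp only [writeCell, reg_eval, htu]
        rw [if_neg (by omega)]
        exact (hinv u' hu').1
      refine Run.branch (by decide) (fun h => ?_) (fun h => ?_)
      · simp only [Test.Holds, Test.lt_holds, reg_eval, buyers_eval, htu, hst.n, not_lt] at h
        refine Run.mono (Run.putVal (by decide) (fun _ => hlit 0 (by decide)) (hfill _ ?_))
          (by omega) fun _ _ h => h
        rw [hb, floor, if_pos h]; simp [ValExpr.eval]
      simp only [Test.Holds, Test.lt_holds, reg_eval, buyers_eval, htu, hst.n, not_not] at h
      have hnext : t.idx 5 u 0 0 = X.nextItem A u := hpt.next u h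
      refine Run.branch (by decide) (fun h' => ?_) (fun h' => ?_)
      · simp only [Test.eq_holds, cell_eval, reg_eval, items_eval, htu, IdxExpr.eval, hst.m,
          hnext] at h'
        have heval : ∀ e : ValExpr,
            e = (.sub (.sub (.lit 0) (vcell 2 (reg 12) (.lit 0))) (.lit 1)) →
            e.eval t = 0 - X.budget u - 1 := by
          rintro e rfl
          simp [ValExpr.eval, htu, IdxExpr.eval, hst.budget]
        refine Run.mono (Run.putVal (by decide) (fun _ => ?_) (hfill _ ?_))
          (by omega) fun _ _ h => h
        · rw [heval _ rfl]; exact hΛ.neg_budget_sub u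
        · rw [heval _ rfl, hb, floor, if_neg (by omega), if_pos h']; ring
      simp only [Test.eq_holds, cell_eval, reg_eval, items_eval, htu, IdxExpr.eval, hst.m,
        hnext] at h'
      have hsm : X.nextItem A u < X.m := lt_of_le_of_ne
        (nextItem_le X A u) h'
      refine Run.branch (by decide) (fun h'' => ?_) (fun h'' => ?_)
      · simp only [Test.disj_holds, Test.eq_holds, Test.isSet_holds, cell_eval, reg_eval, htu,
          IdxExpr.eval, hnext, hpt.cutoff _ hsm, hst.rejected] at h''
        refine Run.putVal (by decide) (fun _ => hlit 0 (by decide)) (hfill _ ?_)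
        rw [hb, floor, if_neg (by omega), if_neg h', if_pos h'']; simp [ValExpr.eval]
      · simp only [Test.disj_holds, Test.eq_holds, Test.isSet_holds, cell_eval, reg_eval, htu,
          IdxExpr.eval, hnext, hpt.cutoff _ hsm, hst.rejected] at h''
        have heval : ∀ e : ValExpr,
            e = (.sub (.lit 0) (vcell 1 (reg 12) (cell 5 (reg 12) (.lit 0)))) →
            e.eval t = 0 - X.price u (X.nextItem A u) := by
          rintro e rfl
          simp [ValExpr.eval, htu, IdxExpr.eval, hst.price, hnext]
        refine Run.putVal (by decide) (fun _ => ?_) (hfill _ ?_)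
        · rw [heval _ rfl]; exact hΛ.neg_price _ _
        · rw [heval _ rfl, hb, floor, if_neg (by omega), if_neg h', if_neg h'']; ring
    · have hst₁ := hst.frame rfl ht₁
      have hpt₁ := hpt.frame rfl rfl ht₁
      have htu₁ : t₁.idx 12 0 0 0 = u := by rw [ht₁.idx 12 rfl]; exact htu
      have hold₁ : ∀ u' < u, ∀ v < N, t₁.val 4 u' v 0 = W u' v ∧ t₁.val 5 u' v 0 = C u' v := by
        intro u' hu'
        rw [ht₁.val 4 rfl, ht₁.val 5 rfl]
        exact (hinv u' hu').2
      refine Run.mono (Run.for (b := N) (fun k t' =>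
        (∀ u' < u, ∀ v < N, t'.val 4 u' v 0 = W u' v ∧ t'.val 5 u' v 0 = C u' v) ∧
        ∀ v < k, t'.val 4 u v 0 = W u v ∧ t'.val 5 u v 0 = C u v)
        (by decide) rfl (fun t ht => (hst₁.frame rfl ht).coords) (by omega) ⟨hold₁, by simp⟩
        (fun k t x h => h) ?_) le_rfl ?_
      · intro v hv t₂ ht₂ htv hinv₂
        have hst₂ := hst₁.frame rfl ht₂
        have hpt₂ := hpt₁.frame rfl rfl ht₂
        have htu₂ : t₂.idx 12 0 0 0 = u := by rw [ht₂.idx 12 rfl]; exact htu₁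
        have hact := active_holds hst₂ hpt₂ (r := 12) (q := 13) (by omega)
        have hmar := marginal_holds hst₂ hpt₂ (r := 13) (q := 12) (by omega)
        rw [htu₂, htv] at hact hmar
        refine Run.seq (τ₁ := 3) (τ₂ := 4) (Mid := fun t' => t'.val 4 u v 0 = W u v ∧
          ∀ u' v', u' ≠ u ∨ v' ≠ v → t'.val 4 u' v' 0 = t₂.val 4 u' v' 0) ?_ fun t₃ ht₃ h₃ => ?_
        · have hfill : ∀ e : ValExpr, e.eval t₂ = W u v →
              (fun t' : Store K => t'.val 4 u v 0 = W u v ∧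
                ∀ u' v', u' ≠ u ∨ v' ≠ v → t'.val 4 u' v' 0 = t₂.val 4 u' v' 0)
                { t₂ with
                  val := writeCell t₂.val 4 ((reg 12).eval t₂) ((reg 13).eval t₂) 0
                    (e.eval t₂) } := by
            intro e he
            refine ⟨by simp [writeCell, htu₂, htv, he], fun u' v' hne => ?_⟩
            simp only [writeCell, reg_eval, htu₂, htv]
            rw [if_neg (by tauto)]
          refine Run.branch (by decide) (fun h => ?_) (fun h => ?_)
          · rw [hact] at h
            refine Run.mono (Run.putVal (by decide) (fun hok => hok.2 _ _ _ _) (hfill _ ?_))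
              (by omega) fun _ _ h => h
            rw [hW, coefW, if_pos h]
            simp [htu₂, htv, hst₂.n, hst₂.price]
          rw [hact] at h
          refine Run.branch (by decide) (fun h' => ?_) (fun h' => ?_)
          · rw [hmar] at h'
            have heval : ∀ e : ValExpr, e = .div (.lit 1) (vcell 1 (reg 13) (itemOf 12)) →
                e.eval t₂ = 1 / X.price v (u - X.n) := by
              rintro e rfl
              simp [ValExpr.eval, htu₂, htv, hst₂.n, hst₂.price]
            refine Run.putVal (by decide) (fun _ => ?_) (hfill _ ?_)
            · rw [heval _ rfl]; exact hΛ.recip _ _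
            · rw [heval _ rfl, hW, coefW, if_neg h, if_pos h']
          · rw [hmar] at h'
            refine Run.putVal (by decide) (fun _ => hlit 0 (by decide)) (hfill _ ?_)
            rw [hW, coefW, if_neg h, if_neg h']; simp [ValExpr.eval]
        · have hst₃ := hst₂.frame rfl ht₃
          have hpt₃ := hpt₂.frame rfl rfl ht₃
          have htu₃ : t₃.idx 12 0 0 0 = u := by rw [ht₃.idx 12 rfl]; exact htu₂
          have htv₃ : t₃.idx 13 0 0 0 = v := by rw [ht₃.idx 13 rfl]; exact htv
          have hfix := fixed_holds hst₃ hpt₃ (r := 12) (q := 13) (by omega)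
          have hfix' := fixed_holds hst₃ hpt₃ (r := 13) (q := 12) (by omega)
          rw [htu₃, htv₃] at hfix hfix'
          rw [and_left_comm] at hfix'
          have hfill : ∀ e : ValExpr, e.eval t₃ = C u v →
              (fun t' : Store K =>
                (∀ u' < u, ∀ v < N, t'.val 4 u' v 0 = W u' v ∧ t'.val 5 u' v 0 = C u' v) ∧
                ∀ v' < v + 1, t'.val 4 u v' 0 = W u v' ∧ t'.val 5 u v' 0 = C u v')
                { t₃ with
                  val := writeCell t₃.val 5 ((reg 12).eval t₃) ((reg 13).eval t₃) 0
                    (e.eval t₃) } := by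
            intro e he
            have h5 : t₃.val 5 = t₂.val 5 := ht₃.val 5 rfl
            refine ⟨fun u' hu' v' hv' => ?_, fun v' hv' => ?_⟩
            · simp only [writeCell, reg_eval, htu₃, htv₃]
              rw [if_neg (by omega), if_neg (by omega), h₃.2 u' v' (Or.inl hu'.ne), h5]
              exact hinv₂.1 u' hu' v' hv'
            · simp only [writeCell, reg_eval, htu₃, htv₃, he]
              rw [if_neg (by omega)]
              rcases Nat.lt_succ_iff_lt_or_eq.1 hv' with hlt | rfl
              · rw [if_neg (by omega), h₃.2 u v' (Or.inr hlt.ne), h5]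
                exact hinv₂.2 v' hlt
              · exact ⟨h₃.1, by simp⟩
          refine Run.branch (by decide) (fun h => ?_) (fun h => ?_)
          · simp only [Test.eq_holds, reg_eval, htu₃, htv₃] at h
            refine Run.mono (τ := 1 + 1) (Run.branch (by decide) (fun h' => ?_) (fun h' => ?_))
              (by omega) fun _ _ h => h
            · simp only [Test.lt_holds, reg_eval, buyers_eval, htu₃, hst₃.n] at h'
              have heval : ∀ e : ValExpr, e = .sub (.lit 0) (vcell 2 (reg 12) (.lit 0)) →
                  e.eval t₃ = 0 - X.budget u := by
                rintro e rfl
                simp [ValExpr.eval, IdxExpr.eval, htu₃, hst₃.budget]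
              refine Run.putVal (by decide) (fun _ => ?_) (hfill _ ?_)
              · rw [heval _ rfl]; exact hΛ.neg_budget _
              · rw [heval _ rfl, hC, coefC, if_pos h, if_pos h']; ring
            · simp only [Test.lt_holds, reg_eval, buyers_eval, htu₃, hst₃.n] at h'
              refine Run.putVal (by decide) (fun _ => hlit 1 (by decide)) (hfill _ ?_)
              rw [hC, coefC, if_pos h, if_neg h']; simp [ValExpr.eval]
          simp only [Test.eq_holds, reg_eval, htu₃, htv₃] at h
          refine Run.branch (by decide) (fun h' => ?_) (fun h' => ?_)
          · rw [hfix] at h'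
            refine Run.mono (Run.putVal (by decide) (fun hok => hok.2 _ _ _ _) (hfill _ ?_))
              (by omega) fun _ _ h => h
            rw [hC, coefC, if_neg h, if_pos h']
            simp [htu₃, htv₃, hst₃.n, hst₃.price]
          rw [hfix] at h'
          refine Run.branch (by decide) (fun h'' => ?_) (fun h'' => ?_)
          · rw [hfix'] at h''
            refine Run.putVal (by decide) (fun _ => hlit (-1) (by decide)) (hfill _ ?_)
            rw [hC, coefC, if_neg h, if_neg h', if_pos h'']; simp [ValExpr.eval]
          · rw [hfix'] at h''
            refine Run.putVal (by decide) (fun _ => hlit 0 (by decide)) (hfill _ ?_)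
            rw [hC, coefC, if_neg h, if_neg h', if_neg h'']; simp [ValExpr.eval]
      · rintro t₂ ht₂ ⟨h2, h3⟩ u' hu'
        rw [ht₂.val 6 rfl]
        rcases Nat.lt_succ_iff_lt_or_eq.1 hu' with hlt | rfl
        · exact ⟨h₁.2 u' hlt, h2 u' hlt⟩
        · exact ⟨h₁.1, h3⟩
  refine main.mono le_rfl fun t ht h => ⟨(hs.frame rfl ht).coords, fun u hu v hv => ?_,
    fun u hu v hv => ?_, fun u hu => (h u hu).1⟩
  · exact ((h u hu).2 v hv).1
  · exact ((h u hu).2 v hv).2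

/-- A bound on the number of steps of `searchProgram`. -/
def searchSteps (N : ℕ) : ℕ := 1 + (2 + N * ((1 + (responseSteps N + ((1 + 1) + 1))) + 2))

/-- The search runs through all coordinates and keeps the last hit. Any hit permits a move, so the
choice does not matter. -/
theorem run_searchProgram {W C : ℕ → ℕ → K} {b : ℕ → K} (hs : HoldsSystem N W C b s)
    (hN : N + 2 ≤ Λ.top)
    (hsmall : ∀ u < N, ∀ t ≤ N, ∀ v < N, ∀ w ≤ N,
      Λ.small Λ.level (affine w W C (pinned N W C b u (b u) t) v)) :
    Run Λ searchProgram s (searchSteps N) (fun t =>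
      (t.idx 30 0 0 0 = 0 ∧ ∀ u < N, b u < response N W C b u (b u)) ∨
      (t.idx 30 0 0 0 = 1 ∧ t.idx 31 0 0 0 < N ∧
        response N W C b (t.idx 31 0 0 0) (b (t.idx 31 0 0 0)) ≤ b (t.idx 31 0 0 0))) := by
  refine Run.seq (Mid := fun t => t.idx 30 0 0 0 = 0)
    (Run.put (by decide) (fun _ => Nat.zero_le _) (by simp [writeCell, IdxExpr.eval]))
    fun s₁ hf₁ h₁ => ?_
  have hs₁ := hs.frame rfl hf₁
  refine Run.for (fun k t => (t.idx 30 0 0 0 = 0 ∧ ∀ u < k, b u < response N W C b u (b u)) ∨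
      (t.idx 30 0 0 0 = 1 ∧ t.idx 31 0 0 0 < N ∧
        response N W C b (t.idx 31 0 0 0) (b (t.idx 31 0 0 0)) ≤ b (t.idx 31 0 0 0)))
    (by decide) rfl (fun t ht => (hs₁.frame rfl ht).coords) (by omega) (Or.inl ⟨h₁, by simp⟩)
    (fun k t x h => by
      rw [Store.setReg_idx_of_ne (a := 30) (by decide),
        Store.setReg_idx_of_ne (a := 31) (by decide)]
      exact h) ?_
  intro u hu t ht htu hinv
  have hst := hs₁.frame rfl ht
  refine Run.seq (Mid := fun t => t.val 10 0 0 0 = b u)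
    (Run.putVal (by decide) (fun hok => hok.2 _ _ _ _) ?_) fun t₁ ht₁ h₁ => ?_
  · simp [writeCell, IdxExpr.eval, htu, hst.floor u hu]
  have hst₁ := hst.frame rfl ht₁
  have htu₁ : t₁.idx 14 0 0 0 = u := by rw [ht₁.idx 14 rfl]; exact htu
  refine Run.seq (run_responseProgram hst₁ hN hu htu₁ h₁ (hsmall u hu)) fun t₂ ht₂ h₂ => ?_
  have hst₂ := hst₁.frame rfl ht₂
  have htu₂ : t₂.idx 14 0 0 0 = u := by rw [ht₂.idx 14 rfl]; exact htu₁
  have h30 : t₂.idx 30 = t.idx 30 := by rw [ht₂.idx 30 rfl, ht₁.idx 30 rfl]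
  have h31 : t₂.idx 31 = t.idx 31 := by rw [ht₂.idx 31 rfl, ht₁.idx 31 rfl]
  refine Run.branch (by decide) (fun h => ?_) (fun h => ?_)
  · simp only [Test.Holds, vreg_eval, vcell_eval, reg_eval, IdxExpr.eval, htu₂, h₂,
      hst₂.floor u hu] at h
    refine Run.seq (Mid := fun t => t.idx 30 0 0 0 = 1)
      (Run.put (by decide) (fun _ => by simp only [IdxExpr.eval]; omega)
        (by simp [writeCell, IdxExpr.eval]))
      fun t₃ ht₃ h₃ => ?_
    have htu₃ : t₃.idx 14 0 0 0 = u := by rw [ht₃.idx 14 rfl]; exact htu₂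
    refine Run.put (by decide) (fun hok => hok.1 _ _ _ _) (Or.inr ?_)
    simp [writeCell, IdxExpr.eval, htu₃, h₃, hu, h]
  · simp only [Test.Holds, vreg_eval, vcell_eval, reg_eval, IdxExpr.eval, htu₂, h₂,
      hst₂.floor u hu, not_le] at h
    refine Run.mono (τ := 1) (Run.skip ?_) (by omega) fun _ _ h => h
    rw [h30, h31]
    rcases hinv with hinv | hinv
    · left
      refine ⟨hinv.1, fun u' hu' => ?_⟩
      rcases Nat.lt_succ_iff_lt_or_eq.1 hu' with hlt | rfl
      · exact hinv.2 u' hlt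
      · exact h
    · exact Or.inr hinv

end RandomAccess

/-- The output array agrees with the computed allocation only at indices in range. -/
theorem IndexedMarket.Stable.congr {K : Type} [Field K] [LinearOrder K] {X : IndexedMarket K}
    {x y : ℕ → ℕ → K} (h : X.Stable x) (hxy : ∀ i < X.n, ∀ j < X.m, x i j = y i j) :
    X.Stable y := by
  have hrow : ∀ i < X.n, ∑ j ∈ Finset.range X.m, y i j * X.price i j =
      ∑ j ∈ Finset.range X.m, x i j * X.price i j := fun i hi =>
    Finset.sum_congr rfl fun j hj => by rw [hxy i hi j (Finset.mem_range.1 hj)]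
  have hcol : ∀ j < X.m, ∑ i ∈ Finset.range X.n, y i j = ∑ i ∈ Finset.range X.n, x i j :=
    fun j hj => Finset.sum_congr rfl fun i hi => (hxy i (Finset.mem_range.1 hi) j hj).symm
  constructor
  · intro i hi j hj; rw [← hxy i hi j hj]; exact h.nonneg i hi j hj
  · intro j hj; rw [hcol j hj]; exact h.supply j hj
  · intro i hi; rw [hrow i hi]; exact h.budget_feasible i hi
  · intro i hi j hj; rw [← hxy i hi j hj]; exact h.valued i hi j hj
  · intro i hi j hj hv hlt
    rw [← hxy i hi j hj] at hlt
    refine (h.no_deviation i hi j hj hv hlt).imp (fun h' => ?_) fun h' => ?_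
    · refine ⟨fun j' hj' hpos => h'.1 j' hj' ?_, by rw [hrow i hi]; exact h'.2⟩
      rwa [hxy i hi j' hj']
    · refine ⟨by rw [hcol j hj]; exact h'.1, fun i' hi' hne hpos => h'.2 i' hi' hne ?_⟩
      rwa [hxy i' hi' j hj]

/-! ### The main loop, the final solution and the output -/

namespace RandomAccess

open IndexedMarket MonotoneSystem

variable {K : Type} [Field K] [LinearOrder K]
variable {Λ : Meter K} {X : IndexedMarket K} {A R : ℕ → ℕ → ℕ} {s : Store K} {N : ℕ}

/-- The number of zeros of a table of flags. -/
def zeros (a b : ℕ) (T : ℕ → ℕ → ℕ) : ℕ :=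
  ∑ i ∈ Finset.range a, ∑ j ∈ Finset.range b, (1 - T i j)

theorem zeros_le (a b : ℕ) (T : ℕ → ℕ → ℕ) : zeros a b T ≤ a * b := by
  calc zeros a b T ≤ ∑ i ∈ Finset.range a, ∑ j ∈ Finset.range b, 1 :=
        Finset.sum_le_sum fun i _ => Finset.sum_le_sum fun j _ => Nat.sub_le _ _
    _ = a * b := by simp

theorem zeros_raise_lt {a b i j : ℕ} {T : ℕ → ℕ → ℕ} (hi : i < a) (hj : j < b)
    (h : T i j = 0) : zeros a b (raise T i j) < zeros a b T := by
  have hle : ∀ i' j', 1 - raise T i j i' j' ≤ 1 - T i' j' := by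
    intro i' j'
    unfold raise
    split_ifs
    · simp
    · exact le_rfl
  refine Finset.sum_lt_sum (fun i' _ => Finset.sum_le_sum fun j' _ => hle i' j')
    ⟨i, Finset.mem_range.2 hi, Finset.sum_lt_sum (fun j' _ => hle i j')
      ⟨j, Finset.mem_range.2 hj, ?_⟩⟩
  rw [raise_self, h]
  exact Nat.zero_lt_one

/-- A bound on the number of steps of `initProgram`. -/
def initSteps (N : ℕ) : ℕ := 1 + ((2 + N * ((2 + N * ((1 + 1) + 2)) + 2)) + 1)

/-- The loop invariant confines raised rejection flags to rows below n, so row n, the record of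
sold-out items, is still zero. -/
theorem run_initProgram (hs : Encodes X s) (hΛ : Λ.Fits X) (hA : s.idx 3 = 0) (hR : s.idx 4 = 0) :
    Run Λ initProgram s (initSteps (X.n + X.m)) (fun t => t.idx 30 0 0 0 = 1 ∧
      Flags X (fun i j => t.idx 3 i j 0) (fun i j => t.idx 4 i j 0) t ∧
      (∀ i j, t.idx 3 i j 0 = 0) ∧
      (∀ i < X.n, ∀ j < X.m, t.idx 4 i j 0 ≠ 0 ↔ X.value i j ≤ 0) ∧
      ∀ j, t.idx 4 X.n j 0 = 0) := by
  have htop := hΛ.top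
  refine Run.seq (Mid := fun t => t.idx 7 0 0 0 = X.n + X.m) (Run.put (by decide) (fun _ => ?_) ?_)
    fun s₁ hf₁ h₁ => ?_
  · simp only [IdxExpr.eval, buyers_eval, items_eval, hs.n, hs.m]; omega
  · simp [writeCell, IdxExpr.eval, hs.n, hs.m]
  have hs₁ := hs.frame rfl hf₁
  refine Run.seq (τ₁ := 2 + (X.n + X.m) * ((2 + (X.n + X.m) * ((1 + 1) + 2)) + 2))
    (Mid := fun t => (∀ i j, t.idx 4 i j 0 ≠ 0 → i < X.n ∧ X.value i j ≤ 0) ∧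
    ∀ i < X.n, ∀ j < X.m, X.value i j ≤ 0 → t.idx 4 i j 0 ≠ 0) ?_ fun s₂ hf₂ h₂ => ?_
  · refine Run.mono (Run.table (b₁ := X.n) (b₂ := X.m) (τ := 1 + 1)
      (fun i j t => X.value i j ≤ 0 → t.idx 4 i j 0 ≠ 0)
      (fun t => ∀ i j, t.idx 4 i j 0 ≠ 0 → i < X.n ∧ X.value i j ≤ 0)
      (by decide) (by decide) (fun t ht => (hs₁.frame rfl ht).n) (fun t ht => (hs₁.frame rfl ht).m)
      (by omega) ?_ (fun t x h => ?_) (fun i j t x h => ?_) ?_) ?_ fun _ _ h => h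
    · intro i j h
      rw [hf₁.idx 4 rfl, hR] at h
      exact absurd rfl h
    · rw [Store.setReg_idx_of_ne (by decide), Store.setReg_idx_of_ne (by decide)]
      exact ⟨h, h⟩
    · rw [Store.setReg_idx_of_ne (by decide), Store.setReg_idx_of_ne (by decide)]
      exact ⟨h, h⟩
    · intro i hi j hj t ht hti htj hJ
      have hst := hs₁.frame rfl ht
      refine Run.branch (by decide) (fun h => ?_) (fun h => ?_)
      · simp only [Test.Holds, ValExpr.eval, vcell_eval, reg_eval, hti, htj, hst.value,
          Int.cast_zero] at h
        refine Run.put (by decide) (fun _ => by simp only [IdxExpr.eval]; omega)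
          ⟨fun i' j' => ?_, fun _ => ?_, fun i' j' hne h' hv => ?_⟩
        · simp only [writeCell, reg_eval, hti, htj, true_and, and_true]
          split_ifs with hc
          · rintro -
            rw [hc.1, hc.2]
            exact ⟨hi, h⟩
          · exact hJ i' j'
        · simp [writeCell, hti, htj, IdxExpr.eval]
        · simp only [writeCell, reg_eval, hti, htj, true_and, and_true]
          rw [if_neg (by omega)]
          exact h' hv
      · simp only [Test.Holds, ValExpr.eval, vcell_eval, reg_eval, hti, htj, hst.value,
          Int.cast_zero] at h
        exact Run.skip ⟨hJ, fun h' => absurd h' h, fun _ _ _ h' => h'⟩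
    · gcongr <;> omega
  · have hs₂ := hs₁.frame rfl hf₂
    refine Run.mono (Run.put (Post := fun t => t.idx 30 0 0 0 = 1) (by decide)
      (fun _ => by simp only [IdxExpr.eval]; omega)
      (by simp [writeCell, IdxExpr.eval])) le_rfl fun t ht h => ?_
    have h4 : t.idx 4 = s₂.idx 4 := ht.idx 4 rfl
    have h3 : t.idx 3 = 0 := by rw [ht.idx 3 rfl, hf₂.idx 3 rfl, hf₁.idx 3 rfl, hA]
    refine ⟨h, ⟨hs₂.frame rfl ht, ?_, fun _ _ => rfl, fun _ _ => rfl⟩, fun _ _ => by rw [h3]; rfl,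
      fun i hi j hj => ?_, fun j => ?_⟩
    · rw [ht.idx 7 rfl, hf₂.idx 7 rfl]; exact h₁
    · rw [h4]; exact ⟨fun h => (h₂.1 i j h).2, h₂.2 i hi j hj⟩
    · rw [h4]
      by_contra h
      exact absurd (h₂.1 _ _ h).1 (lt_irrefl _)

/-- What holds when no pointer can be moved. -/
structure Final (X : IndexedMarket K) (A R : ℕ → ℕ → ℕ) (t : Store K) : Prop where
  halted : t.idx 30 0 0 0 = 0
  pointers : Pointers X A R t
  system : HoldsSystem (X.n + X.m) (X.coefW A R (X.nextItem A) (X.cutoff R))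
    (X.coefC A R (X.cutoff R)) (X.floor R (X.nextItem A) (X.cutoff R)) t
  lt_response : ∀ u < X.n + X.m, X.floor R (X.nextItem A) (X.cutoff R) u <
    response (X.n + X.m) (X.coefW A R (X.nextItem A) (X.cutoff R)) (X.coefC A R (X.cutoff R))
      (X.floor R (X.nextItem A) (X.cutoff R)) u (X.floor R (X.nextItem A) (X.cutoff R) u)

/-- The invariant of the main loop. -/
def LoopInvariant (X : IndexedMarket K) (t : Store K) : Prop :=
  ∃ A R, Flags X A R t ∧ X.Invariant A R ∧ (t.idx 30 0 0 0 = 1 ∨ Final X A R t)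

/-- The measure of the main loop. -/
def loopMeasure (X : IndexedMarket K) (t : Store K) : ℕ :=
  t.idx 30 0 0 0 + zeros X.n X.m (fun i j => t.idx 3 i j 0) +
    zeros (X.n + 1) X.m (fun i j => t.idx 4 i j 0)

theorem Flags.loopMeasure_eq (h : Flags X A R s) :
    loopMeasure X s = s.idx 30 0 0 0 + zeros X.n X.m A + zeros (X.n + 1) X.m R := by
  rw [loopMeasure, show (fun i j => s.idx 3 i j 0) = A from funext₂ h.passed,
    show (fun i j => s.idx 4 i j 0) = R from funext₂ h.rejected]

/-- A bound on the number of steps of `roundProgram`. -/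
def roundSteps (N : ℕ) : ℕ :=
  nextItemSteps N + (cutoffSteps N + (systemSteps N + (searchSteps N + ((1 + 1) + 1))))

variable [IsStrictOrderedRing K]

theorem run_roundProgram (hX : X.Valid) (hΛ : Λ.Fits X) (hs : Flags X A R s)
    (hinv : X.Invariant A R) (h30 : s.idx 30 0 0 0 = 1) :
    Run Λ roundProgram s (roundSteps (X.n + X.m))
      (fun t => LoopInvariant X t ∧ loopMeasure X t < loopMeasure X s) := by
  have htop := hΛ.top
  rw [hs.loopMeasure_eq, h30]
  refine Run.seq (run_nextItemProgram hs hΛ) fun s₁ hf₁ h₁ => ?_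
  have hs₁ := hs.frame rfl hf₁
  refine Run.seq (run_cutoffProgram hs₁ hΛ) fun s₂ hf₂ h₂ => ?_
  have hs₂ := hs₁.frame rfl hf₂
  have hp₂ : Pointers X A R s₂ := ⟨by rw [hf₂.idx 5 rfl]; exact h₁, h₂⟩
  refine Run.seq (run_systemProgram hs₂ hp₂ hΛ) fun s₃ hf₃ h₃ => ?_
  have hs₃ := hs₂.frame rfl hf₃
  have hp₃ := hp₂.frame rfl rfl hf₃
  refine Run.seq (run_searchProgram h₃ htop fun u _ =>
    hΛ.sums A R (X.nextItem A) (X.cutoff R) u _ (Or.inl rfl)) fun s₄ hf₄ h₄ => ?_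
  have hs₄ := hs₃.frame rfl hf₄
  have hp₄ := hp₃.frame rfl rfl hf₄
  have hsys₄ := h₃.frame rfl hf₄
  refine Run.branch (by decide) (fun h => ?_) (fun h => ?_)
  · simp only [Test.isSet_holds, reg_eval] at h
    rcases h₄ with h₄ | ⟨hone, hu, hr⟩
    · exact absurd h₄.1 h
    set u := s₄.idx 31 0 0 0 with hu31
    -- Feasible points occur only in the argument. The program never computes one; it needs only the
    -- coordinate where some feasible point touches the floor.
    obtain ⟨z, l, hzl⟩ := hinv.feasible
    obtain ⟨y, hy⟩ := hzl.exists_feasible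
    obtain ⟨y', hy', hyu⟩ := exists_feasible_eq_floor
      (functional_coefW hX (nextItem_le X A) (cutoff_le X R)) hu hy hr
    have hfp := feasiblePair_of_feasible hy'
    refine Run.branch (by decide) (fun hlt => ?_) (fun hlt => ?_)
    · simp only [Test.lt_holds, reg_eval, buyers_eval, hs₄.n, ← hu31] at hlt
      obtain ⟨hm, hinv'⟩ := hinv.pass hX hlt hfp hyu
      have hA0 : A u (X.nextItem A u) = 0 := by
        rcases nextItem_spec (X := X) A u with h | h
        · exact absurd h.1 hm.ne
        · exact h.2.1.1
      refine Run.mono (Run.put (Post := fun t => Flags X (raise A u (X.nextItem A u)) R t ∧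
          t.idx 30 0 0 0 = 1) (by decide) (fun _ => ?_)
          -- Any program that writes only this array serves here, since a frame depends only on the
          -- arrays written.
          ⟨⟨hs₄.toEncodes.frame (P := .put 3 (.lit 0) (.lit 0) (.lit 0))
            rfl ⟨fun a ha => ?_, fun _ _ => rfl⟩, hs₄.coords, fun i j => ?_, hs₄.rejected⟩, hone⟩)
          le_rfl
          fun t _ ht => ?_
      · simp only [IdxExpr.eval]; omega
      · have : a ≠ 3 := by rintro rfl; exact absurd ha (by decide)
        funext i j k
        simp [writeCell, this]
      · simp only [writeCell, reg_eval, cell_eval, ← hu31, hp₄.next u hlt, IdxExpr.eval, true_and,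
          and_true, raise, hs₄.passed]
      · refine ⟨⟨_, _, ht.1, hinv', Or.inl ht.2⟩, ?_⟩
        rw [ht.1.loopMeasure_eq, ht.2]
        have := zeros_raise_lt hlt hm hA0
        omega
    · simp only [Test.lt_holds, reg_eval, buyers_eval, hs₄.n, ← hu31, not_lt] at hlt
      obtain ⟨j, hj⟩ := Nat.exists_eq_add_of_le hlt
      have hjm : j < X.m := by omega
      have hl0 : y' (X.n + j) = 0 := by rw [← hj, hyu, hj]; simp [floor]
      obtain ⟨hn, hR0, hinv'⟩ := hinv.reject hX hjm hfp hl0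
      refine Run.mono (Run.put (Post := fun t => Flags X A (raise R (X.cutoff R j) j) t ∧
          t.idx 30 0 0 0 = 1) (by decide) (fun _ => ?_)
          ⟨⟨hs₄.toEncodes.frame (P := .put 4 (.lit 0) (.lit 0) (.lit 0))
            rfl ⟨fun a ha => ?_, fun _ _ => rfl⟩, hs₄.coords, hs₄.passed, fun i' j' => ?_⟩, hone⟩)
          le_rfl
          fun t _ ht => ?_
      · simp only [IdxExpr.eval]; omega
      · have : a ≠ 4 := by rintro rfl; exact absurd ha (by decide)
        funext i j k
        simp [writeCell, this]
      · have hitem : (itemOf 31).eval s₄ = j := by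
          rw [itemOf_eval, ← hu31, hs₄.n, hj]; omega
        simp only [writeCell, cell_eval, hitem, hp₄.cutoff j hjm, IdxExpr.eval, true_and,
          and_true, raise, hs₄.rejected]
      · refine ⟨⟨_, _, ht.1, hinv', Or.inl ht.2⟩, ?_⟩
        rw [ht.1.loopMeasure_eq, ht.2]
        have : zeros (X.n + 1) X.m _ < zeros (X.n + 1) X.m _ :=
          zeros_raise_lt (Nat.lt_succ_of_le hn) hjm hR0
        omega
  · simp only [Test.isSet_holds, reg_eval, not_not] at h
    -- No move is possible: the tables stay as they are, and the measure drops because the flag in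
    -- register 30 falls from 1 to 0.
    rcases h₄ with ⟨hz, hlt⟩ | h₄
    · refine Run.mono (τ := 1) (Run.skip ⟨⟨A, R, hs₄, hinv, Or.inr ⟨hz, hp₄, hsys₄, hlt⟩⟩, ?_⟩)
        (by omega) fun _ _ h => h
      rw [hs₄.loopMeasure_eq, hz]
      omega
    · omega

/-- A bound on the number of steps of `solveProgram`. -/
def solveSteps (N : ℕ) : ℕ :=
  2 + N * ((1 + (responseSteps N + (1 + (1 + (responseSteps N + 1))))) + 2)

theorem run_solveProgram (hΛ : Λ.Fits X) {k' : ℕ → ℕ} {s' : ℕ → ℕ}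
    (hs : HoldsSystem (X.n + X.m) (X.coefW A R s' k') (X.coefC A R k') (X.floor R s' k') s) :
    Run Λ solveProgram s (solveSteps (X.n + X.m))
      (fun t => ∀ u < X.n + X.m, t.val 8 u 0 0 = X.solution A R s' k' u) := by
  have htop := hΛ.top
  refine Run.for (fun k t => ∀ u < k, t.val 8 u 0 0 = X.solution A R s' k' u) (by decide) rfl
    (fun t ht => (hs.frame rfl ht).coords) (by omega) (by simp) (fun _ _ _ h => h) ?_
  intro u hu t ht htu hinv
  have hst := hs.frame rfl ht
  refine Run.seq (Mid := fun t => t.val 10 0 0 0 = 1)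
    (Run.putVal (by decide) (fun _ => by simpa [ValExpr.eval] using hΛ.lit 1 (by decide))
      (by simp [writeCell, IdxExpr.eval, ValExpr.eval])) fun t₁ ht₁ h₁ => ?_
  have hst₁ := hst.frame rfl ht₁
  have htu₁ : t₁.idx 14 0 0 0 = u := by rw [ht₁.idx 14 rfl]; exact htu
  refine Run.seq (run_responseProgram hst₁ htop hu htu₁ h₁
    (hΛ.sums A R s' k' u 1 (Or.inr (Or.inl rfl)))) fun t₂ ht₂ h₂ => ?_
  have hst₂ := hst₁.frame rfl ht₂
  have htu₂ : t₂.idx 14 0 0 0 = u := by rw [ht₂.idx 14 rfl]; exact htu₁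
  refine Run.seq (τ₁ := 1) (Run.putVal (by decide) (fun hok => hok.2 _ _ _ _)
    (Post := fun t => t.val 11 0 0 0 = response (X.n + X.m) (X.coefW A R s' k')
      (X.coefC A R k') (X.floor R s' k') u 1)
    (by simp [writeCell, IdxExpr.eval, h₂])) fun t₃ ht₃ h₃ => ?_
  have hst₃ := hst₂.frame rfl ht₃
  have htu₃ : t₃.idx 14 0 0 0 = u := by rw [ht₃.idx 14 rfl]; exact htu₂
  refine Run.seq (Mid := fun t => t.val 10 0 0 0 = 2)
    (Run.putVal (by decide) (fun _ => by simpa [ValExpr.eval] using hΛ.lit 2 (by decide))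
      (by simp [writeCell, IdxExpr.eval, ValExpr.eval])) fun t₄ ht₄ h₄ => ?_
  have hst₄ := hst₃.frame rfl ht₄
  have htu₄ : t₄.idx 14 0 0 0 = u := by rw [ht₄.idx 14 rfl]; exact htu₃
  refine Run.seq (run_responseProgram hst₄ htop hu htu₄ h₄
    (hΛ.sums A R s' k' u 2 (Or.inr (Or.inr rfl)))) fun t₅ ht₅ h₅ => ?_
  have htu₅ : t₅.idx 14 0 0 0 = u := by rw [ht₅.idx 14 rfl]; exact htu₄
  have h11 : t₅.val 11 0 0 0 = response (X.n + X.m) (X.coefW A R s' k')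
      (X.coefC A R k') (X.floor R s' k') u 1 := by
    rw [ht₅.val 11 rfl, ht₄.val 11 rfl]; exact h₃
  have h8 : t₅.val 8 = t.val 8 := by
    rw [ht₅.val 8 rfl, ht₄.val 8 rfl, ht₃.val 8 rfl, ht₂.val 8 rfl, ht₁.val 8 rfl]
  have heval : ∀ e : ValExpr, e = (.div (.sub (.mul (.lit 2) (vreg 11)) (vreg 9))
      (.sub (.lit 1) (.sub (vreg 9) (vreg 11)))) → e.eval t₅ = X.solution A R s' k' u := by
    rintro e rfl
    simp [ValExpr.eval, h₅, h11, IndexedMarket.solution]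
  refine Run.putVal (by decide) (fun _ => ?_) fun u' hu' => ?_
  · rw [heval _ rfl]; exact hΛ.solution A R s' k' u hu
  · simp only [writeCell, reg_eval, htu₅, IdxExpr.eval, true_and, and_true, heval _ rfl, h8]
    split_ifs with hc
    · rw [hc]
    · exact hinv u' (by omega)

/-- A bound on the number of steps of `outputProgram`. -/
def outputSteps (N : ℕ) : ℕ := 2 + N * ((2 + N * ((1 + 1 + 1 + 1 + 1) + 2)) + 2)

theorem run_outputProgram (hΛ : Λ.Fits X) (hs : Flags X A R s) (hp : Pointers X A R s)
    (h8 : ∀ u < X.n + X.m, s.val 8 u 0 0 = X.solution A R (X.nextItem A) (X.cutoff R) u) :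
    Run Λ outputProgram s (outputSteps (X.n + X.m))
      (fun t => ∀ i < X.n, ∀ j < X.m, t.val 3 i j 0 =
        X.allocation A R (X.nextItem A) (X.cutoff R)
          (X.solution A R (X.nextItem A) (X.cutoff R)) i j) := by
  have htop := hΛ.top
  refine Run.mono (Run.table (b₁ := X.n) (b₂ := X.m) (τ := 1 + 1 + 1 + 1 + 1)
    (fun i j t => t.val 3 i j 0 = X.allocation A R (X.nextItem A) (X.cutoff R)
          (X.solution A R (X.nextItem A) (X.cutoff R)) i j) (fun _ => True)
    (by decide) (by decide) (fun t ht => (hs.frame rfl ht).n) (fun t ht => (hs.frame rfl ht).m)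
    (by omega) trivial (fun _ _ _ => ⟨trivial, trivial⟩) (fun _ _ _ _ h => ⟨h, h⟩) ?_) ?_
    fun _ _ h => h.2
  · intro i hi j hj t ht hti htj _
    have hst := hs.frame rfl ht
    have hpt := hp.frame rfl rfl ht
    have h8t : ∀ u < X.n + X.m, t.val 8 u 0 0 = X.solution A R (X.nextItem A) (X.cutoff R) u := by
      rw [ht.val 8 rfl]; exact h8
    have hfill : ∀ e : ValExpr, e.eval t = X.allocation A R (X.nextItem A) (X.cutoff R)
          (X.solution A R (X.nextItem A) (X.cutoff R)) i j →
        (fun t' : Store K => True ∧ t'.val 3 i j 0 =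
            X.allocation A R (X.nextItem A) (X.cutoff R)
              (X.solution A R (X.nextItem A) (X.cutoff R)) i j ∧
          ∀ i' j', i' ≠ i ∨ j' ≠ j →
            t.val 3 i' j' 0 = X.allocation A R (X.nextItem A) (X.cutoff R)
              (X.solution A R (X.nextItem A) (X.cutoff R)) i' j' →
            t'.val 3 i' j' 0 = X.allocation A R (X.nextItem A) (X.cutoff R)
              (X.solution A R (X.nextItem A) (X.cutoff R)) i' j')
          { t with
            val := writeCell t.val 3 ((reg 10).eval t) ((reg 11).eval t) 0 (e.eval t) } := by
      intro e he
      refine ⟨trivial, by simp [writeCell, hti, htj, he], fun i' j' hne h => ?_⟩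
      simp only [writeCell, reg_eval, hti, htj]
      rw [if_neg (by omega)]
      exact h
    refine Run.branch (by decide) (fun h => ?_) (fun h => ?_)
    · simp only [Test.isSet_holds, cell_eval, reg_eval, hti, htj, hst.rejected] at h
      refine Run.mono (τ := 1) (Run.putVal (by decide) (fun _ => hΛ.lit 0 (by decide))
        (hfill _ ?_)) (by omega) fun _ _ h => h
      rw [allocation, if_pos h]; simp [ValExpr.eval]
    simp only [Test.isSet_holds, cell_eval, reg_eval, hti, htj, hst.rejected] at h
    refine Run.branch (by decide) (fun h' => ?_) (fun h' => ?_)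
    · simp only [Test.eq_holds, cell_eval, reg_eval, hti, htj, IdxExpr.eval,
        hpt.cutoff j hj] at h'
      refine Run.mono (τ := 1) (Run.putVal (by decide) (fun hok => hok.2 _ _ _ _)
        (hfill _ ?_)) (by omega) fun _ _ h => h
      rw [allocation, if_neg h, if_pos h']
      simp [IdxExpr.eval, htj, hst.n, h8t (X.n + j) (by omega)]
    simp only [Test.eq_holds, cell_eval, reg_eval, hti, htj, IdxExpr.eval,
      hpt.cutoff j hj] at h'
    refine Run.branch (by decide) (fun h'' => ?_) (fun h'' => ?_)
    · simp only [Test.isSet_holds, cell_eval, reg_eval, hti, htj, hst.passed] at h''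
      refine Run.mono (τ := 1) (Run.putVal (by decide) (fun _ => hΛ.lit 1 (by decide))
        (hfill _ ?_)) (by omega) fun _ _ h => h
      rw [allocation, if_neg h, if_neg h', if_pos h'']; simp [ValExpr.eval]
    simp only [Test.isSet_holds, cell_eval, reg_eval, hti, htj, hst.passed] at h''
    refine Run.branch (by decide) (fun h3 => ?_) (fun h3 => ?_)
    · simp only [Test.eq_holds, cell_eval, reg_eval, hti, htj, IdxExpr.eval,
        hpt.next i hi] at h3
      have heval : ∀ e : ValExpr, e = .div (.sub (.lit 0) (vcell 8 (reg 10) (.lit 0)))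
          (vcell 1 (reg 10) (reg 11)) →
          e.eval t = (0 - X.solution A R (X.nextItem A) (X.cutoff R) i) / X.price i j := by
        rintro e rfl
        simp [ValExpr.eval, IdxExpr.eval, hti, htj, hst.price, h8t i (by omega)]
      refine Run.putVal (by decide) (fun _ => ?_) (hfill _ ?_)
      · rw [heval _ rfl]; exact hΛ.share A R _ _ i j (by omega)
      · rw [heval _ rfl, allocation, if_neg h, if_neg h', if_neg h'', if_pos h3]
    · simp only [Test.eq_holds, cell_eval, reg_eval, hti, htj, IdxExpr.eval,
        hpt.next i hi] at h3
      refine Run.putVal (by decide) (fun _ => hΛ.lit 0 (by decide)) (hfill _ ?_)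
      rw [allocation, if_neg h, if_neg h', if_neg h'', if_neg h3]; simp [ValExpr.eval]
  · unfold outputSteps
    gcongr <;> omega

/-- A bound on the number of steps of `stableAllocationProgram`. -/
def totalSteps (N : ℕ) : ℕ :=
  initSteps N + (((1 + N * N + (N + 1) * N) * (roundSteps N + 1) + 1) +
    (solveSteps N + outputSteps N))

theorem run_stableAllocationProgram (φ : K →+* ℝ) (hφ : StrictMono φ) (hX : X.Valid)
    (hΛ : Λ.Fits X) (hs : Encodes X s) (hA : s.idx 3 = 0) (hR : s.idx 4 = 0) :
    Run Λ stableAllocationProgram s (totalSteps (X.n + X.m))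
      (fun t => X.Stable (fun i j => t.val 3 i j 0)) := by
  refine Run.seq (run_initProgram hs hΛ hA hR) fun s₁ hf₁ h₁ => ?_
  obtain ⟨h30, hs₁, hA₁, hR₁, hn₁⟩ := h₁
  have hinv₁ := invariant_initial hX (fun i _ j _ => hA₁ i j) hR₁ fun j _ => hn₁ j
  refine Run.seq (Run.mono (Run.loop (by decide) (LoopInvariant X) (loopMeasure X)
    (τ := roundSteps (X.n + X.m)) ?_ ⟨_, _, hs₁, hinv₁, Or.inl h30⟩) ?_ fun _ _ h => h)
    fun s₂ hf₂ h₂ => ?_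
  · rintro t - ⟨A, R, hst, hinv, hgo⟩ hb
    simp only [Test.isSet_holds, reg_eval] at hb
    rcases hgo with hgo | hgo
    · exact run_roundProgram hX hΛ hst hinv hgo
    · exact absurd hgo.halted hb
  · have h1 := zeros_le X.n X.m (fun i j => s₁.idx 3 i j 0)
    have h2 := zeros_le (X.n + 1) X.m (fun i j => s₁.idx 4 i j 0)
    have h3 : X.n * X.m ≤ (X.n + X.m) * (X.n + X.m) := by gcongr <;> omega
    have h4 : (X.n + 1) * X.m ≤ (X.n + X.m + 1) * (X.n + X.m) := by gcongr <;> omega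
    unfold loopMeasure
    gcongr ?_ * _ + _
    omega
  · obtain ⟨⟨A, R, hs₂, hinv, hgo⟩, hb⟩ := h₂
    simp only [Test.isSet_holds, reg_eval, not_not] at hb
    have hfin : Final X A R s₂ := hgo.resolve_left (by omega)
    refine Run.seq (run_solveProgram hΛ hfin.system) fun s₃ hf₃ h₃ => ?_
    refine Run.mono (run_outputProgram hΛ (hs₂.frame rfl hf₃) (hfin.pointers.frame rfl rfl hf₃) h₃)
      le_rfl fun t _ ht => ?_
    obtain ⟨z, l, hzl⟩ := hinv.feasible
    refine (hinv.stable hX (fixedPoint_of_floor_lt_response φ hφ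
      (functional_coefW hX (nextItem_le X A) (cutoff_le X R)) (fun u _ => ?_) hzl.exists_feasible
      hfin.lt_response _ fun u _ => rfl)).congr fun i hi j hj => (ht i hi j hj).symm
    unfold ceiling
    split_ifs <;> simp

end RandomAccess

/-! ## Markets as indexed markets -/

namespace FixedPricingMarket

open RandomAccess

variable {K : Type} [Field K] [LinearOrder K] {n m : ℕ}

/-- The market as its program sees it. -/
noncomputable def indexed (M : FixedPricingMarket K n m) : IndexedMarket K where
  n := n
  m := m
  value i j := M.input.val 0 i j 0
  price i j := M.input.val 1 i j 0
  budget i := M.input.val 2 i 0 0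
  priority j i i' := M.input.idx 1 j i i' ≠ 0

variable (M : FixedPricingMarket K n m)

@[simp] theorem indexed_n : M.indexed.n = n := rfl
@[simp] theorem indexed_m : M.indexed.m = m := rfl

theorem indexed_value (i : Fin n) (j : Fin m) : M.indexed.value i j = M.value i j := by
  simp [indexed, input]

theorem indexed_price (i : Fin n) (j : Fin m) : M.indexed.price i j = M.price i j := by
  simp [indexed, input]

theorem indexed_budget (i : Fin n) : M.indexed.budget i = M.budget i := by
  simp [indexed, input]

theorem indexed_priority (j : Fin m) (i i' : Fin n) :
    M.indexed.priority j i i' ↔ M.priority j i i' := by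
  simp [indexed, input]

theorem indexed_valid : M.indexed.Valid where
  price_nonneg i j := by
    by_cases h : i < n ∧ j < m
    · exact (M.price_nonneg ⟨i, h.1⟩ ⟨j, h.2⟩).trans_eq
        (M.indexed_price ⟨i, h.1⟩ ⟨j, h.2⟩).symm
    · simp only [indexed, input]
      rw [dif_neg (by simp), dif_neg (by tauto), dif_neg (by simp)]
  budget_nonneg i := by
    by_cases h : i < n
    · exact (M.budget_nonneg ⟨i, h⟩).trans_eq (M.indexed_budget ⟨i, h⟩).symm
    · simp only [indexed, input]
      rw [dif_neg (by simp), dif_neg (by simp), dif_neg (by tauto)]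
  total j hj i hi i' hi' := by
    have := M.priority_total ⟨j, hj⟩ ⟨i, hi⟩ ⟨i', hi'⟩
    rwa [← M.indexed_priority, ← M.indexed_priority] at this
  trans j hj i₁ h₁ i₂ h₂ i₃ h₃ := by
    have := M.priority_trans ⟨j, hj⟩ ⟨i₁, h₁⟩ ⟨i₂, h₂⟩ ⟨i₃, h₃⟩
    rwa [← M.indexed_priority, ← M.indexed_priority, ← M.indexed_priority] at this

theorem encodes_input : Encodes M.indexed M.input where
  n := by simp [input]
  m := by simp [input]
  value _ _ := rfl
  price _ _ := rfl
  budget _ := rfl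
  priority _ _ _ := Iff.rfl

theorem input_idx_eq_zero {a : ℕ} (ha : 2 ≤ a) : M.input.idx a = 0 := by
  funext i j k
  simp only [input]
  rw [if_neg (by omega), if_neg (by omega), dif_neg (by omega)]
  rfl

theorem input_idx_le (a i j k : ℕ) : M.input.idx a i j k ≤ n + m + 2 := by
  simp only [input]
  split_ifs <;> omega

/-- Every entry of the initial memory is zero or a number of the market. -/
theorem input_val (P : K → Prop) (h0 : P 0) (hv : ∀ i j, P (M.value i j))
    (hp : ∀ i j, P (M.price i j)) (hb : ∀ i, P (M.budget i)) (a i j k : ℕ) :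
    P (M.input.val a i j k) := by
  simp only [input]
  split_ifs
  · exact hv _ _
  · exact hp _ _
  · exact hb _
  · exact h0

/-- Cross-multiplication is faithful at price zero: if j' is free, its ratio is infinite; if only j
is free, the product inequality fails because both values are positive. -/
theorem bangPerBuck_le {M : FixedPricingMarket ℝ n m} {i : Fin n} {j j' : Fin m}
    (hv : 0 < M.value i j) (hv' : 0 < M.value i j')
    (h : M.value i j * M.price i j' ≤ M.value i j' * M.price i j) :
    M.bangPerBuck i j ≤ M.bangPerBuck i j' := by
  unfold bangPerBuck
  rcases (M.price_nonneg i j').eq_or_lt with hp' | hp'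
  · rw [← hp', ENNReal.ofReal_zero, ENNReal.div_zero (by simpa using hv')]
    exact le_top
  · rcases (M.price_nonneg i j).eq_or_lt with hp | hp
    · rw [← hp, mul_zero] at h
      exact absurd h (not_le.2 (mul_pos hv hp'))
    · rw [← ENNReal.ofReal_div_of_pos hp, ← ENNReal.ofReal_div_of_pos hp']
      exact ENNReal.ofReal_le_ofReal ((div_le_div_iff₀ hp hp').2 h)

/-- Stability in terms of field operations implies stability. -/
theorem isStableAllocation_of_stable (φ : K →+* ℝ) (hφ : StrictMono φ)
    (M' : FixedPricingMarket ℝ n m) (hv : ∀ i j, M'.value i j = φ (M.value i j))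
    (hp : ∀ i j, M'.price i j = φ (M.price i j)) (hb : ∀ i, M'.budget i = φ (M.budget i))
    (hpr : ∀ j i i', M'.priority j i i' ↔ M.priority j i i') {x : ℕ → ℕ → K}
    (hx : M.indexed.Stable x) : M'.IsStableAllocation fun i j => φ (x i j) := by
  have hpos : ∀ {a : K}, 0 < φ a ↔ 0 < a := fun {a} => by rw [← map_zero φ, hφ.lt_iff_lt]
  have hnn : ∀ {a : K}, 0 ≤ φ a ↔ 0 ≤ a := fun {a} => by rw [← map_zero φ, hφ.le_iff_le]
  have hone : ∀ {a : K}, φ a ≤ 1 ↔ a ≤ 1 := fun {a} => by rw [← map_one φ, hφ.le_iff_le]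
  have hcol : ∀ j : Fin m, ∑ i : Fin n, φ (x i j) = φ (∑ i ∈ Finset.range n, x i j) := by
    intro j
    rw [map_sum, Finset.sum_range fun i => φ (x i j)]
  have hrow : ∀ i : Fin n, M'.spending (fun i j => φ (x i j)) i =
      φ (∑ j ∈ Finset.range m, x i j * M.indexed.price i j) := by
    intro i
    rw [map_sum, Finset.sum_range, spending]
    exact Finset.sum_congr rfl fun j _ => by rw [map_mul, M.indexed_price, hp]
  have hnonneg : ∀ (i : Fin n) (j : Fin m), 0 ≤ φ (x i j) := fun i j =>
    hnn.2 (hx.nonneg i i.2 j j.2)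
  have hsupply : ∀ j : Fin m, ∑ i : Fin n, φ (x i j) ≤ 1 := fun j => by
    rw [hcol]; exact hone.2 (hx.supply j j.2)
  have hvalued : ∀ (i : Fin n) (j : Fin m), 0 < φ (x i j) → 0 < M'.value i j := by
    intro i j h
    rw [hv, hpos, ← M.indexed_value]
    exact hx.valued i i.2 j j.2 (hpos.1 h)
  refine ⟨⟨hnonneg, fun i j => (Finset.single_le_sum (f := fun i : Fin n => φ (x i j))
    (fun i _ => hnonneg i j) (Finset.mem_univ i)).trans (hsupply j), hsupply⟩, fun i => ⟨?_,
    hvalued i, fun j hvj hlt => ?_⟩⟩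
  · rw [hrow, hb, hφ.le_iff_le, ← M.indexed_budget]
    exact hx.budget_feasible i i.2
  · have hvj' := hvj
    rw [hv, hpos, ← M.indexed_value] at hvj'
    have hlt' : x i j < 1 := by rwa [← map_one φ, hφ.lt_iff_lt] at hlt
    refine (hx.no_deviation i i.2 j j.2 hvj' hlt').imp (fun h => ⟨?_, ?_⟩) fun h => ⟨?_, ?_⟩
    · refine le_iInf₂ fun j' hj' => bangPerBuck_le hvj (hvalued i j' hj') ?_
      have := h.1 j' j'.2 (hpos.1 hj')
      unfold IndexedMarket.BangLe at this
      rw [M.indexed_value, M.indexed_value, M.indexed_price, M.indexed_price] at this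
      rw [hv, hv, hp, hp, ← map_mul, ← map_mul, hφ.le_iff_le]
      exact this
    · rw [hrow, hb, ← M.indexed_budget]
      exact congrArg φ h.2
    · rw [hcol, ← map_one φ]
      exact congrArg φ h.1
    · intro i' hne hi'
      rw [hpr, ← M.indexed_priority]
      exact h.2 i' i'.2 (fun h => hne (Fin.ext h)) (hpos.1 hi')

end FixedPricingMarket

/-! ## Unit costs -/

namespace RandomAccess

/-- The meter that counts operations. -/
def unitMeter (top : ℕ) : Meter ℝ where
  cost := unitCost ℝ
  top := top
  level := 0
  unit := 1
  small _ _ := True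
  small_mono _ _ := trivial
  small_lit _ := trivial
  small_add _ _ := trivial
  small_sub _ _ := trivial
  small_mul _ _ := trivial
  small_div _ _ := trivial
  unit_pos := le_rfl
  idx_le _ _ := le_rfl
  val_le _ _ := le_rfl

theorem unitMeter_fits {X : IndexedMarket ℝ} {top : ℕ} (h : X.n + X.m + 2 ≤ top) :
    (unitMeter top).Fits X := by
  constructor
  · exact h
  all_goals intros; trivial

theorem exists_exec_real {n m : ℕ} (M : FixedPricingMarket ℝ n m) :
    ∃ t c, Exec (unitCost ℝ) stableAllocationProgram M.input t c ∧
      c ≤ totalSteps (n + m) * 1201 ∧ M.IsStableAllocation (t.output n m) := by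
  obtain ⟨t, c, hex, hc, -, ht⟩ := run_stableAllocationProgram (Λ := unitMeter (n + m + 2))
    (RingHom.id ℝ) strictMono_id M.indexed_valid (unitMeter_fits le_rfl) M.encodes_input
    (M.input_idx_eq_zero (by decide)) (M.input_idx_eq_zero (by decide))
    ⟨M.input_idx_le, fun _ _ _ _ => trivial⟩
  exact ⟨t, c, hex, hc, M.isStableAllocation_of_stable (RingHom.id ℝ) strictMono_id M
    (fun _ _ => rfl) (fun _ _ => rfl) (fun _ => rfl) (fun _ _ _ => Iff.rfl) ht⟩

/-! ## Bit costs -/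

/-- The rational number `q` is a fraction with denominator `D ^ a`, and at most `D ^ a`. -/
def Scaled (D a : ℕ) (q : ℚ) : Prop :=
  (∃ z : ℤ, q * (D : ℚ) ^ a = z) ∧ |q| ≤ (D : ℚ) ^ a

section Scaled

variable {D a b : ℕ} {x y : ℚ}

theorem Scaled.mono (hD : 2 ≤ D) (h : Scaled D a x) (hab : a ≤ b) : Scaled D b x := by
  obtain ⟨⟨z, hz⟩, hx⟩ := h
  have hD1 : (1 : ℚ) ≤ D := by exact_mod_cast (by omega : 1 ≤ D)
  refine ⟨⟨z * D ^ (b - a), ?_⟩, hx.trans (pow_le_pow_right₀ hD1 hab)⟩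
  push_cast
  rw [← hz, mul_assoc, ← pow_add, Nat.add_sub_cancel' hab]

/-- As D ≥ 2, one more power of D absorbs the doubling of the absolute value. The common denominator
does not change. -/
theorem Scaled.add (hD : 2 ≤ D) (hx : Scaled D a x) (hy : Scaled D a y) :
    Scaled D (a + 1) (x + y) := by
  obtain ⟨⟨z, hz⟩, hx⟩ := hx
  obtain ⟨⟨w, hw⟩, hy⟩ := hy
  have hD2 : (2 : ℚ) ≤ D := by exact_mod_cast hD
  refine ⟨⟨(z + w) * D, ?_⟩, (abs_add_le x y).trans ?_⟩
  · push_cast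
    rw [← hz, ← hw]
    ring
  · rw [pow_succ]
    nlinarith [pow_nonneg (zero_le_two.trans hD2) a]

theorem Scaled.mul (hx : Scaled D a x) (hy : Scaled D b y) : Scaled D (a + b) (x * y) := by
  obtain ⟨⟨z, hz⟩, hx⟩ := hx
  obtain ⟨⟨w, hw⟩, hy⟩ := hy
  refine ⟨⟨z * w, ?_⟩, ?_⟩
  · push_cast
    rw [← hz, ← hw]
    ring
  · rw [abs_mul, pow_add]
    gcongr

theorem Scaled.neg (hx : Scaled D a x) : Scaled D a (-x) := by
  obtain ⟨⟨z, hz⟩, hx⟩ := hx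
  exact ⟨⟨-z, by push_cast; rw [← hz]; ring⟩, by rwa [abs_neg]⟩

theorem Scaled.sub (hD : 2 ≤ D) (hx : Scaled D a x) (hy : Scaled D a y) :
    Scaled D (a + 1) (x - y) := by
  rw [sub_eq_add_neg]
  exact hx.add hD hy.neg

theorem scaled_intCast (hD : 2 ≤ D) (c : ℤ) : Scaled D c.natAbs (c : ℚ) := by
  refine ⟨⟨c * D ^ c.natAbs, by push_cast; rfl⟩, ?_⟩
  have h1 : c.natAbs ≤ D ^ c.natAbs :=
    Nat.lt_two_pow_self.le.trans (Nat.pow_le_pow_left hD _)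
  calc |(c : ℚ)| = (c.natAbs : ℚ) := by rw [Nat.cast_natAbs, Int.cast_abs]
    _ ≤ _ := by exact_mod_cast h1

theorem scaled_intCast_of_natAbs_le (hD : 2 ≤ D) {c : ℤ} (hc : c.natAbs ≤ a) :
    Scaled D a (c : ℚ) := (scaled_intCast hD c).mono hD hc

/-- A quotient of two scaled numbers. -/
def ScaledQuotient (D a : ℕ) (q : ℚ) : Prop :=
  ∃ x y, Scaled D a x ∧ Scaled D a y ∧ y ≠ 0 ∧ q = x / y

theorem ScaledQuotient.mono (hD : 2 ≤ D) (h : ScaledQuotient D a x) (hab : a ≤ b) :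
    ScaledQuotient D b x := by
  obtain ⟨y, z, hy, hz, h0, rfl⟩ := h
  exact ⟨y, z, hy.mono hD hab, hz.mono hD hab, h0, rfl⟩

theorem Scaled.quotient (hD : 2 ≤ D) (h : Scaled D a x) : ScaledQuotient D a x := by
  refine ⟨x, 1, h, ?_, one_ne_zero, (div_one x).symm⟩
  have hD1 : (1 : ℚ) ≤ D := by exact_mod_cast (by omega : 1 ≤ D)
  exact ⟨⟨D ^ a, by push_cast; ring⟩, by simpa using one_le_pow₀ hD1⟩

theorem ScaledQuotient.add (hD : 2 ≤ D) (hx : ScaledQuotient D a x) (hy : ScaledQuotient D b y) :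
    ScaledQuotient D (a + b + 1) (x + y) := by
  obtain ⟨p, q, hp, hq, hq0, rfl⟩ := hx
  obtain ⟨r, t, hr, ht, ht0, rfl⟩ := hy
  exact ⟨p * t + q * r, q * t, (hp.mul ht).add hD (hq.mul hr), (hq.mul ht).mono hD (by omega),
    mul_ne_zero hq0 ht0, div_add_div _ _ hq0 ht0⟩

theorem ScaledQuotient.sub (hD : 2 ≤ D) (hx : ScaledQuotient D a x) (hy : ScaledQuotient D b y) :
    ScaledQuotient D (a + b + 1) (x - y) := by
  obtain ⟨r, t, hr, ht, ht0, rfl⟩ := hy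
  rw [sub_eq_add_neg, ← neg_div]
  exact hx.add hD ⟨-r, t, hr.neg, ht, ht0, rfl⟩

theorem ScaledQuotient.mul (hD : 2 ≤ D) (hx : ScaledQuotient D a x) (hy : ScaledQuotient D b y) :
    ScaledQuotient D (a + b + 1) (x * y) := by
  obtain ⟨p, q, hp, hq, hq0, rfl⟩ := hx
  obtain ⟨r, t, hr, ht, ht0, rfl⟩ := hy
  exact ⟨p * r, q * t, (hp.mul hr).mono hD (by omega), (hq.mul ht).mono hD (by omega),
    mul_ne_zero hq0 ht0, div_mul_div_comm _ _ _ _⟩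

theorem ScaledQuotient.div (hD : 2 ≤ D) (hx : ScaledQuotient D a x) (hy : ScaledQuotient D b y) :
    ScaledQuotient D (a + b + 1) (x / y) := by
  obtain ⟨r, t, hr, ht, ht0, rfl⟩ := hy
  by_cases hr0 : r = 0
  · rw [hr0, zero_div, div_zero]
    exact_mod_cast (scaled_intCast_of_natAbs_le (c := 0) hD (by simp)).quotient hD
  · rw [div_eq_mul_inv, inv_div]
    exact hx.mul hD ⟨t, r, ht, hr, hr0, rfl⟩

/-- Multiplying both parts of the quotient by D^a gives integers of absolute value at most D^(2a).
The reduced numerator and denominator divide these integers unless the numerator is zero. -/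
theorem ScaledQuotient.ratBits_le {e : ℕ} (hD : 2 ≤ D) (he : D ≤ 2 ^ e)
    (h : ScaledQuotient D a x) : ratBits x ≤ 4 * a * e + 3 := by
  obtain ⟨p, q, ⟨⟨z, hz⟩, hp⟩, ⟨⟨w, hw⟩, hq⟩, hq0, rfl⟩ := h
  have hDa : (0 : ℚ) < (D : ℚ) ^ a := pow_pos (by exact_mod_cast (by omega : 0 < D)) a
  have hw0 : w ≠ 0 := by
    rintro rfl
    rw [Int.cast_zero, mul_eq_zero] at hw
    exact hw.elim hq0 hDa.ne'
  have hpq : p / q = Rat.divInt z w := by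
    rw [Rat.divInt_eq_div, ← hz, ← hw, mul_div_mul_right _ _ hDa.ne']
  have hbound : ∀ {r : ℚ} {c : ℤ}, r * (D : ℚ) ^ a = c → |r| ≤ (D : ℚ) ^ a →
      c.natAbs < 2 ^ (2 * a * e + 1) := by
    intro r c hc hr
    have h1 : |(c : ℚ)| ≤ (D : ℚ) ^ a * (D : ℚ) ^ a := by
      rw [← hc, abs_mul, abs_of_pos hDa]
      gcongr
    have h2 : (c.natAbs : ℚ) ≤ ((D ^ a * D ^ a : ℕ) : ℚ) := by
      rw [Nat.cast_natAbs, Int.cast_abs]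
      exact_mod_cast h1
    have h3 : c.natAbs ≤ D ^ a * D ^ a := by exact_mod_cast h2
    calc c.natAbs ≤ D ^ (2 * a) := by rw [two_mul, pow_add]; exact h3
      _ ≤ (2 ^ e) ^ (2 * a) := Nat.pow_le_pow_left he _
      _ = 2 ^ (2 * a * e) := by rw [← pow_mul]; ring_nf
      _ < _ := Nat.pow_lt_pow_right (by norm_num) (Nat.lt_succ_self _)
  have hnum : (p / q).num.natAbs.size ≤ 2 * a * e + 1 := by
    rw [Nat.size_le, hpq]
    by_cases hz0 : z = 0
    · rw [hz0]; simp
    · exact (Nat.le_of_dvd (Int.natAbs_pos.2 hz0)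
        (Int.natAbs_dvd_natAbs.2 (Rat.num_dvd z hw0))).trans_lt (hbound hz hp)
  have hden : (p / q).den.size ≤ 2 * a * e + 1 := by
    rw [Nat.size_le, hpq]
    refine (Nat.le_of_dvd (Int.natAbs_pos.2 hw0) ?_).trans_lt (hbound hw hq)
    have := Int.natAbs_dvd_natAbs.2 (Rat.den_dvd z w)
    rwa [Int.natAbs_natCast] at this
  unfold ratBits
  linarith

end Scaled

/-- The meter that counts bit operations, for numbers that are quotients of fractions with
denominator `D ^ level`. -/
def bitMeter (D e top level : ℕ) (hD : 2 ≤ D) (he : D ≤ 2 ^ e) : Meter ℚ where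
  cost := bitCost
  top := top
  level := level
  unit := 300 * (top + 1) + 1 + (4 * (300 * (level + 1)) * e + 3)
  small := ScaledQuotient D
  small_mono hab h := h.mono hD hab
  small_lit c := (scaled_intCast_of_natAbs_le hD (Nat.le_succ _)).quotient hD
  small_add hx hy := hx.add hD hy
  small_sub hx hy := hx.sub hD hy
  small_mul hx hy := hx.mul hD hy
  small_div hx hy := hx.div hD hy
  unit_pos := by omega
  idx_le c hc := by
    have : c.size ≤ c := Nat.size_le.2 Nat.lt_two_pow_self
    simp only [bitCost, natBits]
    omega
  val_le q hq := (hq.ratBits_le hD he).trans (Nat.le_add_left _ _)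

end RandomAccess

/-! ### Bit lengths of the numbers in the algorithm -/

namespace RandomAccess

open IndexedMarket MonotoneSystem

section Sizes

variable {D a N : ℕ} {W C : ℕ → ℕ → ℚ} {b y : ℕ → ℚ} {u : ℕ} {θ : ℚ}

/-- Two powers pay for the product with a coefficient and the constant, and one power for each
addition to the sum. -/
theorem scaled_affine (hD : 2 ≤ D) (hW : ∀ u v, Scaled D 1 (W u v))
    (hC : ∀ u v, Scaled D 1 (C u v)) (hy : ∀ v, Scaled D a (y v)) (w v : ℕ) :
    Scaled D (a + 2 + w) (affine w W C y v) := by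
  induction w with
  | zero => exact_mod_cast scaled_intCast_of_natAbs_le (c := 0) hD (by simp)
  | succ w ih =>
    rw [affine, Finset.sum_range_succ]
    have h1 : Scaled D (a + 2) (C v w + W v w * y w) :=
      (((hC v w).mono hD (by omega : 1 ≤ 1 + a)).add hD ((hW v w).mul (hy w))).mono hD (by omega)
    exact ih.add hD (h1.mono hD (Nat.le_add_right _ _))

/-- Coefficients and constants have exponent 1, so a round adds at most N + 2 to the exponent
instead of multiplying it. The maximum creates no new number. -/
theorem scaled_pinned (hD : 2 ≤ D) (hW : ∀ u v, Scaled D 1 (W u v))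
    (hC : ∀ u v, Scaled D 1 (C u v)) (hb : ∀ v, Scaled D 2 (b v)) (hθ : Scaled D 2 θ) (t v : ℕ) :
    Scaled D (2 + t * (N + 2)) (pinned N W C b u θ t v) := by
  induction t generalizing v with
  | zero =>
    rw [Nat.zero_mul]
    unfold pinned
    split_ifs
    · exact hθ
    · exact hb v
  | succ t ih =>
    unfold pinned
    split_ifs
    · exact hθ.mono hD (by omega)
    · rcases max_choice (b v) (affine N W C (pinned N W C b u θ t) v) with h | h <;> rw [h]
      · exact (hb v).mono hD (by omega)
      · exact (scaled_affine hD hW hC ih N v).mono hD (by ring_nf; omega)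

theorem scaled_affine_pinned (hD : 2 ≤ D) (hW : ∀ u v, Scaled D 1 (W u v))
    (hC : ∀ u v, Scaled D 1 (C u v)) (hb : ∀ v, Scaled D 2 (b v)) (hθ : Scaled D 2 θ) {t w : ℕ}
    (ht : t ≤ N) (hw : w ≤ N) (v : ℕ) :
    Scaled D (2 + (N + 1) * (N + 2)) (affine w W C (pinned N W C b u θ t) v) := by
  refine (scaled_affine hD hW hC (scaled_pinned hD hW hC hb hθ t) w v).mono hD ?_
  have := Nat.mul_le_mul_right (N + 2) ht
  rw [add_mul]
  omega

end Sizes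

/-- The numbers of the market are fractions with denominator `D`, and at most `D`. -/
structure ScaledMarket (D : ℕ) (X : IndexedMarket ℚ) : Prop where
  price : ∀ i j, Scaled D 1 (X.price i j)
  recip : ∀ i j, Scaled D 1 (1 / X.price i j)
  budget : ∀ i, Scaled D 1 (X.budget i)

variable {D e top : ℕ} {X : IndexedMarket ℚ} {A R : ℕ → ℕ → ℕ} {s k : ℕ → ℕ}

theorem ScaledMarket.coefW (hD : 2 ≤ D) (h : ScaledMarket D X) (u v : ℕ) :
    Scaled D 1 (X.coefW A R s k u v) := by
  unfold IndexedMarket.coefW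
  split_ifs
  · exact h.price _ _
  · exact h.recip _ _
  · exact_mod_cast scaled_intCast_of_natAbs_le (c := 0) hD (by simp)

theorem ScaledMarket.coefC (hD : 2 ≤ D) (h : ScaledMarket D X) (u v : ℕ) :
    Scaled D 1 (X.coefC A R k u v) := by
  unfold IndexedMarket.coefC
  split_ifs
  · exact (h.budget _).neg
  · exact_mod_cast scaled_intCast_of_natAbs_le (c := 1) hD (by simp)
  · exact h.price _ _
  · exact_mod_cast scaled_intCast_of_natAbs_le (c := -1) hD (by simp)
  · exact_mod_cast scaled_intCast_of_natAbs_le (c := 0) hD (by simp)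

theorem ScaledMarket.floor (hD : 2 ≤ D) (h : ScaledMarket D X) (u : ℕ) :
    Scaled D 2 (X.floor R s k u) := by
  unfold IndexedMarket.floor
  split_ifs
  · exact_mod_cast scaled_intCast_of_natAbs_le (c := 0) hD (by simp)
  · exact (h.budget _).neg.sub hD
      (by exact_mod_cast scaled_intCast_of_natAbs_le (c := 1) hD (by simp))
  · exact_mod_cast scaled_intCast_of_natAbs_le (c := 0) hD (by simp)
  · exact (h.price _ _).neg.mono hD (by norm_num)

/-- The exponent that suffices for all numbers that occur in the algorithm. -/
def maxLevel (N : ℕ) : ℕ := 2 * (2 + (N + 1) * (N + 2)) + 9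

/-- The formula divides by one minus the slope, so the result is only a quotient of scaled numbers.
If L bounds the exponents of both responses, numerator and denominator have exponent L + 2 and the
quotient 2L + 5. -/
theorem ScaledMarket.solution (hD : 2 ≤ D) (h : ScaledMarket D X) (u : ℕ) :
    ScaledQuotient D (2 * (2 + (X.n + X.m + 1) * (X.n + X.m + 2)) + 5)
      (X.solution A R s k u) := by
  have hone : Scaled D 1 (1 : ℚ) := by
    exact_mod_cast scaled_intCast_of_natAbs_le (c := 1) hD (by simp)
  have htwo : Scaled D 2 (2 : ℚ) := by
    exact_mod_cast scaled_intCast_of_natAbs_le (c := 2) hD (by simp)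
  have hr : ∀ θ, Scaled D 2 θ → Scaled D (2 + (X.n + X.m + 1) * (X.n + X.m + 2))
      (response (X.n + X.m) (X.coefW A R s k) (X.coefC A R k) (X.floor R s k) u θ) := fun θ hθ =>
    scaled_affine_pinned hD (h.coefW hD) (h.coefC hD) (h.floor hD) hθ le_rfl le_rfl u
  have h1 := hr 1 (hone.mono hD (by norm_num))
  have h2 := hr 2 htwo
  have hnum := ((two_mul (response (X.n + X.m) (X.coefW A R s k) (X.coefC A R k)
    (X.floor R s k) u 1) ▸ h1.add hD h1).sub hD (h2.mono hD (Nat.le_succ _))).quotient hD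
  have hden := ((hone.mono hD (by omega)).sub hD (h2.sub hD h1)).quotient hD
  exact (hnum.div hD hden).mono hD (by omega)

theorem bitMeter_fits (hD : 2 ≤ D) (he : D ≤ 2 ^ e) (htop : X.n + X.m + 2 ≤ top)
    (h : ScaledMarket D X) : (bitMeter D e top (maxLevel (X.n + X.m)) hD he).Fits X := by
  have hlit : ∀ {c : ℤ} {a : ℕ}, c.natAbs ≤ a → Scaled D a (c : ℚ) := fun hc =>
    scaled_intCast_of_natAbs_le hD hc
  have hzero : ∀ a, Scaled D a (0 : ℚ) := fun a => by exact_mod_cast hlit (c := 0) (by simp)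
  have hlift : ∀ {a : ℕ} {q : ℚ}, Scaled D a q → a ≤ maxLevel (X.n + X.m) →
      ScaledQuotient D (maxLevel (X.n + X.m)) q := fun hq ha => (hq.mono hD ha).quotient hD
  constructor
  · exact htop
  · intro c hc
    exact hlift (hlit hc) (by unfold maxLevel; omega)
  · intro i j
    exact hlift (h.recip i j) (by unfold maxLevel; omega)
  · intro i j
    exact hlift ((hzero 1).sub hD (h.price i j)) (by unfold maxLevel; omega)
  · intro i
    exact hlift ((hzero 1).sub hD (h.budget i)) (by unfold maxLevel; omega)
  · intro i
    have hone : Scaled D 2 (1 : ℚ) := by exact_mod_cast hlit (c := 1) (by simp)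
    exact hlift (((hzero 1).sub hD (h.budget i)).sub hD hone) (by unfold maxLevel; omega)
  · intro A R s k u θ hθ t ht v hv w hw
    refine hlift (scaled_affine_pinned hD (h.coefW hD) (h.coefC hD) (h.floor hD) ?_ ht hw v)
      (by unfold maxLevel; omega)
    rcases hθ with rfl | rfl | rfl
    · exact h.floor hD u
    · exact_mod_cast hlit (c := 1) (by simp)
    · exact_mod_cast hlit (c := 2) (by simp)
  · intro A R s k u hu
    exact (h.solution hD u).mono hD (show _ ≤ maxLevel (X.n + X.m) by unfold maxLevel; omega)
  · intro A R s k u j hu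
    have hp : ScaledQuotient D 1 (X.price u j) := (h.price u j).quotient hD
    exact ((((hzero 0).quotient hD).sub hD (h.solution hD u)).div hD hp).mono hD
      (show _ ≤ maxLevel (X.n + X.m) by unfold maxLevel; omega)

/-! ### A common denominator -/

/-- A multiple of the numerator and the denominator of a rational number. -/
def height (q : ℚ) : ℕ := max 1 q.num.natAbs * q.den

theorem height_pos (q : ℚ) : 0 < height q :=
  Nat.mul_pos (lt_of_lt_of_le Nat.zero_lt_one (le_max_left _ _)) q.den_pos

theorem height_le (q : ℚ) : height q ≤ 2 ^ ratBits q := by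
  have h1 : max 1 q.num.natAbs ≤ 2 ^ q.num.natAbs.size :=
    max_le Nat.one_le_two_pow (Nat.lt_size_self _).le
  calc height q ≤ 2 ^ q.num.natAbs.size * 2 ^ q.den.size :=
        Nat.mul_le_mul h1 (Nat.lt_size_self _).le
    _ = 2 ^ (q.num.natAbs.size + q.den.size) := (pow_add _ _ _).symm
    _ ≤ _ := Nat.pow_le_pow_right (by norm_num) (Nat.le_succ _)

theorem scaled_of_height_dvd {q : ℚ} (hD : 0 < D) (h : height q ∣ D) : Scaled D 1 q := by
  obtain ⟨c, hc⟩ := (Dvd.intro_left _ rfl : q.den ∣ height q).trans h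
  have hle : q.num.natAbs ≤ D :=
    (le_max_right 1 _).trans ((Nat.le_mul_of_pos_right _ q.den_pos).trans (Nat.le_of_dvd hD h))
  have hden : (1 : ℚ) ≤ q.den := by exact_mod_cast q.den_pos
  have habs : |q| * q.den = q.num.natAbs := by
    rw [Nat.cast_natAbs, Int.cast_abs, ← Rat.mul_den_eq_num, abs_mul, Nat.abs_cast]
  rw [Scaled, pow_one]
  refine ⟨⟨q.num * c, ?_⟩, ?_⟩
  · rw [hc]
    push_cast
    rw [← mul_assoc, Rat.mul_den_eq_num]
  · calc |q| ≤ |q| * q.den := le_mul_of_one_le_right (abs_nonneg q) hden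
      _ = q.num.natAbs := habs
      _ ≤ D := by exact_mod_cast hle

/-- The height is symmetric in numerator and denominator, so the same D also serves for the
reciprocals of prices in the coefficients. The maximum with 1 keeps it positive at zero. -/
theorem height_inv_dvd (q : ℚ) : height (1 / q) ∣ height q := by
  by_cases hq : q = 0
  · rw [hq]; simp
  · have hn : q.num.natAbs ≠ 0 := by simpa using hq
    have h1 : (q⁻¹).num.natAbs = q.den := by
      rw [Rat.num_inv]; simp [Int.natAbs_mul, Int.natAbs_sign_of_ne_zero, hq]
    have h2 : (q⁻¹).den = q.num.natAbs := by
      rw [Rat.den_inv_of_ne_zero hq]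
    rw [one_div, height, height, h1, h2, max_eq_right (Nat.one_le_iff_ne_zero.2 hn),
      max_eq_right q.den_pos, mul_comm]

end RandomAccess

namespace FixedPricingMarket

open RandomAccess

variable {n m : ℕ} (M : FixedPricingMarket ℚ n m)

/-- A common multiple of the heights of the numbers of a market. -/
def commonHeight : ℕ :=
  -- The factor 2 guarantees D ≥ 2 even if all heights are 1.
  2 * ((∏ i, ∏ j, height (M.value i j) * height (M.price i j)) * ∏ i, height (M.budget i))

theorem commonHeight_le : M.commonHeight ≤ 2 ^ (M.inputBits + 1) := by
  have h1 : (∏ i, ∏ j, height (M.value i j) * height (M.price i j)) ≤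
      2 ^ (∑ i, ∑ j, (ratBits (M.value i j) + ratBits (M.price i j))) := by
    rw [← Finset.prod_pow_eq_pow_sum]
    refine Finset.prod_le_prod' fun i _ => ?_
    rw [← Finset.prod_pow_eq_pow_sum]
    refine Finset.prod_le_prod' fun j _ => ?_
    rw [pow_add]
    exact Nat.mul_le_mul (height_le _) (height_le _)
  have h2 : (∏ i, height (M.budget i)) ≤ 2 ^ (∑ i, ratBits (M.budget i)) := by
    rw [← Finset.prod_pow_eq_pow_sum]
    exact Finset.prod_le_prod' fun i _ => height_le _
  calc M.commonHeight ≤ 2 * (2 ^ _ * 2 ^ _) := Nat.mul_le_mul_left _ (Nat.mul_le_mul h1 h2)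
    _ = 2 ^ (_ + 1) := by rw [← pow_add, pow_succ']
    _ ≤ 2 ^ (M.inputBits + 1) := Nat.pow_le_pow_right (by norm_num) (by unfold inputBits; omega)

theorem height_value_dvd (i : Fin n) (j : Fin m) : height (M.value i j) ∣ M.commonHeight :=
  (((Dvd.intro _ rfl : height (M.value i j) ∣ height (M.value i j) * height (M.price i j)).trans
    ((Finset.dvd_prod_of_mem (fun j => height (M.value i j) * height (M.price i j))
      (Finset.mem_univ j)).trans
      (Finset.dvd_prod_of_mem (fun i => ∏ j, height (M.value i j) * height (M.price i j))
      (Finset.mem_univ i)))).mul_right _).mul_left _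

theorem height_price_dvd (i : Fin n) (j : Fin m) : height (M.price i j) ∣ M.commonHeight :=
  (((Dvd.intro_left _ rfl : height (M.price i j) ∣
    height (M.value i j) * height (M.price i j)).trans
    ((Finset.dvd_prod_of_mem (fun j => height (M.value i j) * height (M.price i j))
      (Finset.mem_univ j)).trans
      (Finset.dvd_prod_of_mem (fun i => ∏ j, height (M.value i j) * height (M.price i j))
      (Finset.mem_univ i)))).mul_right _).mul_left _

theorem height_budget_dvd (i : Fin n) : height (M.budget i) ∣ M.commonHeight :=
  ((Finset.dvd_prod_of_mem (fun i => height (M.budget i)) (Finset.mem_univ i)).mul_left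
    _).mul_left _

theorem two_le_commonHeight : 2 ≤ M.commonHeight := by
  refine Nat.le_mul_of_pos_right _ (Nat.mul_pos ?_ ?_)
  · exact Finset.prod_pos fun i _ => Finset.prod_pos fun j _ =>
      Nat.mul_pos (height_pos _) (height_pos _)
  · exact Finset.prod_pos fun i _ => height_pos _

theorem scaled_input_val (a i j k : ℕ) : Scaled M.commonHeight 1 (M.input.val a i j k) := by
  have hD := M.two_le_commonHeight
  refine M.input_val (Scaled M.commonHeight 1) ?_ (fun i j => ?_) (fun i j => ?_) (fun i => ?_)
    a i j k
  · exact_mod_cast scaled_intCast_of_natAbs_le (c := 0) hD (by simp)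
  · exact scaled_of_height_dvd (by omega) (M.height_value_dvd i j)
  · exact scaled_of_height_dvd (by omega) (M.height_price_dvd i j)
  · exact scaled_of_height_dvd (by omega) (M.height_budget_dvd i)

theorem scaledMarket_indexed : ScaledMarket M.commonHeight M.indexed := by
  have hD := M.two_le_commonHeight
  refine ⟨fun i j => M.scaled_input_val 1 i j 0, fun i j => ?_,
    fun i => M.scaled_input_val 2 i 0 0⟩
  by_cases h : i < n ∧ j < m
  · rw [show M.indexed.price i j = _ from M.indexed_price ⟨i, h.1⟩ ⟨j, h.2⟩]
    exact scaled_of_height_dvd (by omega) ((height_inv_dvd _).trans (M.height_price_dvd _ _))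
  · have : M.indexed.price i j = 0 := by
      simp only [indexed, input]
      rw [dif_neg (by simp), dif_neg (by tauto), dif_neg (by simp)]
    rw [this, div_zero]
    exact_mod_cast scaled_intCast_of_natAbs_le (c := 0) hD (by simp)

end FixedPricingMarket

namespace RandomAccess

/-- A bound on the charge of an operation, for numbers that occur in the algorithm. -/
def unitBound (S : ℕ) : ℕ :=
  300 * (S + 2 + 1) + 1 + (4 * (300 * (maxLevel S + 1)) * (S + 1) + 3)

theorem exists_exec_rat {n m : ℕ} (M : FixedPricingMarket ℚ n m) :
    ∃ t c, Exec bitCost stableAllocationProgram M.input t c ∧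
      c ≤ totalSteps (n + m) * (1201 * unitBound M.inputBits) ∧
      M.toReal.IsStableAllocation fun i j => ((t.output n m i j : ℚ) : ℝ) := by
  have hD := M.two_le_commonHeight
  have hφ : StrictMono (Rat.castHom ℝ) := fun a b h => by
    simpa using h
  obtain ⟨t, c, hex, hc, -, ht⟩ := run_stableAllocationProgram
    (Λ := bitMeter M.commonHeight (M.inputBits + 1) (n + m + 2) (maxLevel (n + m)) hD
      M.commonHeight_le)
    (Rat.castHom ℝ) hφ M.indexed_valid (bitMeter_fits hD _ le_rfl M.scaledMarket_indexed)
    M.encodes_input (M.input_idx_eq_zero (by decide)) (M.input_idx_eq_zero (by decide))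
    ⟨M.input_idx_le, fun a i j k => ((M.scaled_input_val a i j k).mono hD
      (by simp only [bitMeter, maxLevel]; omega)).quotient hD⟩
  refine ⟨t, c, hex, hc.trans (Nat.mul_le_mul_left _ (Nat.mul_le_mul_left _ ?_)),
    M.isStableAllocation_of_stable (Rat.castHom ℝ) hφ M.toReal
    (fun _ _ => rfl) (fun _ _ => rfl) (fun _ => rfl) (fun _ _ _ => Iff.rfl) ht⟩
  have hN : n + m ≤ M.inputBits := by unfold FixedPricingMarket.inputBits; omega
  simp only [bitMeter, unitBound, maxLevel]
  gcongr

/-! ## Polynomial bounds -/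

/-- The function is given by a polynomial. -/
def IsPolynomial (f : ℕ → ℕ) : Prop := ∃ q : Polynomial ℕ, ∀ N, q.eval N = f N

namespace IsPolynomial

variable {f g : ℕ → ℕ}

theorem const (c : ℕ) : IsPolynomial fun _ => c := ⟨Polynomial.C c, fun _ => by simp⟩

theorem id : IsPolynomial fun N => N := ⟨Polynomial.X, fun _ => by simp⟩

theorem add (hf : IsPolynomial f) (hg : IsPolynomial g) : IsPolynomial fun N => f N + g N := by
  obtain ⟨p, hp⟩ := hf
  obtain ⟨q, hq⟩ := hg
  exact ⟨p + q, fun N => by rw [Polynomial.eval_add, hp, hq]⟩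

theorem mul (hf : IsPolynomial f) (hg : IsPolynomial g) : IsPolynomial fun N => f N * g N := by
  obtain ⟨p, hp⟩ := hf
  obtain ⟨q, hq⟩ := hg
  exact ⟨p * q, fun N => by rw [Polynomial.eval_mul, hp, hq]⟩

theorem monotone (hf : IsPolynomial f) : Monotone f := by
  obtain ⟨q, hq⟩ := hf
  intro a b hab
  rw [← hq, ← hq, Polynomial.eval_eq_sum_range, Polynomial.eval_eq_sum_range]
  gcongr

end IsPolynomial

theorem isPolynomial_totalSteps : IsPolynomial totalSteps := by
  unfold totalSteps initSteps roundSteps solveSteps outputSteps nextItemSteps cutoffSteps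
    systemSteps searchSteps responseSteps affineSteps
  repeat' first
    | with_reducible exact IsPolynomial.const _ | with_reducible exact IsPolynomial.id
    | with_reducible apply IsPolynomial.add | with_reducible apply IsPolynomial.mul

theorem isPolynomial_unitBound : IsPolynomial unitBound := by
  unfold unitBound maxLevel
  repeat' first
    | with_reducible exact IsPolynomial.const _ | with_reducible exact IsPolynomial.id
    | with_reducible apply IsPolynomial.add | with_reducible apply IsPolynomial.mul

end RandomAccess

theorem theorem1 :
    -- existence
    (∀ (n m : ℕ) (M : FixedPricingMarket ℝ n m),
      ∃ x : Fin n → Fin m → ℝ, M.IsStableAllocation x) ∧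
    -- one algorithm, strongly polynomial
    ∃ P : RandomAccess.Program,
      -- on real data: polynomially many elementary operations in the numbers of buyers and items
      (∃ q : Polynomial ℕ, ∀ (n m : ℕ) (M : FixedPricingMarket ℝ n m),
        ∃ (t : RandomAccess.Store ℝ) (c : ℕ),
          RandomAccess.Exec (RandomAccess.unitCost ℝ) P M.input t c ∧
          c ≤ q.eval (n + m) ∧
          M.IsStableAllocation (t.output n m)) ∧
      -- on rational data: polynomially many bit operations in the bit length of the input,
      -- and the stable allocation has rational entries
      (∃ q : Polynomial ℕ, ∀ (n m : ℕ) (M : FixedPricingMarket ℚ n m),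
        ∃ (t : RandomAccess.Store ℚ) (c : ℕ),
          RandomAccess.Exec RandomAccess.bitCost P M.input t c ∧
          c ≤ q.eval M.inputBits ∧
          M.toReal.IsStableAllocation (fun i j => ((t.output n m i j : ℚ) : ℝ))) := by
  open RandomAccess in
  refine ⟨fun n m M => ?_, stableAllocationProgram, ?_, ?_⟩
  · obtain ⟨t, -, -, -, ht⟩ := exists_exec_real M
    exact ⟨_, ht⟩
  · obtain ⟨q, hq⟩ := isPolynomial_totalSteps.mul (.const 1201)
    exact ⟨q, fun n m M => by rw [hq]; exact exists_exec_real M⟩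
  · obtain ⟨q, hq⟩ := isPolynomial_totalSteps.mul ((IsPolynomial.const 1201).mul
      isPolynomial_unitBound)
    refine ⟨q, fun n m M => ?_⟩
    obtain ⟨t, c, hex, hc, ht⟩ := exists_exec_rat M
    refine ⟨t, c, hex, ?_, ht⟩
    rw [hq]
    -- The number of steps is bounded in n + m, which is part of the bit length of the input;
    -- polynomials with natural coefficients are monotone.
    refine hc.trans (Nat.mul_le_mul_right _ (isPolynomial_totalSteps.monotone ?_))
    unfold FixedPricingMarket.inputBits
    omega
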